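/- Let $T$ be a finite tree with at least two vertices, rooted at $v_0$, with $g\ge 1$ edges $e_1,\dots,e_g$ directed away from $v_0$ and each identified with $[0,\ell]$, $\ell>0$. On the edges let real potentials $q_j\in L^2(0,\ell)$ be given. Let $T_\infty$ be obtained by attaching at $v_0$ a lead $e_0=[0,\infty)$, directed away from $v_0$, with $q_0=0$. The *standard conditions* at a vertex $v$ are: the values at $v$ of the functions on all edges incident to $v$ coincide, and $\sum_{e_j\text{ into }v}y_j'(\ell)-\sum_{e_k\text{ out of }v}y_k'(0)=0$. In $L^2(T)=\bigoplus_{j=1}^gL^2(0,\ell)$ let $L_D$ and $L_N$ be the operators $(y_j)\mapsto(-y_j''+q_jy_j)$ on those $(y_j)\in\bigoplus_j H^2(0,\ell)$ that satisfy the standard conditions at every vertex $v\ne v_0$ and, at $v_0$, the Dirichlet condition ($y_k(0)=0$ for all edges $e_k$ at $v_0$) for $L_D$, resp. the standard conditions in $T$ for $L_N$. Let $L_\infty$ be the operator $(y_j)_{j=0}^g\mapsto(-y_j''+q_jy_j)_{j=0}^g$ in $L^2(T_\infty)=L^2(0,\infty)\oplus L^2(T)$ on those $(y_j)\in H^2(0,\infty)\oplus\bigoplus_{j=1}^g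 H^2(0,\ell)$ that satisfy the standard conditions in $T_\infty$ at all vertices, including $v_0$. $\operatorname{Sp}$ denotes the spectrum; an eigenvalue is *isolated* if it is an isolated point of the spectrum; the essential spectrum of a self-adjoint operator is its spectrum without the isolated eigenvalues of finite multiplicity. For $\lambda\in\mathbb C$ let $c_j,s_j$ be the solutions of $-y''+q_jy=\lambda y$ on $[0,\ell]$ with $c_j(0)=1$, $c_j'(0)=0$, $s_j(0)=0$, $s_j'(0)=1$. Insert $y_j=a_jc_j+b_js_j$ into the vertex conditions of $L_D$, resp. $L_N$. This gives a homogeneous linear system of $2g$ equations for the $2g$ unknowns $a_1,\dots,a_g,b_1,\dots,b_g$, with matrix $\Phi_D(\lambda)$, resp. $\Phi_N(\lambda)$. Here, if $e_1,\dots,e_{d_0}$ are the edges at $v_0$, the conditions at $v_0$ are taken in the order $y_1(0),\dots,y_{d_0}(0)$ for $\Phi_D$, and $y_1(0)-y_2(0),\dots,y_1(0)-y_{d_0}(0),\ y_1'(0)+\dots+y_{d_0}'(0)$ for $\Phi_N$; these two lists occupy the same row positions. The other conditions are $y_j(\ell)-y_k(0)$ ($e_j$ into $v$, $e_k$ out of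 $v$, $v\neq v_0$) and $y_j'(\ell)-\sum_{e_k\text{ out of }v}y_k'(0)$ ($e_j$ into $v$, $v\neq v_0$). The order of the rows and of the columns is otherwise arbitrary, but the same for $\Phi_D$ and $\Phi_N$. Put $\phi_D=\det\Phi_D$, $\phi_N=\det\Phi_N$ and $$E(\zeta)=\phi_N(\zeta^2)+i\zeta\,\phi_D(\zeta^2),\qquad \zeta\in\mathbb C .$$ Let $\zeta=\sqrt\lambda\in\mathbb C$ be any number with $\zeta^2=\lambda\ne0$ and $\operatorname{Im}\zeta\ge0$. Then: (i) $\lambda$ is an eigenvalue of $L_\infty$ if and only if $E(\zeta)=0$. (ii) If $E(\zeta)=0$, then $\zeta$ is real or lies on the positive imaginary half line. (iii) If $\zeta$ is real (so $\lambda>0$), then $E(\zeta)=0$ if and only if $\lambda\in\operatorname{Sp}(L_N)\cap\operatorname{Sp}(L_D)$. In this case $\lambda$ is an eigenvalue of both $L_N$ and $L_D$, and it is an eigenvalue of $L_\infty$ that belongs to the essential spectrum of $L_\infty$. (iv) If $\zeta=i\kappa$ with $\kappa>0$ (so $\lambda<0$), then $E(\zeta)=0$ if and only if $\lambda$ is an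 isolated eigenvalue of $L_\infty$. In particular, every negative $\lambda\in\operatorname{Sp}(L_N)\cap\operatorname{Sp}(L_D)$ is an isolated eigenvalue of $L_\infty$. -/

import Mathlib

open MeasureTheory Set

noncomputable section

namespace QTree

/-! ## Spectral notions for unbounded operators -/

section Spectral

variable {H : Type*} [NormedAddCommGroup H] [NormedSpace ℂ H]

/-- `z` is in the resolvent set of `A` iff `A - z : dom A → H` is a bijection with bounded
everywhere defined inverse `R`. -/
def resolventSet (A : H →ₗ.[ℂ] H) : Set ℂ :=
  {z | ∃ R : H →L[ℂ] H,
    (∀ f : H, ∃ h : R f ∈ A.domain, A ⟨R f, h⟩ - z • R f = f) ∧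
    ∀ y : A.domain, R (A y - z • (y : H)) = y}

/-- The spectrum `Sp(A)`. -/
def Sp (A : H →ₗ.[ℂ] H) : Set ℂ := (resolventSet A)ᶜ

/-- The eigenspace `ker (A - z) = {y ∈ dom A : A y = z y}`. -/
def eigenspace (A : H →ₗ.[ℂ] H) (z : ℂ) : Submodule ℂ H :=
  A.graph.comap (LinearMap.prod LinearMap.id (z • LinearMap.id))

def IsEigenvalue (A : H →ₗ.[ℂ] H) (z : ℂ) : Prop := ∃ y ∈ eigenspace A z, y ≠ 0

/-- An eigenvalue that is an isolated point of the spectrum. -/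
def IsIsolatedEigenvalue (A : H →ₗ.[ℂ] H) (z : ℂ) : Prop :=
  IsEigenvalue A z ∧ ∃ ε > 0, ∀ w ∈ Sp A, dist w z < ε → w = z

/-- The essential spectrum of a self-adjoint operator: the points of the spectrum that are not
isolated eigenvalues of finite multiplicity. -/
def essSp (A : H →ₗ.[ℂ] H) : Set ℂ :=
  {z ∈ Sp A | ¬ (IsIsolatedEigenvalue A z ∧ FiniteDimensional ℂ (eigenspace A z))}

/-- An eigenvalue embedded into the essential spectrum. -/
def IsEmbeddedEigenvalue (A : H →ₗ.[ℂ] H) (z : ℂ) : Prop :=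
  IsEigenvalue A z ∧ z ∈ essSp A

end Spectral

/-! ## Sturm-Liouville operators on a finite family of intervals -/

/-- `u ∈ H²(I)` for an interval `I` of the form `[0, ℓ]` or `[0, ∞)` (end points are null sets),
with `u' = v` everywhere on `I` (one-sidedly at end points), `v` absolutely continuous, and
`u'' = v' = w` almost everywhere. -/
structure IsH2 (I : Set ℝ) (u v w : ℝ → ℂ) : Prop where
  memLp_u : MemLp u 2 (volume.restrict I)
  memLp_v : MemLp v 2 (volume.restrict I)
  memLp_w : MemLp w 2 (volume.restrict I)
  deriv_u : ∀ x ∈ I, HasDerivWithinAt u (v x) I x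
  integrable_w : ∀ x ∈ I, IntervalIntegrable w volume 0 x
  v_eq : ∀ x ∈ I, v x = v 0 + ∫ t in (0 : ℝ)..x, w t

theorem IsH2.zero (I : Set ℝ) : IsH2 I 0 0 0 where
  memLp_u := MemLp.zero
  memLp_v := MemLp.zero
  memLp_w := MemLp.zero
  deriv_u x _ := hasDerivWithinAt_const x I (0 : ℂ)
  integrable_w _ _ := intervalIntegrable_const
  v_eq x _ := by simp

theorem IsH2.add {I : Set ℝ} {u v w u' v' w' : ℝ → ℂ}
    (h : IsH2 I u v w) (h' : IsH2 I u' v' w') : IsH2 I (u + u') (v + v') (w + w') where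
  memLp_u := h.memLp_u.add h'.memLp_u
  memLp_v := h.memLp_v.add h'.memLp_v
  memLp_w := h.memLp_w.add h'.memLp_w
  deriv_u x hx := (h.deriv_u x hx).add (h'.deriv_u x hx)
  integrable_w x hx := (h.integrable_w x hx).add (h'.integrable_w x hx)
  v_eq x hx := by
    have := intervalIntegral.integral_add (h.integrable_w x hx) (h'.integrable_w x hx)
    simp only [Pi.add_apply]
    rw [this, h.v_eq x hx, h'.v_eq x hx]
    ring

theorem IsH2.smul {I : Set ℝ} {u v w : ℝ → ℂ} (a : ℂ)
    (h : IsH2 I u v w) : IsH2 I (a • u) (a • v) (a • w) where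
  memLp_u := h.memLp_u.const_smul a
  memLp_v := h.memLp_v.const_smul a
  memLp_w := h.memLp_w.const_smul a
  deriv_u x hx := (h.deriv_u x hx).const_smul a
  integrable_w x hx := (h.integrable_w x hx).const_mul a
  v_eq x hx := by
    simp only [Pi.smul_apply, smul_eq_mul]
    rw [intervalIntegral.integral_const_mul, h.v_eq x hx]
    ring

/-- If `u ∈ H²(I)` vanishes almost everywhere, so does `u''`. -/
theorem IsH2.ae_eq_zero {I : Set ℝ} (hI : I = Ici 0 ∨ ∃ l > 0, I = Icc 0 l) {u v w : ℝ → ℂ}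
    (h : IsH2 I u v w) (hu : u =ᵐ[volume.restrict I] 0) : w =ᵐ[volume.restrict I] 0 := by
  have hconv : Convex ℝ I := by
    rcases hI with rfl | ⟨l, hl, rfl⟩
    exacts [convex_Ici 0, convex_Icc 0 l]
  have hint : (interior I).Nonempty := by
    rcases hI with rfl | ⟨l, hl, rfl⟩
    · exact ⟨1, by simp⟩
    · exact ⟨l / 2, by simp [hl]⟩
  have h0I : (0 : ℝ) ∈ I := by
    rcases hI with rfl | ⟨l, hl, rfl⟩
    · simp
    · simp [hl.le]
  have hu0 : EqOn u 0 I := Measure.eqOn_of_ae_eq hu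
    (fun x hx => (h.deriv_u x hx).continuousWithinAt) continuousOn_const
    (by rw [hconv.closure_interior_eq_closure_of_nonempty_interior hint]; exact subset_closure)
  have hv0 : ∀ x ∈ I, v x = 0 := fun x hx =>
    (uniqueDiffOn_convex hconv hint x hx).eq_deriv I (h.deriv_u x hx)
      ((hasDerivWithinAt_const x I (0 : ℂ)).congr hu0 (hu0 hx))
  have hw0 : ∀ x ∈ I, ∫ t in (0 : ℝ)..x, w t = 0 := fun x hx => by
    have := h.v_eq x hx
    rw [hv0 x hx, hv0 0 h0I, zero_add] at this
    exact this.symm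
  have key : ∀ b ∈ I, ∀ᵐ x, x ∈ Ioo 0 b → w x = 0 := fun b hb => by
    filter_upwards [(h.integrable_w b hb).ae_hasDerivAt_integral] with x hx hxb
    have hb0 : (0 : ℝ) ≤ b := (hxb.1.trans hxb.2).le
    have h1 := hx (by rw [uIcc_of_le hb0]; exact Ioo_subset_Icc_self hxb) 0 (by simp)
    refine h1.unique ((hasDerivAt_const x (0 : ℂ)).congr_of_eventuallyEq ?_)
    filter_upwards [Ioo_mem_nhds hxb.1 hxb.2] with y hy
    exact hw0 y (hconv.ordConnected.out h0I hb (Ioo_subset_Icc_self hy))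
  have hne : ∀ c : ℝ, ∀ᵐ x : ℝ, x ≠ c := fun c => Measure.ae_ne volume c
  rw [Filter.EventuallyEq, ae_restrict_iff' (by
    rcases hI with rfl | ⟨l, hl, rfl⟩
    exacts [measurableSet_Ici, measurableSet_Icc])]
  rcases hI with rfl | ⟨l, hl, rfl⟩
  · have hall : ∀ᵐ x, ∀ n : ℕ, x ∈ Ioo 0 (n : ℝ) → w x = 0 :=
      ae_all_iff.2 fun n => key n (by simp)
    filter_upwards [hall, hne 0] with x hx hx0 hxI
    obtain ⟨n, hn⟩ := exists_nat_gt x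
    exact hx n ⟨lt_of_le_of_ne hxI (Ne.symm hx0), hn⟩
  · filter_upwards [key l ⟨hl.le, le_rfl⟩, hne 0, hne l] with x hx hx0 hxl hxI
    exact hx ⟨lt_of_le_of_ne hxI.1 (Ne.symm hx0), lt_of_le_of_ne hxI.2 hxl⟩

variable {ι : Type*}

/-- The Hilbert space `⨁ⱼ L²(Iⱼ)`. -/
abbrev L2Sum (I : ι → Set ℝ) : Type _ :=
  PiLp 2 (fun j => Lp ℂ 2 (volume.restrict (I j)))

/-- The graph of the operator `(yⱼ) ↦ (-yⱼ'' + qⱼ yⱼ)` in `⨁ⱼ L²(Iⱼ)` with domain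
`{(yⱼ) ∈ ⨁ⱼ H²(Iⱼ) : ((yⱼ), (yⱼ')) ∈ B}`, where `B` expresses linear boundary conditions on
the functions and their derivatives. -/
def slGraph (I : ι → Set ℝ) (q : ι → ℝ → ℝ)
    (B : Submodule ℂ ((ι → ℝ → ℂ) × (ι → ℝ → ℂ))) : Submodule ℂ (L2Sum I × L2Sum I) where
  carrier := {p | ∃ u v w : ι → ℝ → ℂ,
    (∀ j, IsH2 (I j) (u j) (v j) (w j)) ∧ (u, v) ∈ B ∧
    (∀ j, p.1 j =ᵐ[volume.restrict (I j)] u j) ∧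
    (∀ j, p.2 j =ᵐ[volume.restrict (I j)] fun x => -w j x + (q j x : ℂ) * u j x)}
  zero_mem' := by
    refine ⟨0, 0, 0, fun j => IsH2.zero _, B.zero_mem, fun j => ?_, fun j => ?_⟩
    · exact Lp.coeFn_zero _ _ _
    · filter_upwards [Lp.coeFn_zero ℂ 2 (volume.restrict (I j))] with x hx
      simpa using hx
  add_mem' := by
    rintro p p' ⟨u, v, w, h1, h2, h3, h4⟩ ⟨u', v', w', h1', h2', h3', h4'⟩
    refine ⟨u + u', v + v', w + w', fun j => (h1 j).add (h1' j), B.add_mem h2 h2',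
      fun j => ?_, fun j => ?_⟩
    · filter_upwards [Lp.coeFn_add (p.1 j) (p'.1 j), h3 j, h3' j] with x hx h h'
      exact hx.trans (by simp [h, h'])
    · filter_upwards [Lp.coeFn_add (p.2 j) (p'.2 j), h4 j, h4' j] with x hx h h'
      exact hx.trans (by simp only [Pi.add_apply, h, h']; ring)
  smul_mem' := by
    rintro a p ⟨u, v, w, h1, h2, h3, h4⟩
    refine ⟨a • u, a • v, a • w, fun j => (h1 j).smul a, B.smul_mem a h2,
      fun j => ?_, fun j => ?_⟩
    · filter_upwards [Lp.coeFn_smul a (p.1 j), h3 j] with x hx h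
      exact hx.trans (by simp [h])
    · filter_upwards [Lp.coeFn_smul a (p.2 j), h4 j] with x hx h
      exact hx.trans (by simp only [Pi.smul_apply, smul_eq_mul, h]; ring)

/-- The relation `slGraph` is the graph of an operator. -/
theorem slGraph_functional {I : ι → Set ℝ} (hI : ∀ j, I j = Ici 0 ∨ ∃ l > 0, I j = Icc 0 l)
    (q : ι → ℝ → ℝ) (B : Submodule ℂ ((ι → ℝ → ℂ) × (ι → ℝ → ℂ)))
    (p : L2Sum I × L2Sum I) (hp : p ∈ slGraph I q B) (h0 : p.1 = 0) : p.2 = 0 := by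
  obtain ⟨u, v, w, h1, -, h3, h4⟩ := hp
  ext1 j
  have hu : u j =ᵐ[volume.restrict (I j)] 0 := by
    filter_upwards [h3 j, Lp.coeFn_zero ℂ 2 (volume.restrict (I j))] with x hx hx0
    rw [← hx, h0]
    exact hx0
  refine Lp.ext ?_
  filter_upwards [h4 j, hu, (h1 j).ae_eq_zero (hI j) hu,
    Lp.coeFn_zero ℂ 2 (volume.restrict (I j))] with x hx hxu hxw hx0
  rw [hx]
  refine Eq.trans ?_ hx0.symm
  simp [hxu, hxw]

/-- The operator with graph `slGraph`. -/
def slOperator [Fintype ι] (I : ι → Set ℝ) (q : ι → ℝ → ℝ)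
    (B : Submodule ℂ ((ι → ℝ → ℂ) × (ι → ℝ → ℂ))) : L2Sum I →ₗ.[ℂ] L2Sum I :=
  (slGraph I q B).toLinearPMap

/-! ## Fundamental solutions on an edge -/

/-- `u` is a solution of `-y'' + q y = lam y` on `[0, ℓ]` with `u' = v`; here `v` is absolutely
continuous and the equation holds almost everywhere. -/
structure IsSLSolution (ℓ : ℝ) (q : ℝ → ℝ) (lam : ℂ) (u v : ℝ → ℂ) : Prop where
  deriv_u : ∀ x ∈ Icc 0 ℓ, HasDerivWithinAt u (v x) (Icc 0 ℓ) x
  v_eq : ∀ x ∈ Icc 0 ℓ, v x = v 0 + ∫ t in (0 : ℝ)..x, ((q t : ℂ) - lam) * u t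

/-- The pair `(y, y')`, where `y` is the solution of `-y'' + q y = lam y` on `[0, ℓ]` with
`y(0) = a`, `y'(0) = b` (it exists and is unique on `[0, ℓ]` for integrable `q`). -/
def slSol (ℓ : ℝ) (q : ℝ → ℝ) (lam a b : ℂ) : (ℝ → ℂ) × (ℝ → ℂ) :=
  Classical.epsilon fun p => IsSLSolution ℓ q lam p.1 p.2 ∧ p.1 0 = a ∧ p.2 0 = b

/-! ## The rooted metric tree -/

section Tree

variable {V : Type*} [Fintype V] (G : SimpleGraph V) (r : V)

/-- The edges of the tree `G`, directed away from the root `r`. -/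
def Edge : Type _ := {d : G.Dart // G.dist r d.snd = G.dist r d.fst + 1}

open scoped Classical in
instance : Fintype (Edge G r) :=
  inferInstanceAs (Fintype {d : G.Dart // G.dist r d.snd = G.dist r d.fst + 1})

instance : DecidableEq (Edge G r) := Classical.decEq _

variable {G r}

/-- The vertex that the edge goes out of; it corresponds to `x = 0`. -/
def Edge.tail (e : Edge G r) : V := e.1.fst

/-- The vertex that the edge comes into; it corresponds to `x = ℓ`. -/
def Edge.head (e : Edge G r) : V := e.1.snd

variable (G r)

open scoped Classical in
/-- The edges coming into `x`. -/
def inEdges (x : V) : Finset (Edge G r) := Finset.univ.filter fun e => e.head = x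

open scoped Classical in
/-- The edges going out of `x`. -/
def outEdges (x : V) : Finset (Edge G r) := Finset.univ.filter fun e => e.tail = x

/-- The standard conditions at all vertices other than the root, for a family `p.1` of functions
on the edges with family of derivatives `p.2`: continuity and Kirchhoff's condition (which
is the Neumann condition `y'(ℓ) = 0` at a pendant vertex). -/
def standardOffRoot (ℓ : ℝ) : Submodule ℂ ((Edge G r → ℝ → ℂ) × (Edge G r → ℝ → ℂ)) where
  carrier := {p | ∀ x : V, x ≠ r →
    (∀ j ∈ inEdges G r x, ∀ k ∈ outEdges G r x, p.1 j ℓ - p.1 k 0 = 0) ∧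
    (∑ j ∈ inEdges G r x, p.2 j ℓ) - ∑ k ∈ outEdges G r x, p.2 k 0 = 0}
  zero_mem' := fun x _ => by simp
  add_mem' := by
    intro p p' h h' x hx
    refine ⟨fun j hj k hk => ?_, ?_⟩
    · have a := (h x hx).1 j hj k hk
      have b := (h' x hx).1 j hj k hk
      simp only [Prod.fst_add, Pi.add_apply]
      linear_combination a + b
    · have a := (h x hx).2
      have b := (h' x hx).2
      simp only [Prod.snd_add, Pi.add_apply, Finset.sum_add_distrib]
      linear_combination a + b
  smul_mem' := by
    intro c p h x hx
    refine ⟨fun j hj k hk => ?_, ?_⟩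
    · have a := (h x hx).1 j hj k hk
      simp only [Prod.smul_fst, Pi.smul_apply, smul_eq_mul]
      linear_combination c * a
    · have a := (h x hx).2
      simp only [Prod.smul_snd, Pi.smul_apply, smul_eq_mul, ← Finset.mul_sum]
      linear_combination c * a

/-- The Dirichlet condition at the root. -/
def dirichletRoot : Submodule ℂ ((Edge G r → ℝ → ℂ) × (Edge G r → ℝ → ℂ)) where
  carrier := {p | ∀ k ∈ outEdges G r r, p.1 k 0 = 0}
  zero_mem' := fun k _ => by simp
  add_mem' := by
    intro p p' h h' k hk
    simp [h k hk, h' k hk]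
  smul_mem' := by
    intro c p h k hk
    simp [h k hk]

/-- The standard conditions at the root of the compact tree. -/
def standardRoot : Submodule ℂ ((Edge G r → ℝ → ℂ) × (Edge G r → ℝ → ℂ)) where
  carrier := {p | (∀ j ∈ outEdges G r r, ∀ k ∈ outEdges G r r, p.1 j 0 - p.1 k 0 = 0) ∧
    ∑ k ∈ outEdges G r r, p.2 k 0 = 0}
  zero_mem' := by simp
  add_mem' := by
    intro p p' h h'
    refine ⟨fun j hj k hk => ?_, ?_⟩
    · have a := h.1 j hj k hk
      have b := h'.1 j hj k hk
      simp only [Prod.fst_add, Pi.add_apply]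
      linear_combination a + b
    · simp only [Prod.snd_add, Pi.add_apply, Finset.sum_add_distrib]
      rw [h.2, h'.2, add_zero]
  smul_mem' := by
    intro c p h
    refine ⟨fun j hj k hk => ?_, ?_⟩
    · have a := h.1 j hj k hk
      simp only [Prod.smul_fst, Pi.smul_apply, smul_eq_mul]
      linear_combination c * a
    · simp only [Prod.smul_snd, Pi.smul_apply, smul_eq_mul, ← Finset.mul_sum]
      rw [h.2, mul_zero]

/-- The standard conditions at all vertices of the tree with a lead attached at the root. The
lead is the edge `none`. -/
def standardLead (ℓ : ℝ) :
    Submodule ℂ ((Option (Edge G r) → ℝ → ℂ) × (Option (Edge G r) → ℝ → ℂ)) where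
  carrier := {p |
    ((fun e => p.1 (some e)), (fun e => p.2 (some e))) ∈ standardOffRoot G r ℓ ∧
    (∀ k ∈ outEdges G r r, p.1 none 0 - p.1 (some k) 0 = 0) ∧
    p.2 none 0 + ∑ k ∈ outEdges G r r, p.2 (some k) 0 = 0}
  zero_mem' := ⟨(standardOffRoot G r ℓ).zero_mem, by simp, by simp⟩
  add_mem' := by
    intro p p' h h'
    refine ⟨(standardOffRoot G r ℓ).add_mem h.1 h'.1, fun k hk => ?_, ?_⟩
    · have a := h.2.1 k hk
      have b := h'.2.1 k hk
      simp only [Prod.fst_add, Pi.add_apply]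
      linear_combination a + b
    · have a := h.2.2
      have b := h'.2.2
      simp only [Prod.snd_add, Pi.add_apply, Finset.sum_add_distrib]
      linear_combination a + b
  smul_mem' := by
    intro c p h
    refine ⟨(standardOffRoot G r ℓ).smul_mem c h.1, fun k hk => ?_, ?_⟩
    · have a := h.2.1 k hk
      simp only [Prod.smul_fst, Pi.smul_apply, smul_eq_mul]
      linear_combination c * a
    · have a := h.2.2
      simp only [Prod.smul_snd, Pi.smul_apply, smul_eq_mul, ← Finset.mul_sum]
      linear_combination c * a

/-- The operator `L_D` in `L²(T)`. -/
def LD (ℓ : ℝ) (q : Edge G r → ℝ → ℝ) :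
    L2Sum (fun _ : Edge G r => Icc 0 ℓ) →ₗ.[ℂ] L2Sum (fun _ : Edge G r => Icc 0 ℓ) :=
  slOperator _ q (standardOffRoot G r ℓ ⊓ dirichletRoot G r)

/-- The operator `L_N` in `L²(T)`. -/
def LN (ℓ : ℝ) (q : Edge G r → ℝ → ℝ) :
    L2Sum (fun _ : Edge G r => Icc 0 ℓ) →ₗ.[ℂ] L2Sum (fun _ : Edge G r => Icc 0 ℓ) :=
  slOperator _ q (standardOffRoot G r ℓ ⊓ standardRoot G r)

/-- The edges of `T_∞` as intervals: `[0, ∞)` for the lead, `[0, ℓ]` for the edges of `T`. -/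
def leadInterval (ℓ : ℝ) : Option (Edge G r) → Set ℝ
  | none => Ici 0
  | some _ => Icc 0 ℓ

/-- The potential on `T_∞`; it vanishes on the lead. -/
def leadPotential (q : Edge G r → ℝ → ℝ) : Option (Edge G r) → ℝ → ℝ
  | none => 0
  | some e => q e

/-- The operator `L_∞` in `L²(T_∞)`. -/
def LInf (ℓ : ℝ) (q : Edge G r → ℝ → ℝ) :
    L2Sum (leadInterval G r ℓ) →ₗ.[ℂ] L2Sum (leadInterval G r ℓ) :=
  slOperator _ (leadPotential G r q) (standardLead G r ℓ)

/-! ## Characteristic matrices and the Jost function -/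

/-- An arrangement of the characteristic matrices: an enumeration `e₁, …, e_{d₀}` of the
`d₀ = m + 1` edges going out of the root, and arbitrary orders of the `2 g` boundary conditions
(common to both problems) and of the `2 g` unknowns `a_j`, `b_j`.
The boundary conditions are: the `d₀` conditions at the root, one continuity condition for each
edge `k` that does not start at the root (at the vertex where it starts), and one Kirchhoff
condition for each vertex other than the root. -/
structure Arrangement where
  m : ℕ
  rootEdge : Fin (m + 1) ≃ {e : Edge G r // e.tail = r}
  row : Fin (m + 1) ⊕ {e : Edge G r // e.tail ≠ r} ⊕ {x : V // x ≠ r} ≃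
    Fin (2 * Fintype.card (Edge G r))
  col : Edge G r ⊕ Edge G r ≃ Fin (2 * Fintype.card (Edge G r))

variable {G r}

/-- The index type of the boundary conditions, before they are put in order. -/
abbrev Arrangement.Cond (N : Arrangement G r) : Type _ :=
  Fin (N.m + 1) ⊕ {e : Edge G r // e.tail ≠ r} ⊕ {x : V // x ≠ r}

/-- The left hand sides of the standard conditions at the vertices other than the root, for a
family `u` of functions on the edges with derivatives `v`. The first sum has exactly one term,
given by the edge that comes into the starting vertex of `k`. -/
def offRootForm (ℓ : ℝ) (u v : Edge G r → ℝ → ℂ) :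
    {e : Edge G r // e.tail ≠ r} ⊕ {x : V // x ≠ r} → ℂ
  | .inl k => (∑ j ∈ inEdges G r k.1.tail, u j ℓ) - u k.1 0
  | .inr x => (∑ j ∈ inEdges G r x.1, v j ℓ) - ∑ k ∈ outEdges G r x.1, v k 0

/-- The left hand sides of the boundary conditions of Problem D; at the root they are
`y₁(0), …, y_{d₀}(0)`, in this order. -/
def Arrangement.formD (N : Arrangement G r) (ℓ : ℝ) (u v : Edge G r → ℝ → ℂ) : N.Cond → ℂ
  | .inl k => u (N.rootEdge k) 0
  | .inr i => offRootForm ℓ u v i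

/-- The left hand sides of the boundary conditions of Problem N; at the root they are
`y₁(0) - y₂(0), …, y₁(0) - y_{d₀}(0), y₁'(0) + … + y_{d₀}'(0)`, in this order. -/
def Arrangement.formN (N : Arrangement G r) (ℓ : ℝ) (u v : Edge G r → ℝ → ℂ) : N.Cond → ℂ
  | .inl k =>
      Fin.lastCases (motive := fun _ => ℂ) (∑ j, v (N.rootEdge j) 0)
        (fun i => u (N.rootEdge 0) 0 - u (N.rootEdge i.succ) 0) k
  | .inr i => offRootForm ℓ u v i

/-- The families `(y_j)`, `(y_j')` obtained from `y_j = a_j c_j + b_j s_j` when one of the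
unknowns `a_j` (for `inl`), `b_j` (for `inr`) is `1` and all others are `0`. -/
def basisFamily (ℓ : ℝ) (q : Edge G r → ℝ → ℝ) (lam : ℂ) :
    Edge G r ⊕ Edge G r → (Edge G r → ℝ → ℂ) × (Edge G r → ℝ → ℂ)
  | .inl e => (Pi.single e (slSol ℓ (q e) lam 1 0).1, Pi.single e (slSol ℓ (q e) lam 1 0).2)
  | .inr e => (Pi.single e (slSol ℓ (q e) lam 0 1).1, Pi.single e (slSol ℓ (q e) lam 0 1).2)

/-- The characteristic matrix of Problem D. -/
def Arrangement.PhiD (N : Arrangement G r) (ℓ : ℝ) (q : Edge G r → ℝ → ℝ) (lam : ℂ) :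
    Matrix (Fin (2 * Fintype.card (Edge G r))) (Fin (2 * Fintype.card (Edge G r))) ℂ :=
  Matrix.reindex N.row N.col (Matrix.of fun i k =>
    N.formD ℓ (basisFamily ℓ q lam k).1 (basisFamily ℓ q lam k).2 i)

/-- The characteristic matrix of Problem N. -/
def Arrangement.PhiN (N : Arrangement G r) (ℓ : ℝ) (q : Edge G r → ℝ → ℝ) (lam : ℂ) :
    Matrix (Fin (2 * Fintype.card (Edge G r))) (Fin (2 * Fintype.card (Edge G r))) ℂ :=
  Matrix.reindex N.row N.col (Matrix.of fun i k =>
    N.formN ℓ (basisFamily ℓ q lam k).1 (basisFamily ℓ q lam k).2 i)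

/-- The characteristic function `φ_D`. -/
def Arrangement.phiD (N : Arrangement G r) (ℓ : ℝ) (q : Edge G r → ℝ → ℝ) (lam : ℂ) : ℂ :=
  (N.PhiD ℓ q lam).det

/-- The characteristic function `φ_N`. -/
def Arrangement.phiN (N : Arrangement G r) (ℓ : ℝ) (q : Edge G r → ℝ → ℝ) (lam : ℂ) : ℂ :=
  (N.PhiN ℓ q lam).det

/-- The Jost function `E`, as a function of `ζ = √lam`. -/
def Arrangement.jost (N : Arrangement G r) (ℓ : ℝ) (q : Edge G r → ℝ → ℝ) (ζ : ℂ) : ℂ :=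
  N.phiN ℓ q (ζ ^ 2) + Complex.I * ζ * N.phiD ℓ q (ζ ^ 2)

end Tree

/-- Arrangements exist for every tree with at least two vertices. -/
theorem Arrangement.nonempty {V : Type*} [Fintype V] [Nontrivial V] {G : SimpleGraph V}
    (hG : G.IsTree) (r : V) : Nonempty (Arrangement G r) := by
  classical
  have hsurj : ∀ x : V, x ≠ r → ∃ e : Edge G r, e.head = x := by
    intro x hx
    obtain ⟨p, hp⟩ := hG.connected.exists_walk_length_eq_dist r x
    have hnn : ¬ p.Nil := SimpleGraph.Walk.not_nil_of_ne (Ne.symm hx)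
    have hadj := p.adj_penultimate hnn
    have hl : p.dropLast.length + 1 = p.length := SimpleGraph.Walk.length_dropLast_add_one hnn
    have h1 : G.dist r p.penultimate ≤ p.dropLast.length := SimpleGraph.dist_le _
    have h2 : G.dist r x ≤ G.dist r p.penultimate + 1 := by
      obtain ⟨p', hp'⟩ := hG.connected.exists_walk_length_eq_dist r p.penultimate
      rw [← hp', ← SimpleGraph.Walk.length_concat p' hadj]
      exact SimpleGraph.dist_le _
    exact ⟨⟨⟨(p.penultimate, x), hadj⟩, show G.dist r x = G.dist r p.penultimate + 1 by omega⟩, rfl⟩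
  have hinj : Function.Injective (fun e : Edge G r => e.1.edge) := by
    rintro ⟨d, hd⟩ ⟨d', hd'⟩ h
    apply Subtype.ext
    rcases SimpleGraph.dart_edge_eq_iff d d' |>.1 h with h | h
    · exact h
    · subst h
      simp only [SimpleGraph.Dart.symm_toProd, Prod.fst_swap, Prod.snd_swap] at hd
      change G.dist r d'.fst = G.dist r d'.snd + 1 at hd
      omega
  have hle : Fintype.card (Edge G r) ≤ G.edgeFinset.card := by
    rw [← Finset.card_univ]
    exact Finset.card_le_card_of_injOn (fun e => e.1.edge)
      (fun e _ => by simp [SimpleGraph.Dart.edge_mem]) (hinj.injOn)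
  have htree := hG.card_edgeFinset
  have hge : Fintype.card {x : V // x ≠ r} ≤ Fintype.card (Edge G r) := by
    choose f hf using hsurj
    exact Fintype.card_le_of_injective (fun x : {x : V // x ≠ r} => f x.1 x.2) (fun x y h =>
      Subtype.ext (by rw [← hf x.1 x.2, ← hf y.1 y.2]; exact congrArg _ h))
  have hV : Fintype.card {x : V // x ≠ r} + 1 = Fintype.card V := by
    rw [Fintype.card_subtype_compl, Fintype.card_subtype_eq]
    have := Fintype.card_pos_iff.2 (⟨r⟩ : Nonempty V)
    omega
  have hcompl : Fintype.card {e : Edge G r // e.tail ≠ r} = _ := Fintype.card_subtype_compl (fun e : Edge G r => e.tail = r)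
  have hsub := Fintype.card_subtype_le (fun e : Edge G r => e.tail = r)
  have hpos : 0 < Fintype.card {e : Edge G r // e.tail = r} := by
    obtain ⟨x, hx⟩ := exists_ne r
    obtain ⟨y, hy⟩ := hG.connected.preconnected.exists_adj_of_nontrivial r
    refine Fintype.card_pos_iff.2 ⟨⟨⟨⟨(r, y), hy⟩, ?_⟩, rfl⟩⟩
    change G.dist r y = G.dist r r + 1
    rw [SimpleGraph.dist_self, SimpleGraph.dist_eq_one_iff_adj.2 hy]
  obtain ⟨m, hm⟩ := Nat.exists_eq_succ_of_ne_zero hpos.ne'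
  refine ⟨⟨m, (Fintype.equivFinOfCardEq hm).symm, Fintype.equivFinOfCardEq ?_,
    Fintype.equivFinOfCardEq ?_⟩⟩
  · simp only [Fintype.card_sum, Fintype.card_fin]
    omega
  · rw [Fintype.card_sum]; omega

end QTree

end

open MeasureTheory Set

noncomputable section

namespace QTree

/-! Everything rests on the observation that `E(ζ)` is itself a characteristic determinant. A square
integrable solution of `-u'' = ζ² u` on the lead with `Im ζ ≥ 0` satisfies `u' = iζ u`
(`IsH2.lead_deriv_eq`). Seen from the tree, the lead therefore acts as the Robin condition `∑
y_k'(0) + iζ y(v₀) = 0` at the root. The determinant of the Robin problem with parameter `h` is `φ_N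
+ h φ_D` (`Arrangement.det_charMatrix_linR`), and `h = iζ` gives `E`. So `E(ζ) = 0` iff the tree
carries a nontrivial solution with this Robin condition, and such a solution extends to the lead by
`c e^{iζx}`. For real `ζ` the exponential is not in `L²`, but there `c = 0`, as the next identity
shows.

Green's identity on the tree leaves only boundary terms at the root (`sum_green`). For a Robin
solution with root value `c` it reads `Re ζ (2 Im ζ ∑‖u‖² + |c|²) = 0` (`re_mul_eq_zero`). If `Im ζ
> 0`, this forces `Re ζ = 0`. If `ζ ≠ 0` is real, it forces `c = 0`, so the solution satisfies the
Dirichlet and the standard conditions at once and is an eigenfunction of both `L_D` and `L_N`.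
Conversely, a real spectral point of `L_D` or `L_N` is a zero of `φ_D` or `φ_N`, because a nonzero
determinant makes the inhomogeneous problem solvable.

Spectra are controlled without adjoints: for a symmetric operator, surjectivity of `A - z` and `A -
conj z` already puts `z` in the resolvent set (`mem_resolventSet_of_symmetric`). Surjectivity of
`L_∞ - ζ²` for `Im ζ > 0` and `E(ζ) ≠ 0` is `Arrangement.surjective_LInf`. Since `E` is entire and
has no zeros in the open upper half plane off the imaginary axis, its zeros `iκ` are isolated, and
so are the corresponding eigenvalues. By contrast all of `(0, ∞)` is in the spectrum of `L_∞`
(`mem_Sp_LInf_of_pos`), so positive eigenvalues are never isolated. -/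

/-! ### Calculus of absolutely continuous complex functions -/

/-- `F` is a primitive of the integrable function `φ` on `[0, l]`. -/
structure IsPrim (l : ℝ) (F φ : ℝ → ℂ) : Prop where
  int : IntervalIntegrable φ volume 0 l
  eq : ∀ x ∈ Icc 0 l, F x = F 0 + ∫ t in (0 : ℝ)..x, φ t

/-- The indefinite integrals of `Re φ` and `Im φ` are absolutely continuous by the real-valued
theorem; multiplying by the constants `1` and `i` and adding recovers the complex integral. -/
theorem absolutelyContinuous_integral {φ : ℝ → ℂ} {l : ℝ}
    (h : IntervalIntegrable φ volume 0 l) :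
    AbsolutelyContinuousOnInterval (fun x => ∫ t in (0 : ℝ)..x, φ t) 0 l := by
  have hre : IntervalIntegrable (fun t => (φ t).re) volume 0 l :=
    ⟨h.1.re, h.2.re⟩
  have him : IntervalIntegrable (fun t => (φ t).im) volume 0 l :=
    ⟨h.1.im, h.2.im⟩
  have hc : ∀ c : ℂ, AbsolutelyContinuousOnInterval (fun _ : ℝ => c) 0 l := fun c =>
    (LipschitzWith.const c).lipschitzOnWith.absolutelyContinuousOnInterval (K := 0)
  have h1 := ((hre.absolutelyContinuousOnInterval_intervalIntegral left_mem_uIcc).smul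
    (hc 1)).add ((him.absolutelyContinuousOnInterval_intervalIntegral left_mem_uIcc).smul
    (hc Complex.I))
  have hac : ∀ x ∈ uIcc 0 l, (∫ t in (0 : ℝ)..x, φ t) =
      (∫ t in (0 : ℝ)..x, (φ t).re) • (1 : ℂ) +
       (∫ t in (0 : ℝ)..x, (φ t).im) • Complex.I := by
    intro x hx
    have hx' : IntervalIntegrable φ volume 0 x :=
      h.mono_set (uIcc_subset_uIcc left_mem_uIcc hx)
    have e1 : ∫ t in (0 : ℝ)..x, (φ t).re = (∫ t in (0 : ℝ)..x, φ t).re :=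
      Complex.reCLM.intervalIntegral_comp_comm hx'
    have e2 : ∫ t in (0 : ℝ)..x, (φ t).im = (∫ t in (0 : ℝ)..x, φ t).im :=
      Complex.imCLM.intervalIntegral_comp_comm hx'
    simp only [e1, e2, Complex.real_smul, mul_one]
    exact (Complex.re_add_im _).symm
  rw [absolutelyContinuousOnInterval_iff] at h1 ⊢
  intro ε hε
  obtain ⟨δ, hδ, H⟩ := h1 ε hε
  refine ⟨δ, hδ, fun E hE hs => ?_⟩
  convert H E hE hs using 2 with i hi
  have := hE.1 i hi
  rw [hac _ this.1, hac _ this.2]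
  rfl

theorem IsPrim.absolutelyContinuous {l : ℝ} (hl : 0 ≤ l) {F φ : ℝ → ℂ} (h : IsPrim l F φ) :
    AbsolutelyContinuousOnInterval F 0 l := by
  have hc : AbsolutelyContinuousOnInterval (fun _ : ℝ => F 0) 0 l :=
    (LipschitzWith.const (F 0)).lipschitzOnWith.absolutelyContinuousOnInterval (K := 0)
  have h1 := hc.add (absolutelyContinuous_integral h.int)
  rw [absolutelyContinuousOnInterval_iff] at h1 ⊢
  intro ε hε
  obtain ⟨δ, hδ, H⟩ := h1 ε hε
  refine ⟨δ, hδ, fun E hE hs => ?_⟩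
  convert H E hE hs using 2 with i hi
  have := hE.1 i hi
  rw [uIcc_of_le hl] at this
  rw [h.eq _ this.1, h.eq _ this.2]
  rfl

theorem IsPrim.continuousOn {l : ℝ} (hl : 0 ≤ l) {F φ : ℝ → ℂ} (h : IsPrim l F φ) :
    ContinuousOn F (Icc 0 l) := by
  simpa [uIcc_of_le hl] using (h.absolutelyContinuous hl).continuousOn

theorem IsPrim.ae_hasDerivAt {l : ℝ} (hl : 0 ≤ l) {F φ : ℝ → ℂ} (h : IsPrim l F φ) :
    ∀ᵐ x, x ∈ Icc 0 l → HasDerivAt F (φ x) x := by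
  filter_upwards [h.int.ae_hasDerivAt_integral, Measure.ae_ne volume (0 : ℝ),
    Measure.ae_ne volume l] with x hx hx0 hxl hxI
  have h1 := hx (by rwa [uIcc_of_le hl]) 0 left_mem_uIcc
  refine (h1.const_add (F 0)).congr_of_eventuallyEq ?_
  filter_upwards [Icc_mem_nhds (lt_of_le_of_ne hxI.1 (Ne.symm hx0))
    (lt_of_le_of_ne hxI.2 hxl)] with y hy
  exact h.eq y hy

/-- Product rule for absolutely continuous functions. -/
theorem IsPrim.mul {l : ℝ} (hl : 0 ≤ l) {F φ G γ : ℝ → ℂ} (hF : IsPrim l F φ)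
    (hG : IsPrim l G γ) :
    IsPrim l (fun x => F x * G x) (fun x => φ x * G x + F x * γ x) := by
  have hFc := hF.continuousOn hl
  have hGc := hG.continuousOn hl
  have hint : IntervalIntegrable (fun x => φ x * G x + F x * γ x) volume 0 l :=
    (hF.int.mul_continuousOn (by rwa [uIcc_of_le hl])).add
      (hG.int.continuousOn_mul (by rwa [uIcc_of_le hl]))
  refine ⟨hint, ?_⟩
  -- The difference of `F G` and the claimed primitive is absolutely continuous with derivative zero
  -- almost everywhere, hence constant.
  have hac := ((hF.absolutelyContinuous hl).smul (hG.absolutelyContinuous hl)).sub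
    (absolutelyContinuous_integral hint)
  have hd : ∀ᵐ x, x ∈ uIcc 0 l → HasDerivAt (F • G - fun x => ∫ t in (0 : ℝ)..x,
      (φ t * G t + F t * γ t)) 0 x := by
    filter_upwards [hF.ae_hasDerivAt hl, hG.ae_hasDerivAt hl, hint.ae_hasDerivAt_integral]
      with x h1 h2 h3 hx
    have hx' := hx
    rw [uIcc_of_le hl] at hx'
    have := ((h1 hx').mul (h2 hx')).sub (h3 hx 0 left_mem_uIcc)
    rw [sub_self] at this
    exact this
  obtain ⟨C, hC⟩ := hac.const_of_ae_hasDerivAt_zero hd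
  intro x hx
  have e1 := hC x (by rwa [uIcc_of_le hl])
  have e2 := hC 0 left_mem_uIcc
  simp only [Pi.sub_apply, Pi.mul_apply, smul_eq_mul, intervalIntegral.integral_same] at e1 e2
  linear_combination e1 - e2

theorem IsPrim.of_hasDerivWithinAt {l : ℝ} {F φ : ℝ → ℂ}
    (h : ∀ x ∈ Icc 0 l, HasDerivWithinAt F (φ x) (Icc 0 l) x) (hφ : ContinuousOn φ (Icc 0 l))
    (hl : 0 ≤ l) : IsPrim l F φ := by
  have hi : ∀ x ∈ Icc 0 l, IntervalIntegrable φ volume 0 x := fun x hx => by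
    refine ContinuousOn.intervalIntegrable ?_
    rw [uIcc_of_le hx.1]
    exact hφ.mono (Icc_subset_Icc_right hx.2)
  refine ⟨hi l ⟨hl, le_rfl⟩, fun x hx => ?_⟩
  rw [intervalIntegral.integral_eq_sub_of_hasDeriv_right_of_le hx.1
    (f := F) (fun y hy => ((h y ⟨hy.1, hy.2.trans hx.2⟩).continuousWithinAt).mono
      (Icc_subset_Icc_right hx.2)) (fun y hy => ?_) (hi x hx)]
  · ring
  · exact ((h y ⟨hy.1.le, hy.2.le.trans hx.2⟩).hasDerivAt
      (Icc_mem_nhds hy.1 (hy.2.trans_le hx.2))).hasDerivWithinAt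

theorem IsPrim.hasDerivWithinAt {l : ℝ} (hl : 0 < l) {F φ : ℝ → ℂ} (h : IsPrim l F φ)
    (hφ : ContinuousOn φ (Icc 0 l)) {x : ℝ} (hx : x ∈ Icc 0 l) :
    HasDerivWithinAt F (φ x) (Icc 0 l) x := by
  have := Fact.mk hx
  have h1 : HasDerivWithinAt (fun u => ∫ t in (0 : ℝ)..u, φ t) (φ x) (Icc 0 l) x :=
    intervalIntegral.integral_hasDerivWithinAt_right
      (h.int.mono_set (by rw [uIcc_of_le hl.le, uIcc_of_le hx.1]; exact Icc_subset_Icc_right hx.2))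
      (hφ.stronglyMeasurableAtFilter_nhdsWithin measurableSet_Icc x) (hφ x hx)
  exact (h1.const_add (F 0)).congr (fun y hy => h.eq y hy) (h.eq x hx)

theorem IsPrim.conj {l : ℝ} {F φ : ℝ → ℂ} (h : IsPrim l F φ) :
    IsPrim l (fun x => starRingEnd ℂ (F x)) (fun x => starRingEnd ℂ (φ x)) := by
  have e : ∀ x, ∫ t in (0 : ℝ)..x, starRingEnd ℂ (φ t) =
      starRingEnd ℂ (∫ t in (0 : ℝ)..x, φ t) := fun x => by
    simp only [intervalIntegral, integral_conj, map_sub]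
  refine ⟨⟨?_, ?_⟩, fun x hx => ?_⟩
  · exact Complex.conjCLE.integrable_comp_iff.2 h.int.1
  · exact Complex.conjCLE.integrable_comp_iff.2 h.int.2
  · rw [e, h.eq x hx, map_add]

theorem IsPrim.sub {l : ℝ} (hl : 0 ≤ l) {F φ G γ : ℝ → ℂ} (hF : IsPrim l F φ)
    (hG : IsPrim l G γ) : IsPrim l (fun x => F x - G x) (fun x => φ x - γ x) := by
  refine ⟨hF.int.sub hG.int, fun x hx => ?_⟩
  have hs : uIcc 0 x ⊆ uIcc 0 l := by
    rw [uIcc_of_le hl, uIcc_of_le hx.1]; exact Icc_subset_Icc_right hx.2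
  rw [intervalIntegral.integral_sub (hF.int.mono_set hs) (hG.int.mono_set hs), hF.eq x hx,
    hG.eq x hx]
  ring

theorem IsPrim.congr {l : ℝ} {F φ γ : ℝ → ℂ} (hF : IsPrim l F φ)
    (h : ∀ x, φ x = γ x) : IsPrim l F γ := by
  rwa [← funext h]

theorem IsPrim.linearComb {l : ℝ} (hl : 0 ≤ l) {F φ G γ : ℝ → ℂ} (hF : IsPrim l F φ)
    (hG : IsPrim l G γ) (a b : ℂ) :
    IsPrim l (fun x => a * F x + b * G x) (fun x => a * φ x + b * γ x) := by
  refine ⟨(hF.int.const_mul a).add (hG.int.const_mul b), fun x hx => ?_⟩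
  have hs : uIcc 0 x ⊆ uIcc 0 l := by
    rw [uIcc_of_le hl, uIcc_of_le hx.1]; exact Icc_subset_Icc_right hx.2
  rw [intervalIntegral.integral_add ((hF.int.mono_set hs).const_mul a)
    ((hG.int.mono_set hs).const_mul b), intervalIntegral.integral_const_mul,
    intervalIntegral.integral_const_mul, hF.eq x hx, hG.eq x hx]
  ring

theorem IsPrim.congr₂ {l : ℝ} {F φ G γ : ℝ → ℂ} (hF : IsPrim l F φ)
    (h' : ∀ x, F x = G x) (h : ∀ x, φ x = γ x) : IsPrim l G γ := by
  rwa [← funext h, ← funext h']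

/-! ### Lagrange's identity and Green's formula -/

section Green
variable {I : Set ℝ} {u v w u' v' w' : ℝ → ℂ}

theorem IsH2.isPrim_v (h : IsH2 I u v w) {b : ℝ} (hI : Icc 0 b ⊆ I) (hb : 0 ≤ b) :
    IsPrim b v w :=
  ⟨h.integrable_w b (hI ⟨hb, le_rfl⟩), fun x hx => h.v_eq x (hI hx)⟩

theorem IsH2.isPrim_u (h : IsH2 I u v w) {b : ℝ} (hI : Icc 0 b ⊆ I) (hb : 0 ≤ b) :
    IsPrim b u v :=
  .of_hasDerivWithinAt (fun x hx => (h.deriv_u x (hI hx)).mono hI)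
    ((h.isPrim_v hI hb).continuousOn hb) hb

/-- The Wronskian of `conj u` and `u'`. -/
def wronsk (u v u' v' : ℝ → ℂ) (x : ℝ) : ℂ :=
  starRingEnd ℂ (v x) * u' x - starRingEnd ℂ (u x) * v' x

/-- Lagrange's identity. -/
theorem IsH2.lagrange (h : IsH2 I u v w) (h' : IsH2 I u' v' w') {b : ℝ} (hI : Icc 0 b ⊆ I)
    (hb : 0 ≤ b) : IsPrim b (wronsk u v u' v')
      (fun x => starRingEnd ℂ (w x) * u' x - starRingEnd ℂ (u x) * w' x) := by
  have h1 := (h.isPrim_v hI hb).conj.mul hb (h'.isPrim_u hI hb)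
  have h2 := (h.isPrim_u hI hb).conj.mul hb (h'.isPrim_v hI hb)
  refine (h1.sub hb h2).congr fun x => ?_
  ring

theorem IsH2.integrableOn_lagrange (h : IsH2 I u v w) (h' : IsH2 I u' v' w') :
    IntegrableOn (fun x => starRingEnd ℂ (w x) * u' x - starRingEnd ℂ (u x) * w' x) I :=
  (h.memLp_w.star.integrable_mul h'.memLp_u).sub (h.memLp_u.star.integrable_mul h'.memLp_w)

theorem IsH2.green_Icc {l : ℝ} (hl : 0 ≤ l) (h : IsH2 (Icc 0 l) u v w)
    (h' : IsH2 (Icc 0 l) u' v' w') :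
    ∫ x in Icc 0 l, (starRingEnd ℂ (w x) * u' x - starRingEnd ℂ (u x) * w' x) =
      wronsk u v u' v' l - wronsk u v u' v' 0 := by
  rw [(h.lagrange h' subset_rfl hl).eq l ⟨hl, le_rfl⟩, integral_Icc_eq_integral_Ioc,
    ← intervalIntegral.integral_of_le hl]
  ring

/-- The Wronskian has an integrable derivative, so it converges at infinity. It is also integrable,
being built from products of `L²` functions, so its limit is `0` and only the boundary term at `0`
survives. -/
theorem IsH2.green_Ici (h : IsH2 (Ici 0) u v w) (h' : IsH2 (Ici 0) u' v' w') :
    ∫ x in Ici 0, (starRingEnd ℂ (w x) * u' x - starRingEnd ℂ (u x) * w' x) =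
      - wronsk u v u' v' 0 := by
  have hint := h.integrableOn_lagrange h'
  rw [integrableOn_Ici_iff_integrableOn_Ioi] at hint
  have ht := intervalIntegral_tendsto_integral_Ioi 0 hint Filter.tendsto_id
  have hW : Filter.Tendsto (wronsk u v u' v') Filter.atTop (nhds (wronsk u v u' v' 0 +
      ∫ x in Ioi 0, (starRingEnd ℂ (w x) * u' x - starRingEnd ℂ (u x) * w' x))) := by
    refine (ht.const_add _).congr' ?_
    filter_upwards [Filter.eventually_ge_atTop 0] with x hx
    exact ((h.lagrange h' Icc_subset_Ici_self hx).eq x ⟨hx, le_rfl⟩).symm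
  have hWi : IntegrableOn (wronsk u v u' v') (Ici 0) :=
    (h.memLp_v.star.integrable_mul h'.memLp_u).sub (h.memLp_u.star.integrable_mul h'.memLp_v)
  have h0 := IntegrableAtFilter.eq_zero_of_tendsto (μ := volume)
    ⟨Ici 0, Filter.Ici_mem_atTop 0, hWi⟩ (fun s hs => ?_) hW
  · rw [integral_Ici_eq_integral_Ioi]
    linear_combination h0
  · obtain ⟨a, ha⟩ := Filter.mem_atTop_sets.1 hs
    exact top_unique (by rw [← Real.volume_Ici (a := a)]; exact measure_mono ha)
end Green

/-! ### The Volterra equation on an edge -/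

theorem differentiable_inverse_affine {R : Type*} [NormedRing R] [HasSummableGeomSeries R]
    [NormedAlgebra ℂ R] (A B : R) (h : ∀ z : ℂ, IsUnit (1 - (A - z • B))) :
    Differentiable ℂ fun z : ℂ => Ring.inverse (1 - (A - z • B)) := fun z =>
  DifferentiableAt.comp (g := Ring.inverse) z (differentiableAt_inverse (𝕜 := ℂ) (h z))
    ((differentiableAt_const _).sub ((differentiableAt_const A).sub
      (differentiableAt_id.smul_const B)))

/-- `1 - K^n` is invertible and is the product of `1 - K` with the geometric sum of `K`. The two
factors commute, so each is invertible. -/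
theorem isUnit_one_sub_of_norm_pow_lt_one {R : Type*} [NormedRing R] [HasSummableGeomSeries R]
    {K : R} {n : ℕ} (h : ‖K ^ n‖ < 1) : IsUnit (1 - K) := by
  have hu := isUnit_one_sub_of_norm_lt_one h
  rw [← mul_neg_geom_sum] at hu
  exact ((Commute.isUnit_mul_iff (Commute.sum_right _ _ _ fun i _ =>
      ((Commute.one_left _).sub_left (Commute.self_pow K i)))).1 hu).1

section Volterra
variable {ℓ : ℝ} (hℓ : 0 ≤ ℓ)

theorem IccExtend_coe_of_mem (u : C(Icc (0 : ℝ) ℓ, ℂ)) {t : ℝ} (ht : t ∈ Icc 0 ℓ) :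
    IccExtend hℓ u t = u ⟨t, ht⟩ := IccExtend_of_mem hℓ u ht

theorem continuous_IccExtend (u : C(Icc (0 : ℝ) ℓ, ℂ)) : Continuous (IccExtend hℓ u) :=
  u.continuous.Icc_extend'

theorem norm_IccExtend_le (u : C(Icc (0 : ℝ) ℓ, ℂ)) (t : ℝ) : ‖IccExtend hℓ u t‖ ≤ ‖u‖ :=
  u.norm_coe_le_norm _

theorem intervalIntegrable_mul_IccExtend {g : ℝ → ℂ} (hg : IntervalIntegrable g volume 0 ℓ)
    (u : C(Icc (0 : ℝ) ℓ, ℂ)) :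
    IntervalIntegrable (fun t => g t * IccExtend hℓ u t) volume 0 ℓ :=
  hg.mul_continuousOn (continuous_IccExtend hℓ u).continuousOn

/-- Only the size of `u` on `[0, x]` enters, not its global norm; this lets the iteration below gain
a power of `x` at each step. -/
theorem norm_integral_mul_le {g : ℝ → ℂ} (hg : IntervalIntegrable g volume 0 ℓ)
    (u : C(Icc (0 : ℝ) ℓ, ℂ)) {x a : ℝ} (hx : x ∈ Icc 0 ℓ) (ha : 0 ≤ a)
    (hu : ∀ t : Icc (0 : ℝ) ℓ, (t : ℝ) ≤ x → ‖u t‖ ≤ a) :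
    ‖∫ t in (0 : ℝ)..x, g t * IccExtend hℓ u t‖ ≤ (∫ t in (0 : ℝ)..ℓ, ‖g t‖) * a := by
  have hs : uIcc 0 x ⊆ uIcc 0 ℓ := by
    rw [uIcc_of_le hℓ, uIcc_of_le hx.1]; exact Icc_subset_Icc_right hx.2
  have h1 : ∫ t in (0 : ℝ)..x, ‖g t‖ ≤ ∫ t in (0 : ℝ)..ℓ, ‖g t‖ :=
    intervalIntegral.integral_mono_interval le_rfl hx.1 hx.2
      (Filter.Eventually.of_forall fun _ => norm_nonneg _) hg.norm
  refine le_trans ?_ (mul_le_mul_of_nonneg_right h1 ha)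
  rw [← intervalIntegral.integral_mul_const]
  refine intervalIntegral.norm_integral_le_of_norm_le hx.1 ?_ ((hg.mono_set hs).norm.mul_const a)
  refine Filter.Eventually.of_forall fun t ht => ?_
  rw [norm_mul]
  refine mul_le_mul_of_nonneg_left ?_ (norm_nonneg _)
  rw [IccExtend_coe_of_mem hℓ u ⟨ht.1.le, ht.2.trans hx.2⟩]
  exact hu _ ht.2

/-- The Volterra operator `u ↦ ∫₀ˣ g u` on `C[0, ℓ]`. -/
def volterra (g : ℝ → ℂ) (hg : IntervalIntegrable g volume 0 ℓ) :
    C(Icc (0 : ℝ) ℓ, ℂ) →L[ℂ] C(Icc (0 : ℝ) ℓ, ℂ) :=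
  LinearMap.mkContinuous
    { toFun := fun u => ⟨fun x => ∫ t in (0 : ℝ)..x, g t * IccExtend hℓ u t, by
        have h := intervalIntegral.continuousOn_primitive_interval
          (f := fun t => g t * IccExtend hℓ u t) (μ := volume) (a := 0) (b := ℓ)
          (by
            rw [uIcc_of_le hℓ, ← intervalIntegrable_iff_integrableOn_Icc_of_le hℓ]
            exact intervalIntegrable_mul_IccExtend hℓ hg u)
        rw [uIcc_of_le hℓ] at h
        exact continuousOn_iff_continuous_domRestrict.1 h⟩
      map_add' := fun u u' => by
        ext x
        have hs : uIcc 0 (x : ℝ) ⊆ uIcc 0 ℓ := by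
          rw [uIcc_of_le hℓ, uIcc_of_le x.2.1]; exact Icc_subset_Icc_right x.2.2
        change ∫ t in (0 : ℝ)..x, g t * IccExtend hℓ (u + u') t =
          (∫ t in (0 : ℝ)..x, g t * IccExtend hℓ u t) +
            ∫ t in (0 : ℝ)..x, g t * IccExtend hℓ u' t
        rw [← intervalIntegral.integral_add
          ((intervalIntegrable_mul_IccExtend hℓ hg u).mono_set hs)
          ((intervalIntegrable_mul_IccExtend hℓ hg u').mono_set hs)]
        refine intervalIntegral.integral_congr fun t _ => ?_
        simp [IccExtend, mul_add]
      map_smul' := fun c u => by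
        ext x
        change ∫ t in (0 : ℝ)..x, g t * IccExtend hℓ (c • u) t =
          c * ∫ t in (0 : ℝ)..x, g t * IccExtend hℓ u t
        rw [← intervalIntegral.integral_const_mul]
        refine intervalIntegral.integral_congr fun t _ => ?_
        simp [IccExtend, mul_left_comm] }
    (∫ t in (0 : ℝ)..ℓ, ‖g t‖) fun u => by
      have h0 : 0 ≤ ∫ t in (0 : ℝ)..ℓ, ‖g t‖ :=
        intervalIntegral.integral_nonneg hℓ fun _ _ => norm_nonneg _
      refine (ContinuousMap.norm_le _ (mul_nonneg h0 (norm_nonneg _))).2 fun x => ?_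
      exact norm_integral_mul_le hℓ hg u x.2 (norm_nonneg _) fun t _ => u.norm_coe_le_norm t

theorem volterra_apply (g : ℝ → ℂ) (hg : IntervalIntegrable g volume 0 ℓ)
    (u : C(Icc (0 : ℝ) ℓ, ℂ)) (x : Icc (0 : ℝ) ℓ) :
    volterra hℓ g hg u x = ∫ t in (0 : ℝ)..x, g t * IccExtend hℓ u t := rfl

/-- The integration operator `u ↦ ∫₀ˣ u` on `C[0, ℓ]`. -/
def primitive : C(Icc (0 : ℝ) ℓ, ℂ) →L[ℂ] C(Icc (0 : ℝ) ℓ, ℂ) :=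
  volterra hℓ (fun _ => 1) intervalIntegrable_const

theorem primitive_apply (u : C(Icc (0 : ℝ) ℓ, ℂ)) (x : Icc (0 : ℝ) ℓ) :
    primitive hℓ u x = ∫ t in (0 : ℝ)..x, IccExtend hℓ u t := by
  simp [primitive, volterra_apply]

/-- The weight `g` is merely integrable and costs a constant factor per step; the plain integration
that follows it turns `x^n / n!` into `x^(n+1) / (n+1)!`. -/
theorem norm_iterate_volterra_le {g : ℝ → ℂ} (hg : IntervalIntegrable g volume 0 ℓ) (n : ℕ)
    (u : C(Icc (0 : ℝ) ℓ, ℂ)) (x : Icc (0 : ℝ) ℓ) :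
    ‖((primitive hℓ * volterra hℓ g hg) ^ n) u x‖ ≤
      (∫ t in (0 : ℝ)..ℓ, ‖g t‖) ^ n * ((x : ℝ) ^ n / n.factorial) * ‖u‖ := by
  have h0 : 0 ≤ ∫ t in (0 : ℝ)..ℓ, ‖g t‖ :=
    intervalIntegral.integral_nonneg hℓ fun _ _ => norm_nonneg _
  induction n generalizing x with
  | zero => simpa using u.norm_coe_le_norm x
  | succ n ih =>
    rw [pow_succ', mul_apply_eq_comp, mul_apply_eq_comp, primitive_apply]
    set U := ((primitive hℓ * volterra hℓ g hg) ^ n) u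
    set M := ∫ t in (0 : ℝ)..ℓ, ‖g t‖
    have hb : ∀ s ∈ Icc 0 ℓ, ‖IccExtend hℓ (volterra hℓ g hg U) s‖ ≤
        M * (M ^ n * (s ^ n / n.factorial) * ‖u‖) := by
      intro s hs
      rw [IccExtend_coe_of_mem hℓ _ hs, volterra_apply]
      have := hs.1
      refine norm_integral_mul_le hℓ hg U hs (by positivity) fun t hts => (ih t).trans ?_
      have := t.2.1
      gcongr
    have hi : ∫ s in (0 : ℝ)..x, M * (M ^ n * (s ^ n / n.factorial) * ‖u‖) =
        M ^ (n + 1) * ((x : ℝ) ^ (n + 1) / (n + 1).factorial) * ‖u‖ := by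
      have : ∀ s : ℝ, M * (M ^ n * (s ^ n / n.factorial) * ‖u‖) =
          (M ^ (n + 1) / n.factorial * ‖u‖) * s ^ n := fun s => by ring
      simp_rw [this]
      rw [intervalIntegral.integral_const_mul, integral_pow, Nat.factorial_succ]
      push_cast
      have : (n.factorial : ℝ) ≠ 0 := by positivity
      field_simp
      simp
    rw [← hi]
    refine intervalIntegral.norm_integral_le_of_norm_le x.2.1
      (Filter.Eventually.of_forall fun t ht => hb t ⟨ht.1.le, ht.2.trans x.2.2⟩) ?_
    exact Continuous.intervalIntegrable (by fun_prop) _ _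

/-- By the iterate bound `‖K^n‖ ≤ (M ℓ)^n / n!`, so some power of `K` has norm below `1`, however
large `g` is. -/
theorem isUnit_one_sub_volterra {g : ℝ → ℂ} (hg : IntervalIntegrable g volume 0 ℓ) :
    IsUnit (1 - primitive hℓ * volterra hℓ g hg) := by
  set K := primitive hℓ * volterra hℓ g hg
  set M := ∫ t in (0 : ℝ)..ℓ, ‖g t‖
  have h0 : 0 ≤ M := intervalIntegral.integral_nonneg hℓ fun _ _ => norm_nonneg _
  have hK : ∀ n, ‖K ^ n‖ ≤ (M * ℓ) ^ n / n.factorial := fun n => by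
    refine ContinuousLinearMap.opNorm_le_bound _ (by positivity) fun u => ?_
    refine (ContinuousMap.norm_le _ (by positivity)).2 fun x => ?_
    refine (norm_iterate_volterra_le hℓ hg n u x).trans ?_
    rw [mul_pow, mul_div_assoc]
    have := x.2.1
    have := x.2.2
    gcongr
  obtain ⟨n, hn⟩ := ((FloorSemiring.tendsto_pow_div_factorial_atTop (M * ℓ)).eventually
    (gt_mem_nhds one_pos)).exists
  exact isUnit_one_sub_of_norm_pow_lt_one
    (R := C(Icc (0 : ℝ) ℓ, ℂ) →L[ℂ] C(Icc (0 : ℝ) ℓ, ℂ)) ((hK n).trans_lt hn)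

end Volterra

/-! ### Solutions on an edge: existence, uniqueness, analytic dependence on `lam` -/

section Solutions
variable {ℓ : ℝ} (hℓ : 0 < ℓ) {q : ℝ → ℝ}

theorem intervalIntegrable_of_memLp {f : ℝ → ℂ} {I : Set ℝ} {b : ℝ}
    (hf : MemLp f 2 (volume.restrict I)) (hb : 0 ≤ b) (hI : Icc 0 b ⊆ I) :
    IntervalIntegrable f volume 0 b := by
  rw [intervalIntegrable_iff_integrableOn_Icc_of_le hb]
  exact (hf.mono_measure (Measure.restrict_mono hI le_rfl)).integrable one_le_two

theorem memLp_ofReal (hq : MemLp q 2 (volume.restrict (Icc 0 ℓ))) :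
    MemLp (fun x => (q x : ℂ)) 2 (volume.restrict (Icc 0 ℓ)) := hq.ofReal

theorem memLp_potential (hq : MemLp q 2 (volume.restrict (Icc 0 ℓ))) (lam : ℂ) :
    MemLp (fun x => (q x : ℂ) - lam) 2 (volume.restrict (Icc 0 ℓ)) :=
  (memLp_ofReal hq).sub (memLp_const lam)

/-- The solution operator of the Volterra integral equation. -/
def solOp (q : ℝ → ℝ) (hq : IntervalIntegrable (fun x => (q x : ℂ)) volume 0 ℓ) (lam : ℂ) :
    C(Icc (0 : ℝ) ℓ, ℂ) →L[ℂ] C(Icc (0 : ℝ) ℓ, ℂ) :=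
  Ring.inverse (1 - primitive hℓ.le * volterra hℓ.le (fun x => (q x : ℂ) - lam)
    (hq.sub intervalIntegrable_const))

/-- This exhibits the Volterra operator as affine in `lam`, so that `differentiable_inverse_affine`
makes the solution operator entire. -/
theorem volterra_sub_const (hq : IntervalIntegrable (fun x => (q x : ℂ)) volume 0 ℓ) (lam : ℂ) :
    volterra hℓ.le (fun x => (q x : ℂ) - lam) (hq.sub intervalIntegrable_const) =
      volterra hℓ.le (fun x => (q x : ℂ)) hq - lam • primitive hℓ.le := by
  ext u x
  have hs : uIcc 0 (x : ℝ) ⊆ uIcc 0 ℓ := by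
    rw [uIcc_of_le hℓ.le, uIcc_of_le x.2.1]; exact Icc_subset_Icc_right x.2.2
  simp only [sub_apply, smul_apply,
    ContinuousMap.sub_apply, ContinuousMap.smul_apply, volterra_apply, primitive_apply,
    smul_eq_mul]
  rw [← intervalIntegral.integral_const_mul, ← intervalIntegral.integral_sub
    ((intervalIntegrable_mul_IccExtend hℓ.le hq u).mono_set hs)
    (((continuous_IccExtend hℓ.le u).const_mul lam).intervalIntegrable _ _)]
  simp only [sub_mul]

theorem differentiable_solOp (hq : IntervalIntegrable (fun x => (q x : ℂ)) volume 0 ℓ) :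
    Differentiable ℂ (solOp hℓ q hq) := by
  have hmul : ∀ z : ℂ, primitive hℓ.le * (volterra hℓ.le (fun x => (q x : ℂ)) hq -
      z • primitive hℓ.le) = primitive hℓ.le * volterra hℓ.le (fun x => (q x : ℂ)) hq -
      z • (primitive hℓ.le * primitive hℓ.le) := fun z => by
    ext u x
    simp [mul_apply_eq_comp]
  have h := differentiable_inverse_affine
    (R := C(Icc (0 : ℝ) ℓ, ℂ) →L[ℂ] C(Icc (0 : ℝ) ℓ, ℂ))
    (primitive hℓ.le * volterra hℓ.le (fun x => (q x : ℂ)) hq)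
    (primitive hℓ.le * primitive hℓ.le) fun z => by
      have hu := isUnit_one_sub_volterra hℓ.le
        (hq.sub (intervalIntegrable_const (c := z) (μ := volume)))
      rw [volterra_sub_const hℓ hq, hmul] at hu
      exact hu
  refine (funext fun z => ?_ : solOp hℓ q hq = _) ▸ h
  rw [solOp, volterra_sub_const hℓ hq, hmul]

include hℓ in
/-- Existence for the inhomogeneous equation. -/
theorem exists_isH2_forcing (hq : MemLp q 2 (volume.restrict (Icc 0 ℓ))) (lam a b : ℂ)
    {f : ℝ → ℂ} (hf : MemLp f 2 (volume.restrict (Icc 0 ℓ))) :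
    ∃ u v : ℝ → ℂ, IsH2 (Icc 0 ℓ) u v (fun x => ((q x : ℂ) - lam) * u x - f x) ∧
      u 0 = a ∧ v 0 = b := by
  have hg := memLp_potential hq lam
  have hgi := intervalIntegrable_of_memLp hg hℓ.le subset_rfl
  have hfi := intervalIntegrable_of_memLp hf hℓ.le subset_rfl
  set V := volterra hℓ.le _ hgi
  set P := primitive hℓ.le
  set c : C(Icc (0 : ℝ) ℓ, ℂ) := volterra hℓ.le _ hfi 1 with hc
  -- Integrating the equation twice turns it into `u = a + b x + ∫∫ ((q - lam) u - f)`, that is `(1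
  -- - P V) u = F`.
  set F : C(Icc (0 : ℝ) ℓ, ℂ) := a • 1 + b • P 1 - P c
  obtain ⟨U, hU⟩ : ∃ U, U - P (V U) = F := by
    obtain ⟨T, hT⟩ := isUnit_one_sub_volterra hℓ.le hgi
    refine ⟨(↑T⁻¹ : C(Icc (0 : ℝ) ℓ, ℂ) →L[ℂ] C(Icc (0 : ℝ) ℓ, ℂ)) F, ?_⟩
    have := congrArg (fun A : C(Icc (0 : ℝ) ℓ, ℂ) →L[ℂ] C(Icc (0 : ℝ) ℓ, ℂ) => A F) T.mul_inv
    rwa [hT] at this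
  set u := IccExtend hℓ.le U with hu
  set W : C(Icc (0 : ℝ) ℓ, ℂ) := b • 1 + V U - c with hW
  set v := IccExtend hℓ.le W with hv
  have huc : Continuous u := continuous_IccExtend _ _
  have hvc : Continuous v := continuous_IccExtend _ _
  have h0 : (0 : ℝ) ∈ Icc 0 ℓ := ⟨le_rfl, hℓ.le⟩
  have hUW : U = a • 1 + P W := by
    rw [hW, map_sub, map_add, map_smul]
    rw [sub_eq_iff_eq_add] at hU
    conv_lhs => rw [hU]
    simp only [F]
    abel
  have hueq : ∀ x ∈ Icc 0 ℓ, u x = a + ∫ t in (0 : ℝ)..x, v t := fun x hx => by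
    have := congrArg (fun A : C(Icc (0 : ℝ) ℓ, ℂ) => A ⟨x, hx⟩) hUW
    simp only [ContinuousMap.add_apply, ContinuousMap.smul_apply, ContinuousMap.one_apply,
      smul_eq_mul, mul_one, P, primitive_apply] at this
    rw [hu, IccExtend_coe_of_mem _ _ hx, this]
  have hgu : MemLp (fun x => ((q x : ℂ) - lam) * u x) 2 (volume.restrict (Icc 0 ℓ)) := by
    refine MemLp.of_le_mul (c := ‖U‖) hg
      (hg.aestronglyMeasurable.mul huc.aestronglyMeasurable) ?_
    refine Filter.Eventually.of_forall fun x => ?_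
    rw [norm_mul, mul_comm]
    exact mul_le_mul_of_nonneg_right (norm_IccExtend_le hℓ.le U x) (norm_nonneg _)
  have hveq : ∀ x ∈ Icc 0 ℓ, v x = b + ∫ t in (0 : ℝ)..x, (((q t : ℂ) - lam) * u t - f t) :=
    fun x hx => by
      have hs : uIcc 0 x ⊆ uIcc 0 ℓ := by
        rw [uIcc_of_le hℓ.le, uIcc_of_le hx.1]; exact Icc_subset_Icc_right hx.2
      rw [intervalIntegral.integral_sub
        ((intervalIntegrable_mul_IccExtend hℓ.le hgi U).mono_set hs) (hfi.mono_set hs),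
        hv, IccExtend_coe_of_mem _ _ hx, hW]
      simp only [ContinuousMap.add_apply, ContinuousMap.smul_apply, ContinuousMap.one_apply,
        ContinuousMap.sub_apply, smul_eq_mul, mul_one, V, hc, volterra_apply]
      have : ∫ t in (0 : ℝ)..x, f t * IccExtend hℓ.le (1 : C(Icc (0 : ℝ) ℓ, ℂ)) t =
          ∫ t in (0 : ℝ)..x, f t := intervalIntegral.integral_congr fun t _ => by
        simp [IccExtend]
      rw [this]
      ring
  have hu0 : u 0 = a := by simpa using hueq 0 h0
  have hv0 : v 0 = b := by simpa using hveq 0 h0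
  have hpu : IsPrim ℓ u v := ⟨hvc.intervalIntegrable _ _, fun x hx => by rw [hueq x hx, hu0]⟩
  have hLp : ∀ h : C(Icc (0 : ℝ) ℓ, ℂ),
      MemLp (IccExtend hℓ.le h) 2 (volume.restrict (Icc 0 ℓ)) := fun h =>
    MemLp.of_bound (continuous_IccExtend _ _).aestronglyMeasurable ‖h‖
      (Filter.Eventually.of_forall (norm_IccExtend_le _ h))
  exact ⟨u, v, ⟨hLp U, hLp W, hgu.sub hf, fun x hx => hpu.hasDerivWithinAt hℓ hvc.continuousOn hx,
    fun x hx => intervalIntegrable_of_memLp (hgu.sub hf) hx.1 (Icc_subset_Icc_right hx.2),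
    fun x hx => by rw [hv0]; exact hveq x hx⟩, hu0, hv0⟩

variable {lam : ℂ} {u v w : ℝ → ℂ}

theorem IsH2.isSLSolution (h : IsH2 (Icc 0 ℓ) u v w)
    (hw : w =ᵐ[volume.restrict (Icc 0 ℓ)] fun x => ((q x : ℂ) - lam) * u x) :
    IsSLSolution ℓ q lam u v := by
  refine ⟨h.deriv_u, fun x hx => ?_⟩
  rw [h.v_eq x hx]
  congr 1
  refine intervalIntegral.integral_congr_ae ?_
  filter_upwards [ae_imp_of_ae_restrict hw] with t ht htx
  rw [uIoc_of_le hx.1] at htx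
  exact ht ⟨htx.1.le, htx.2.trans hx.2⟩

theorem IsSLSolution.continuousOn_u (h : IsSLSolution ℓ q lam u v) :
    ContinuousOn u (Icc 0 ℓ) := fun x hx => (h.deriv_u x hx).continuousWithinAt

theorem IsSLSolution.intervalIntegrable (h : IsSLSolution ℓ q lam u v) (hℓ : 0 < ℓ)
    (hq : MemLp q 2 (volume.restrict (Icc 0 ℓ))) :
    IntervalIntegrable (fun t => ((q t : ℂ) - lam) * u t) volume 0 ℓ :=
  (intervalIntegrable_of_memLp (memLp_potential hq lam) hℓ.le subset_rfl).mul_continuousOn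
    (by rw [uIcc_of_le hℓ.le]; exact h.continuousOn_u)

theorem IsSLSolution.continuousOn_v (h : IsSLSolution ℓ q lam u v) (hℓ : 0 < ℓ)
    (hq : MemLp q 2 (volume.restrict (Icc 0 ℓ))) : ContinuousOn v (Icc 0 ℓ) :=
  IsPrim.continuousOn hℓ.le ⟨h.intervalIntegrable hℓ hq, h.v_eq⟩

theorem memLp_of_continuousOn_Icc {f : ℝ → ℂ} (hf : ContinuousOn f (Icc 0 ℓ)) :
    MemLp f 2 (volume.restrict (Icc 0 ℓ)) := by
  obtain ⟨C, hC⟩ := isCompact_Icc.exists_bound_of_continuousOn hf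
  exact MemLp.of_bound (hf.aestronglyMeasurable measurableSet_Icc) C
    ((ae_restrict_iff' measurableSet_Icc).2 (Filter.Eventually.of_forall hC))

theorem IsSLSolution.isH2 (h : IsSLSolution ℓ q lam u v) (hℓ : 0 < ℓ)
    (hq : MemLp q 2 (volume.restrict (Icc 0 ℓ))) :
    IsH2 (Icc 0 ℓ) u v (fun x => ((q x : ℂ) - lam) * u x) := by
  have hLp : MemLp (fun x => ((q x : ℂ) - lam) * u x) 2 (volume.restrict (Icc 0 ℓ)) := by
    obtain ⟨C, hC⟩ := isCompact_Icc.exists_bound_of_continuousOn h.continuousOn_u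
    have hg := memLp_potential hq lam
    refine MemLp.of_le_mul (c := C) hg (hg.aestronglyMeasurable.mul
      (h.continuousOn_u.aestronglyMeasurable measurableSet_Icc)) ?_
    refine (ae_restrict_iff' measurableSet_Icc).2 (Filter.Eventually.of_forall fun x hx => ?_)
    rw [norm_mul, mul_comm]
    exact mul_le_mul_of_nonneg_right (hC x hx) (norm_nonneg _)
  exact ⟨memLp_of_continuousOn_Icc h.continuousOn_u,
    memLp_of_continuousOn_Icc (h.continuousOn_v hℓ hq), hLp, h.deriv_u,
    fun x hx => intervalIntegrable_of_memLp hLp hx.1 (Icc_subset_Icc_right hx.2), h.v_eq⟩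

/-- Representation of solutions by the solution operator. -/
theorem IsSLSolution.eq_solOp (h : IsSLSolution ℓ q lam u v)
    (hq : MemLp q 2 (volume.restrict (Icc 0 ℓ))) (x : Icc (0 : ℝ) ℓ) :
    u x = solOp hℓ q (intervalIntegrable_of_memLp (memLp_ofReal hq) hℓ.le subset_rfl) lam
      (u 0 • 1 + v 0 • primitive hℓ.le 1) x := by
  have hgi := intervalIntegrable_of_memLp (memLp_potential hq lam) hℓ.le subset_rfl
  set U : C(Icc (0 : ℝ) ℓ, ℂ) := ⟨fun x => u x, continuousOn_iff_continuous_domRestrict.1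
    h.continuousOn_u⟩ with hU
  set W : C(Icc (0 : ℝ) ℓ, ℂ) := ⟨fun x => v x, continuousOn_iff_continuous_domRestrict.1
    (h.continuousOn_v hℓ hq)⟩ with hW
  have hUx : ∀ t ∈ Icc 0 ℓ, IccExtend hℓ.le U t = u t := fun t ht =>
    IccExtend_coe_of_mem hℓ.le U ht
  have hWx : ∀ t ∈ Icc 0 ℓ, IccExtend hℓ.le W t = v t := fun t ht =>
    IccExtend_coe_of_mem hℓ.le W ht
  have e1 : W = v 0 • 1 + volterra hℓ.le _ hgi U := by
    ext x
    simp only [hW, ContinuousMap.add_apply, ContinuousMap.smul_apply,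
      ContinuousMap.one_apply, smul_eq_mul, mul_one, volterra_apply]
    change v x = _
    rw [h.v_eq x x.2]
    congr 1
    refine intervalIntegral.integral_congr fun t ht => ?_
    rw [uIcc_of_le x.2.1] at ht
    simp only [hUx t ⟨ht.1, ht.2.trans x.2.2⟩]
  have e2 : U = u 0 • 1 + primitive hℓ.le W := by
    ext x
    simp only [hU, ContinuousMap.add_apply, ContinuousMap.smul_apply,
      ContinuousMap.one_apply, smul_eq_mul, mul_one, primitive_apply]
    change u x = _
    rw [(IsPrim.of_hasDerivWithinAt h.deriv_u (h.continuousOn_v hℓ hq) hℓ.le).eq x x.2]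
    congr 1
    refine intervalIntegral.integral_congr fun t ht => ?_
    rw [uIcc_of_le x.2.1] at ht
    simp only [hWx t ⟨ht.1, ht.2.trans x.2.2⟩]
  have e3 : (1 - primitive hℓ.le * volterra hℓ.le _ hgi) U =
      u 0 • 1 + v 0 • primitive hℓ.le 1 := by
    have e2' := e2
    rw [e1, map_add, map_smul] at e2'
    change U - primitive hℓ.le (volterra hℓ.le _ hgi U) = _
    rw [sub_eq_iff_eq_add]
    exact e2'.trans (by abel)
  have e4 := congrArg (fun A : C(Icc (0 : ℝ) ℓ, ℂ) →L[ℂ] C(Icc (0 : ℝ) ℓ, ℂ) => A U)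
    (Ring.inverse_mul_cancel _ (isUnit_one_sub_volterra hℓ.le hgi))
  have e5 : solOp hℓ q (intervalIntegrable_of_memLp (memLp_ofReal hq) hℓ.le subset_rfl) lam
      (u 0 • 1 + v 0 • primitive hℓ.le 1) = U := by
    rw [← e3]
    exact e4
  rw [e5]
  rfl

/-- By `IsSLSolution.eq_solOp` the function is determined by its two initial values; the integral
equation then determines the derivative. -/
theorem IsSLSolution.unique {u' v' : ℝ → ℂ} (h : IsSLSolution ℓ q lam u v)
    (h' : IsSLSolution ℓ q lam u' v') (hℓ : 0 < ℓ) (hq : MemLp q 2 (volume.restrict (Icc 0 ℓ)))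
    (hu : u 0 = u' 0) (hv : v 0 = v' 0) : EqOn u u' (Icc 0 ℓ) ∧ EqOn v v' (Icc 0 ℓ) := by
  have hU : EqOn u u' (Icc 0 ℓ) := fun x hx => by
    have e1 := h.eq_solOp hℓ hq ⟨x, hx⟩
    have e2 := h'.eq_solOp hℓ hq ⟨x, hx⟩
    rw [hu, hv] at e1
    exact e1.trans e2.symm
  refine ⟨hU, fun x hx => ?_⟩
  rw [h.v_eq x hx, h'.v_eq x hx, hv]
  congr 1
  refine intervalIntegral.integral_congr fun t ht => ?_
  rw [uIcc_of_le hx.1] at ht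
  simp only [hU ⟨ht.1, ht.2.trans hx.2⟩]

include hℓ in
theorem slSol_spec (hq : MemLp q 2 (volume.restrict (Icc 0 ℓ))) (lam a b : ℂ) :
    IsSLSolution ℓ q lam (slSol ℓ q lam a b).1 (slSol ℓ q lam a b).2 ∧
      (slSol ℓ q lam a b).1 0 = a ∧ (slSol ℓ q lam a b).2 0 = b := by
  obtain ⟨u, v, h, hu, hv⟩ := exists_isH2_forcing hℓ hq lam a b
    (f := 0) MemLp.zero
  refine Classical.epsilon_spec (p := fun p : (ℝ → ℂ) × (ℝ → ℂ) =>
    IsSLSolution ℓ q lam p.1 p.2 ∧ p.1 0 = a ∧ p.2 0 = b) ⟨(u, v), ?_, hu, hv⟩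
  exact h.isSLSolution (by simp)

theorem IsSLSolution.linearComb {u' v' : ℝ → ℂ} (h : IsSLSolution ℓ q lam u v)
    (h' : IsSLSolution ℓ q lam u' v') (hℓ : 0 < ℓ)
    (hq : MemLp q 2 (volume.restrict (Icc 0 ℓ))) (a b : ℂ) :
    IsSLSolution ℓ q lam (a • u + b • u') (a • v + b • v') := by
  refine (((h.isH2 hℓ hq).smul a).add ((h'.isH2 hℓ hq).smul b)).isSLSolution ?_
  refine Filter.Eventually.of_forall fun x => ?_
  simp only [Pi.add_apply, Pi.smul_apply, smul_eq_mul]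
  ring

include hℓ in
-- The value at `ℓ` is a point evaluation of the entire solution operator applied to a vector
-- independent of `lam`.
theorem differentiable_slSol_fst (hq : MemLp q 2 (volume.restrict (Icc 0 ℓ))) (a b : ℂ) :
    Differentiable ℂ fun lam => (slSol ℓ q lam a b).1 ℓ := by
  have hqi := intervalIntegrable_of_memLp (memLp_ofReal hq) hℓ.le subset_rfl
  have hd := differentiable_solOp hℓ hqi
  have e : (fun lam => (slSol ℓ q lam a b).1 ℓ) = fun lam => ContinuousMap.evalCLM ℂ
      (⟨ℓ, hℓ.le, le_rfl⟩ : Icc (0 : ℝ) ℓ)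
      (solOp hℓ q hqi lam (a • 1 + b • primitive hℓ.le 1)) := by
    funext lam
    obtain ⟨h, h1, h2⟩ := slSol_spec hℓ hq lam a b
    have := h.eq_solOp hℓ hq ⟨ℓ, hℓ.le, le_rfl⟩
    rw [h1, h2] at this
    exact this
  rw [e]
  fun_prop

include hℓ in
theorem differentiable_slSol_snd (hq : MemLp q 2 (volume.restrict (Icc 0 ℓ))) (a b : ℂ) :
    Differentiable ℂ fun lam => (slSol ℓ q lam a b).2 ℓ := by
  have hqi := intervalIntegrable_of_memLp (memLp_ofReal hq) hℓ.le subset_rfl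
  have hd := differentiable_solOp hℓ hqi
  -- The derivative is recovered as `b + ∫ (q - lam) u`, an affine family of operators applied to
  -- the solution; no derivative of the solution operator in `x` is needed.
  have e : (fun lam => (slSol ℓ q lam a b).2 ℓ) = fun lam => b + ContinuousMap.evalCLM ℂ
      (⟨ℓ, hℓ.le, le_rfl⟩ : Icc (0 : ℝ) ℓ)
      ((volterra hℓ.le (fun x => (q x : ℂ)) hqi - lam • primitive hℓ.le)
        (solOp hℓ q hqi lam (a • 1 + b • primitive hℓ.le 1))) := by
    funext lam
    obtain ⟨h, h1, h2⟩ := slSol_spec hℓ hq lam a b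
    rw [← volterra_sub_const hℓ hqi, h.v_eq ℓ ⟨hℓ.le, le_rfl⟩, h2]
    congr 1
    refine intervalIntegral.integral_congr fun t ht => ?_
    rw [uIcc_of_le hℓ.le] at ht
    have := h.eq_solOp hℓ hq ⟨t, ht⟩
    rw [h1, h2] at this
    simp only [this]
    rw [IccExtend_coe_of_mem hℓ.le _ ht]
  rw [e]
  fun_prop

end Solutions

/-! ### Resolvent set and eigenvalues of unbounded operators -/

section Abstract
variable {H : Type*} [NormedAddCommGroup H] [InnerProductSpace ℂ H]

/-- For a symmetric operator, `z` is in the resolvent set as soon as `A - z` and `A - conj z` are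
surjective. -/
theorem mem_resolventSet_of_symmetric [CompleteSpace H] {A : H →ₗ.[ℂ] H}
    (hA : ∀ p ∈ A.graph, ∀ p' ∈ A.graph, inner ℂ p.2 p'.1 = inner ℂ p.1 p'.2) {z : ℂ}
    (hz : ∀ f, ∃ p ∈ A.graph, p.2 - z • p.1 = f)
    (hz' : ∀ f, ∃ p ∈ A.graph, p.2 - (starRingEnd ℂ z) • p.1 = f) : z ∈ resolventSet A := by
  have key : ∀ p ∈ A.graph, ∀ p' ∈ A.graph,
      inner ℂ (p.2 - z • p.1) p'.1 = inner ℂ p.1 (p'.2 - (starRingEnd ℂ z) • p'.1) := by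
    intro p hp p' hp'
    rw [inner_sub_left, inner_sub_right, inner_smul_left, inner_smul_right, hA p hp p' hp']
  -- The kernel of `A - z` is orthogonal to the range of `A - conj z`, which is the whole space.
  have inj : ∀ p ∈ A.graph, p.2 - z • p.1 = 0 → p.1 = 0 := by
    intro p hp h0
    obtain ⟨p', hp', h'⟩ := hz' p.1
    have := key p hp p' hp'
    rw [h0, inner_zero_left, h'] at this
    exact inner_self_eq_zero.1 this.symm
  have inj' : ∀ p ∈ A.graph, ∀ p' ∈ A.graph, p.2 - z • p.1 = p'.2 - z • p'.1 →
      p.1 = p'.1 := by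
    intro p hp p' hp' h
    refine sub_eq_zero.1 (inj (p - p') (A.graph.sub_mem hp hp') ?_)
    rw [Prod.fst_sub, Prod.snd_sub, smul_sub, sub_sub_sub_comm, h, sub_self]
  choose P hP hPf using hz
  let R : H →ₗ[ℂ] H :=
    { toFun := fun f => (P f).1
      map_add' := fun f g => by
        refine inj' _ (hP _) _ (A.graph.add_mem (hP f) (hP g)) ?_
        rw [hPf, Prod.fst_add, Prod.snd_add, smul_add, add_sub_add_comm, hPf, hPf]
      map_smul' := fun c f => by
        refine inj' _ (hP _) _ (A.graph.smul_mem c (hP f)) ?_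
        rw [hPf, Prod.smul_fst, Prod.smul_snd, smul_comm z c, ← smul_sub, hPf] }
  -- Closed graph theorem, as in Hellinger–Toeplitz: writing `g = (A - conj z) p'` gives `⟨R f, g⟩ =
  -- ⟨f, p'⟩`, which is continuous in `f`; every `g` has this form, so the limit is identified
  -- weakly.
  have hR : Continuous R := by
    refine R.continuous_of_seq_closed_graph fun f x y hf hy => ?_
    have h1 : ∀ g, inner ℂ y g = inner ℂ (R x) g := by
      intro g
      obtain ⟨p', hp', h'⟩ := hz' g
      have h2 : ∀ f, inner ℂ (R f) g = inner ℂ f p'.1 := fun f => by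
        have h3 := key _ (hP f) p' hp'
        rw [hPf, h'] at h3
        exact h3.symm
      have h3 := (hy.inner (tendsto_const_nhds (x := g)) : Filter.Tendsto
        (fun n => inner ℂ (R (f n)) g) _ _)
      rw [h2]
      exact tendsto_nhds_unique (h3.congr fun n => h2 (f n)) (hf.inner tendsto_const_nhds)
    exact ext_inner_right ℂ h1
  refine ⟨⟨R, hR⟩, fun f => ?_, fun y => ?_⟩
  · obtain ⟨y, hy1, hy2⟩ := (LinearPMap.mem_graph_iff A).1 (hP f)
    have hmem : (P f).1 ∈ A.domain := hy1 ▸ y.2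
    refine ⟨hmem, ?_⟩
    have : (⟨(P f).1, hmem⟩ : A.domain) = y := Subtype.ext hy1.symm
    change A ⟨(P f).1, hmem⟩ - z • (P f).1 = f
    rw [this, hy2, hPf]
  · exact inj' _ (hP _) _ (A.mem_graph y) (hPf _)

end Abstract

theorem mem_eigenspace_iff {H : Type*} [NormedAddCommGroup H] [NormedSpace ℂ H]
    {A : H →ₗ.[ℂ] H} {z : ℂ} {y : H} : y ∈ eigenspace A z ↔ (y, z • y) ∈ A.graph := Iff.rfl

theorem IsEigenvalue.mem_Sp {H : Type*} [NormedAddCommGroup H] [NormedSpace ℂ H]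
    {A : H →ₗ.[ℂ] H} {z : ℂ} (h : IsEigenvalue A z) : z ∈ Sp A := by
  rintro ⟨R, -, hR⟩
  obtain ⟨y, hy, hy0⟩ := h
  obtain ⟨x, hx1, hx2⟩ := (LinearPMap.mem_graph_iff A).1 (mem_eigenspace_iff.1 hy)
  have h1 := hR x
  simp only at hx1 hx2
  rw [hx2, hx1, sub_self, map_zero] at h1
  exact hy0 h1.symm

/-- Points of the resolvent set make `A - z` surjective. -/
theorem exists_mem_graph_of_mem_resolventSet {H : Type*} [NormedAddCommGroup H]
    [NormedSpace ℂ H] {A : H →ₗ.[ℂ] H} {z : ℂ} (h : z ∈ resolventSet A) (f : H) :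
    ∃ p ∈ A.graph, p.2 - z • p.1 = f := by
  obtain ⟨R, hR, -⟩ := h
  obtain ⟨hf, h⟩ := hR f
  exact ⟨_, A.mem_graph ⟨R f, hf⟩, h⟩

/-! ### The half line: decaying solutions and the inhomogeneous equation -/

section Lead
variable {ζ : ℂ} {u v w : ℝ → ℂ}

theorem eq_mul_exp_of_hasDerivWithinAt {c : ℂ}
    (h : ∀ x ∈ Ici (0 : ℝ), HasDerivWithinAt u (c * u x) (Ici 0) x) {x : ℝ} (hx : 0 ≤ x) :
    u x = u 0 * Complex.exp (c * x) := by
  have hd : ∀ y ∈ Ici (0 : ℝ), HasDerivWithinAt (fun y : ℝ => u y * Complex.exp (-(c * y))) 0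
      (Ici 0) y := fun y hy => by
    have h1 : HasDerivAt (fun y : ℝ => Complex.exp (-(c * y))) (Complex.exp (-(c * y)) * -(c * 1)) y :=
      (((hasDerivAt_id (y : ℂ)).const_mul c).neg.cexp).comp_ofReal
    refine ((h y hy).mul h1.hasDerivWithinAt).congr_deriv ?_
    ring
  have h2 := constant_of_has_deriv_right_zero (a := 0) (b := x)
    (fun y hy => ((hd y hy.1).continuousWithinAt).mono Icc_subset_Ici_self)
    (fun y hy => (hd y hy.1).mono (Ici_subset_Ici.2 hy.1)) x ⟨hx, le_rfl⟩
  simp only [Complex.ofReal_zero, mul_zero, neg_zero, Complex.exp_zero, mul_one] at h2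
  rw [← h2, mul_assoc, ← Complex.exp_add, neg_add_cancel, Complex.exp_zero, mul_one]

/-- The right-hand side is continuous because the potential vanishes on the lead, so the almost
everywhere equation holds at every point. -/
theorem IsH2.hasDerivWithinAt_v (h : IsH2 (Ici 0) u v w)
    (hw : w =ᵐ[volume.restrict (Ici 0)] fun x => -ζ ^ 2 * u x) :
    ∀ x ∈ Ici (0 : ℝ), HasDerivWithinAt v (-ζ ^ 2 * u x) (Ici 0) x := by
  intro x hx
  have hx1 : (0 : ℝ) < x + 1 := by linarith [mem_Ici.1 hx]
  have huc : ContinuousOn u (Ici 0) := fun y hy => (h.deriv_u y hy).continuousWithinAt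
  have hc : ContinuousOn (fun x => -ζ ^ 2 * u x) (Icc 0 (x + 1)) :=
    continuousOn_const.mul (huc.mono Icc_subset_Ici_self)
  have hp : IsPrim (x + 1) v (fun x => -ζ ^ 2 * u x) := by
    refine ⟨ContinuousOn.intervalIntegrable (by rwa [uIcc_of_le hx1.le]), fun y hy => ?_⟩
    rw [h.v_eq y hy.1]
    congr 1
    refine intervalIntegral.integral_congr_ae ?_
    filter_upwards [ae_imp_of_ae_restrict hw] with t ht hty
    rw [uIoc_of_le hy.1] at hty
    exact ht hty.1.le
  refine (hp.hasDerivWithinAt hx1 hc ⟨hx, by linarith⟩).mono_of_mem_nhdsWithin ?_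
  refine mem_nhdsWithin.2 ⟨Iio (x + 1), isOpen_Iio, by simp, fun y hy => ⟨hy.2, ?_⟩⟩
  exact (mem_Iio.1 hy.1).le

/-- Square integrable solutions of `-u'' = ζ² u` on the half line, `Im ζ ≥ 0`, satisfy
`u' = i ζ u`. -/
theorem IsH2.lead_deriv_eq (h : IsH2 (Ici 0) u v w)
    (hw : w =ᵐ[volume.restrict (Ici 0)] fun x => -ζ ^ 2 * u x) (hζ : 0 ≤ ζ.im) {x : ℝ}
    (hx : 0 ≤ x) : v x = Complex.I * ζ * u x := by
  have hv := h.hasDerivWithinAt_v hw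
  -- `m = u' - iζ u` isolates the component `e^{-iζx}`: it satisfies `m' = -iζ m`. Since `Im ζ ≥ 0`,
  -- `|m(x)| ≥ |m(0)|`, and a nonzero constant is not square integrable on the half line.
  have hm : ∀ x ∈ Ici (0 : ℝ), HasDerivWithinAt (fun x => v x - Complex.I * ζ * u x)
      (-(Complex.I * ζ) * (v x - Complex.I * ζ * u x)) (Ici 0) x := fun x hx => by
    refine ((hv x hx).sub ((h.deriv_u x hx).const_mul _)).congr_deriv ?_
    ring_nf
    rw [Complex.I_sq]
    ring
  have hm0 : v 0 - Complex.I * ζ * u 0 = 0 := by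
    have hL : MemLp (fun x => v x - Complex.I * ζ * u x) 2 (volume.restrict (Ici 0)) :=
      h.memLp_v.sub (h.memLp_u.const_mul _)
    have hc : MemLp (fun _ : ℝ => v 0 - Complex.I * ζ * u 0) 2
        (volume.restrict (Ici (0 : ℝ))) := by
      refine hL.mono aestronglyMeasurable_const ((ae_restrict_iff' measurableSet_Ici).2
        (Filter.Eventually.of_forall fun x hx => ?_))
      rw [eq_mul_exp_of_hasDerivWithinAt hm hx, norm_mul]
      refine le_mul_of_one_le_right (norm_nonneg _) ?_
      rw [Complex.norm_exp]
      refine Real.one_le_exp ?_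
      simp only [neg_mul, Complex.neg_re, Complex.mul_re, Complex.I_re, Complex.I_im,
        Complex.mul_im, Complex.ofReal_re, Complex.ofReal_im]
      have := mul_nonneg hζ (mem_Ici.1 hx)
      linarith
    rcases (memLp_const_iff (by simp) (by simp)).1 hc with h0 | h0
    · exact h0
    · simp at h0
  have := eq_mul_exp_of_hasDerivWithinAt hm hx
  rw [hm0, zero_mul] at this
  exact sub_eq_zero.1 this

theorem IsH2.lead_eq_exp (h : IsH2 (Ici 0) u v w)
    (hw : w =ᵐ[volume.restrict (Ici 0)] fun x => -ζ ^ 2 * u x) (hζ : 0 ≤ ζ.im) {x : ℝ}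
    (hx : 0 ≤ x) : u x = u 0 * Complex.exp (Complex.I * ζ * x) := by
  refine eq_mul_exp_of_hasDerivWithinAt (fun y hy => ?_) hx
  rw [← h.lead_deriv_eq hw hζ hy]
  exact h.deriv_u y hy

/-- For real `ζ` both `ζ` and `-ζ` lie in the closed upper half plane, so `u' = iζ u` and `u' = -iζ
u` hold together. -/
theorem IsH2.lead_eq_zero (h : IsH2 (Ici 0) u v w)
    (hw : w =ᵐ[volume.restrict (Ici 0)] fun x => -ζ ^ 2 * u x) (hζ : ζ.im = 0) (hζ0 : ζ ≠ 0)
    {x : ℝ} (hx : 0 ≤ x) : u x = 0 ∧ v x = 0 := by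
  have h1 := h.lead_deriv_eq hw hζ.ge hx
  have h2 := h.lead_deriv_eq (ζ := -ζ) (by simpa using hw) (by simp [hζ]) hx
  have h3 : Complex.I * ζ * u x = 0 := by linear_combination (h2 - h1) / 2
  have h4 : u x = 0 := by simpa [hζ0] using h3
  exact ⟨h4, by rw [h1, h4, mul_zero]⟩

theorem memLp_exp {c : ℂ} (hc : c.re < 0) :
    MemLp (fun x : ℝ => Complex.exp (c * x)) 2 (volume.restrict (Ici 0)) := by
  have hcont : Continuous fun x : ℝ => Complex.exp (c * x) := by fun_prop
  rw [memLp_two_iff_integrable_sq_norm hcont.aestronglyMeasurable]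
  have h1 := integrableOn_exp_mul_Ioi (a := 2 * c.re) (by linarith) 0
  rw [← integrableOn_Ici_iff_integrableOn_Ioi] at h1
  refine h1.congr (Filter.Eventually.of_forall fun x => ?_)
  simp only [Complex.norm_exp, ← Real.exp_nat_mul]
  congr 1
  simp
  ring

theorem isH2_exp {c : ℂ} (hc : c.re < 0) :
    IsH2 (Ici 0) (fun x : ℝ => Complex.exp (c * x)) (fun x : ℝ => c * Complex.exp (c * x))
      (fun x : ℝ => c ^ 2 * Complex.exp (c * x)) := by
  have hd : ∀ x : ℝ, HasDerivAt (fun x : ℝ => Complex.exp (c * x)) (c * Complex.exp (c * x)) x :=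
    fun x => by
      have : HasDerivAt (fun y : ℝ => Complex.exp (c * y)) (Complex.exp (c * x) * (c * 1)) x :=
        (((hasDerivAt_id (x : ℂ)).const_mul c).cexp).comp_ofReal
      exact this.congr_deriv (by ring)
  have hi : ∀ x : ℝ, IntervalIntegrable (fun x : ℝ => c ^ 2 * Complex.exp (c * x)) volume 0 x :=
    fun x => Continuous.intervalIntegrable (by fun_prop) _ _
  refine ⟨memLp_exp hc, (memLp_exp hc).const_mul _, (memLp_exp hc).const_mul _,
    fun x _ => (hd x).hasDerivWithinAt, fun x _ => hi x, fun x _ => ?_⟩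
  rw [intervalIntegral.integral_eq_sub_of_hasDerivAt
    (f := fun x : ℝ => c * Complex.exp (c * x)) (fun t _ => ?_) (hi x)]
  · ring
  · exact ((hd t).const_mul c).congr_deriv (by ring)

/-- Energy estimate: bounded solutions of `P' = c P + f` with `f ∈ L²`, `Re c ≠ 0` are in `L²`. -/
theorem memLp_of_bounded_solution {c : ℂ} (hc : c.re ≠ 0) {P f : ℝ → ℂ}
    (hf : MemLp f 2 (volume.restrict (Ici 0)))
    (hP : ∀ b : ℝ, 0 ≤ b → IsPrim b P (fun x => c * P x + f x)) {M : ℝ}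
    (hM : ∀ x : ℝ, 0 ≤ x → ‖P x‖ ≤ M) : MemLp P 2 (volume.restrict (Ici 0)) := by
  have hPc : ContinuousOn P (Ici 0) := fun x hx => by
    have hx1 : (0 : ℝ) ≤ x + 1 := by linarith [mem_Ici.1 hx]
    refine ((hP (x + 1) hx1).continuousOn hx1 x ⟨hx, by linarith⟩).mono_of_mem_nhdsWithin ?_
    refine mem_nhdsWithin.2 ⟨Iio (x + 1), isOpen_Iio, by simp, fun y hy => ⟨hy.2, ?_⟩⟩
    exact (mem_Iio.1 hy.1).le
  have hPm : AEStronglyMeasurable P (volume.restrict (Ici 0)) :=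
    hPc.aestronglyMeasurable measurableSet_Ici
  rw [memLp_two_iff_integrable_sq_norm hPm]
  have hf2 := (memLp_two_iff_integrable_sq_norm hf.1).1 hf
  set κ := |c.re| with hκ
  have hκ0 : 0 < κ := abs_pos.2 hc
  set F := ∫ x in Ici (0 : ℝ), ‖f x‖ ^ 2 with hF
  have main : ∀ b : ℝ, 0 ≤ b → ∫ x in (0 : ℝ)..b, ‖P x‖ ^ 2 ≤
      κ⁻¹ * (2 * M ^ 2 + κ⁻¹ * F) := by
    intro b hb
    have hPb := hP b hb
    have hI : Icc 0 b ⊆ Ici (0 : ℝ) := Icc_subset_Ici_self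
    have hPcb : ContinuousOn P (uIcc 0 b) := by
      rw [uIcc_of_le hb]; exact hPc.mono hI
    have i1 : IntervalIntegrable (fun x => ‖P x‖ ^ 2) volume 0 b :=
      (hPcb.norm.pow 2).intervalIntegrable
    have i2 : IntervalIntegrable (fun x => ‖f x‖ ^ 2) volume 0 b := by
      rw [intervalIntegrable_iff_integrableOn_Icc_of_le hb]
      exact IntegrableOn.mono_set hf2 hI
    have hfb : IntervalIntegrable f volume 0 b := intervalIntegrable_of_memLp hf hb hI
    have hN := (hPb.conj.mul hb hPb)
    have hNb := hN.eq b ⟨hb, le_rfl⟩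
    -- This integrates `(|P|²)' = 2 Re c |P|² + 2 Re (conj P · f)`.
    have hre : ∫ x in (0 : ℝ)..b, (2 * c.re * ‖P x‖ ^ 2 +
        2 * (starRingEnd ℂ (P x) * f x).re) = ‖P b‖ ^ 2 - ‖P 0‖ ^ 2 := by
      have h1 := congrArg Complex.re hNb
      have h2 : (∫ x in (0 : ℝ)..b, (starRingEnd ℂ (c * P x + f x) * P x +
          starRingEnd ℂ (P x) * (c * P x + f x))).re = ∫ x in (0 : ℝ)..b,
          (starRingEnd ℂ (c * P x + f x) * P x +
          starRingEnd ℂ (P x) * (c * P x + f x)).re :=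
        (Complex.reCLM.intervalIntegral_comp_comm hN.int).symm
      rw [Complex.add_re, h2] at h1
      have h3 : ∀ z : ℂ, (starRingEnd ℂ z * z).re = ‖z‖ ^ 2 := fun z => by
        rw [← Complex.normSq_eq_conj_mul_self, Complex.ofReal_re, Complex.normSq_eq_norm_sq]
      rw [h3, h3] at h1
      rw [h1, add_sub_cancel_left]
      refine intervalIntegral.integral_congr fun x _ => ?_
      simp only [← h3]
      simp [Complex.mul_re, Complex.mul_im]
      ring
    have i3 : IntervalIntegrable (fun x => 2 * (starRingEnd ℂ (P x) * f x).re) volume 0 b := by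
      have : IntervalIntegrable (fun x => starRingEnd ℂ (P x) * f x) volume 0 b :=
        hfb.continuousOn_mul (Complex.continuous_conj.comp_continuousOn hPcb)
      have h : IntervalIntegrable (fun x => (starRingEnd ℂ (P x) * f x).re) volume 0 b :=
        ⟨this.1.re, this.2.re⟩
      exact h.const_mul 2
    rw [intervalIntegral.integral_add (i1.const_mul _) i3,
      intervalIntegral.integral_const_mul] at hre
    -- Young's inequality with weight `κ`: the term `κ ∫|P|²` is absorbed by `2κ ∫|P|²`, uniformly
    -- in `b`.
    have h4 : |∫ x in (0 : ℝ)..b, 2 * (starRingEnd ℂ (P x) * f x).re| ≤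
        κ * (∫ x in (0 : ℝ)..b, ‖P x‖ ^ 2) + κ⁻¹ * ∫ x in (0 : ℝ)..b, ‖f x‖ ^ 2 := by
      rw [← intervalIntegral.integral_const_mul, ← intervalIntegral.integral_const_mul,
        ← intervalIntegral.integral_add (i1.const_mul _) (i2.const_mul _)]
      rw [← Real.norm_eq_abs]
      refine (intervalIntegral.norm_integral_le_of_norm_le hb
        (Filter.Eventually.of_forall fun x _ => ?_) ((i1.const_mul _).add (i2.const_mul _)))
      have h5 := Complex.abs_re_le_norm (starRingEnd ℂ (P x) * f x)
      rw [norm_mul, Complex.norm_conj] at h5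
      rw [norm_mul, Real.norm_eq_abs, Real.norm_eq_abs, abs_two]
      have h6 : 0 ≤ κ⁻¹ * (κ * ‖P x‖ - ‖f x‖) ^ 2 := by positivity
      have h7 : κ⁻¹ * (κ * ‖P x‖ - ‖f x‖) ^ 2 =
          κ * ‖P x‖ ^ 2 + κ⁻¹ * ‖f x‖ ^ 2 - 2 * (‖P x‖ * ‖f x‖) := by
        field_simp
        ring
      linarith
    have h5 : ∫ x in (0 : ℝ)..b, ‖f x‖ ^ 2 ≤ F := by
      rw [intervalIntegral.integral_of_le hb]
      exact setIntegral_mono_set hf2 (Filter.Eventually.of_forall fun _ => by positivity)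
        (Filter.Eventually.of_forall (Ioc_subset_Icc_self.trans hI))
    have h6 : 0 ≤ ∫ x in (0 : ℝ)..b, ‖P x‖ ^ 2 :=
      intervalIntegral.integral_nonneg hb fun _ _ => by positivity
    have h7 : ‖P b‖ ^ 2 ≤ M ^ 2 := pow_le_pow_left₀ (norm_nonneg _) (hM b hb) 2
    have h8 : ‖P 0‖ ^ 2 ≤ M ^ 2 := pow_le_pow_left₀ (norm_nonneg _) (hM 0 le_rfl) 2
    have h7' : 0 ≤ ‖P b‖ ^ 2 := by positivity
    have h8' : 0 ≤ ‖P 0‖ ^ 2 := by positivity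
    have h9 : κ⁻¹ * ∫ x in (0 : ℝ)..b, ‖f x‖ ^ 2 ≤ κ⁻¹ * F :=
      mul_le_mul_of_nonneg_left h5 (inv_nonneg.2 hκ0.le)
    have h10 := abs_le.1 h4
    rw [← div_eq_inv_mul, le_div_iff₀ hκ0]
    rcases abs_cases c.re with ⟨hs, -⟩ | ⟨hs, -⟩ <;> rw [← hκ] at hs
    · rw [← hs] at hre
      nlinarith
    · have hs' : c.re = -κ := by linarith
      rw [hs'] at hre
      nlinarith
  have := integrableOn_Ioi_of_intervalIntegral_norm_bounded (μ := volume)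
    (f := fun x => ‖P x‖ ^ 2) (l := Filter.atTop) (b := fun b : ℝ => b)
    (κ⁻¹ * (2 * M ^ 2 + κ⁻¹ * F)) 0 (fun b => ?_) Filter.tendsto_id ?_
  · rwa [← integrableOn_Ici_iff_integrableOn_Ioi] at this
  · refine ((hPc.norm.pow 2).mono ?_ |>.integrableOn_compact isCompact_Icc).mono_set
      Ioc_subset_Icc_self
    exact Icc_subset_Ici_self
  · filter_upwards [Filter.eventually_ge_atTop 0] with b hb
    simpa using main b hb

theorem hasDerivAt_exp_mul (c : ℂ) (x : ℝ) :
    HasDerivAt (fun x : ℝ => Complex.exp (c * x)) (c * Complex.exp (c * x)) x := by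
  have : HasDerivAt (fun y : ℝ => Complex.exp (c * y)) (Complex.exp (c * x) * (c * 1)) x :=
    (((hasDerivAt_id (x : ℂ)).const_mul c).cexp).comp_ofReal
  exact this.congr_deriv (by ring)

/-- Variation of constants. -/
theorem isPrim_exp_mul_primitive {c C : ℂ} {f : ℝ → ℂ} {b : ℝ} (hb : 0 ≤ b)
    (hf : IntervalIntegrable f volume 0 b) :
    IsPrim b (fun x : ℝ => Complex.exp (c * x) *
        (C + ∫ t in (0 : ℝ)..x, Complex.exp (-c * t) * f t))
      (fun x : ℝ => c * (Complex.exp (c * x) *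
        (C + ∫ t in (0 : ℝ)..x, Complex.exp (-c * t) * f t)) + f x) := by
  have h1 : IsPrim b (fun x : ℝ => Complex.exp (c * x)) (fun x : ℝ => c * Complex.exp (c * x)) :=
    .of_hasDerivWithinAt (fun x _ => (hasDerivAt_exp_mul c x).hasDerivWithinAt)
      (by fun_prop) hb
  have h2 : IsPrim b (fun x : ℝ => C + ∫ t in (0 : ℝ)..x, Complex.exp (-c * t) * f t)
      (fun x : ℝ => Complex.exp (-c * x) * f x) :=
    ⟨hf.continuousOn_mul (by fun_prop), fun x _ => by simp⟩
  refine (h1.mul hb h2).congr fun x => ?_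
  have : Complex.exp (c * x) * Complex.exp (-c * x) = 1 := by
    rw [← Complex.exp_add, neg_mul, add_neg_cancel, Complex.exp_zero]
  linear_combination f x * this

/-- Pointwise, the product of the exponential and `|f|` is at most the sum of their squares. The
factor `e^d` is kept inside so that a growing prefactor and a decaying kernel are estimated
together. -/
theorem norm_setIntegral_exp_mul_le {c d : ℂ} {f : ℝ → ℂ} {s : Set ℝ} {K : ℝ}
    (hs0 : s ⊆ Ici 0)
    (hf : MemLp f 2 (volume.restrict (Ici 0)))
    (hi : IntegrableOn (fun t : ℝ => Real.exp (2 * (c.re * t + d.re))) s)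
    (hK : ∫ t in s, Real.exp (2 * (c.re * t + d.re)) ≤ K) :
    ‖Complex.exp d * ∫ t in s, Complex.exp (c * t) * f t‖ ≤
      K + ∫ t in Ici (0 : ℝ), ‖f t‖ ^ 2 := by
  have hf2 : IntegrableOn (fun t => ‖f t‖ ^ 2) (Ici 0) :=
    (memLp_two_iff_integrable_sq_norm hf.1).1 hf
  rw [← integral_const_mul]
  refine (norm_integral_le_of_norm_le (hi.add (hf2.mono_set hs0))
    (Filter.Eventually.of_forall fun t => ?_)).trans ?_
  · have h1 : ‖Complex.exp d * (Complex.exp (c * t) * f t)‖ =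
        Real.exp (c.re * t + d.re) * ‖f t‖ := by
      rw [norm_mul, norm_mul, Complex.norm_exp, Complex.norm_exp, Real.exp_add]
      simp only [Complex.mul_re, Complex.ofReal_re, Complex.ofReal_im, mul_zero, sub_zero]
      ring
    simp only [Pi.add_apply]
    rw [h1, two_mul (c.re * t + d.re), Real.exp_add (c.re * t + d.re) (c.re * t + d.re)]
    nlinarith [sq_nonneg (Real.exp (c.re * t + d.re) - ‖f t‖),
      sq_nonneg (Real.exp (c.re * t + d.re)), sq_nonneg ‖f t‖]
  · simp only [Pi.add_apply]
    rw [integral_add hi (hf2.mono_set hs0)]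
    refine add_le_add hK ?_
    exact setIntegral_mono_set hf2 (Filter.Eventually.of_forall fun _ => by positivity)
      (Filter.Eventually.of_forall hs0)

/-- Existence of a square integrable solution of `-u'' = ζ² u + f` on the half line. -/
theorem exists_lead_solution (hζ : 0 < ζ.im) {f : ℝ → ℂ}
    (hf : MemLp f 2 (volume.restrict (Ici 0))) :
    ∃ u v : ℝ → ℂ, IsH2 (Ici 0) u v (fun x => -ζ ^ 2 * u x - f x) := by
  have hζ0 : ζ ≠ 0 := fun h => by simp [h] at hζ
  set c : ℂ := Complex.I * ζ with hc
  have hcre : c.re = -ζ.im := by simp [hc]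
  have hfb : ∀ b : ℝ, 0 ≤ b → IntervalIntegrable f volume 0 b := fun b hb =>
    intervalIntegrable_of_memLp hf hb Icc_subset_Ici_self
  have hint : IntegrableOn (fun t : ℝ => Complex.exp (c * t) * f t) (Ici 0) :=
    (memLp_exp (by rw [hcre]; linarith)).integrable_mul hf
  -- The equation is diagonalised by `P' = iζ P + f` and `Q' = -iζ Q - f`, with `u = i/(2ζ) (P + Q)`
  -- and `u' = -(P - Q)/2`. The homogeneous solution of the `Q` equation grows; this initial value
  -- `C` makes `Q` the tail integral `e^{-iζx} ∫_x^∞ e^{iζt} f`, which stays bounded.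
  set C : ℂ := ∫ t in Ioi (0 : ℝ), Complex.exp (c * t) * f t with hC
  set P : ℝ → ℂ := fun x => Complex.exp (c * x) *
    (0 + ∫ t in (0 : ℝ)..x, Complex.exp (-c * t) * f t) with hP
  set Q : ℝ → ℂ := fun x => Complex.exp (-c * x) *
    (C + ∫ t in (0 : ℝ)..x, Complex.exp (-(-c) * t) * (-f t)) with hQ
  have hPp : ∀ b : ℝ, 0 ≤ b → IsPrim b P (fun x => c * P x + f x) := fun b hb =>
    isPrim_exp_mul_primitive hb (hfb b hb)
  have hQp : ∀ b : ℝ, 0 ≤ b → IsPrim b Q (fun x => -c * Q x + -f x) := fun b hb =>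
    isPrim_exp_mul_primitive hb (hfb b hb).neg
  have hexp : ∀ (a d : ℝ) (_ : a ≠ 0) (x y : ℝ), ∫ t in x..y, Real.exp (2 * (a * t + d)) =
      (2 * a)⁻¹ * (Real.exp (2 * (a * y + d)) - Real.exp (2 * (a * x + d))) := by
    intro a d ha x y
    rw [intervalIntegral.integral_eq_sub_of_hasDerivAt
      (f := fun t => (2 * a)⁻¹ * Real.exp (2 * (a * t + d)))]
    · ring
    · intro t _
      have h1 : HasDerivAt (fun t => 2 * (a * t + d)) (2 * (a * 1)) t :=
        (((hasDerivAt_id t).const_mul a).add_const d).const_mul 2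
      refine (h1.exp.const_mul (2 * a)⁻¹).congr_deriv ?_
      field_simp
    · exact Continuous.intervalIntegrable (by fun_prop) _ _
  have hPL : MemLp P 2 (volume.restrict (Ici 0)) := by
    refine memLp_of_bounded_solution (c := c) (by rw [hcre]; linarith) hf hPp
      (M := (2 * ζ.im)⁻¹ + ∫ t in Ici (0 : ℝ), ‖f t‖ ^ 2) fun x hx => ?_
    simp only [hP, zero_add, intervalIntegral.integral_of_le hx]
    have hi : Continuous fun t : ℝ => Real.exp (2 * ((-c).re * t + (c * x).re)) := by fun_prop
    refine norm_setIntegral_exp_mul_le (fun t ht => ht.1.le) hf (hi.integrableOn_Ioc) ?_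
    rw [← intervalIntegral.integral_of_le hx, hexp _ _ (by simp [hcre]; linarith)]
    have e : (-c).re * x + (c * x).re = 0 := by simp
    rw [e, mul_zero, Real.exp_zero, Complex.neg_re, hcre, neg_neg]
    refine mul_le_of_le_one_right (by positivity) ?_
    linarith [Real.exp_pos (2 * (ζ.im * 0 + (c * x).re))]
  have hQe : ∀ x : ℝ, 0 ≤ x → Q x = Complex.exp (-c * x) *
      ∫ t in Ioi x, Complex.exp (c * t) * f t := fun x hx => by
    have h1 : ∫ t in (0 : ℝ)..x, Complex.exp (-(-c) * t) * (-f t) =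
        -∫ t in (0 : ℝ)..x, Complex.exp (c * t) * f t := by
      rw [← intervalIntegral.integral_neg]
      refine intervalIntegral.integral_congr fun t _ => ?_
      simp
    simp only [hQ]
    rw [h1, hC, ← intervalIntegral.integral_Ioi_sub_Ioi 
      (hint.mono_set Ioi_subset_Ici_self) hx]
    ring
  have hQL : MemLp Q 2 (volume.restrict (Ici 0)) := by
    refine memLp_of_bounded_solution (c := -c) (by rw [Complex.neg_re, hcre]; simpa using hζ.ne')
      hf.neg hQp
      (M := (2 * ζ.im)⁻¹ + ∫ t in Ici (0 : ℝ), ‖f t‖ ^ 2) fun x hx => ?_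
    rw [hQe x hx]
    have e : ∀ t : ℝ, Real.exp (2 * (c.re * t + (-c * x).re)) =
        Real.exp (2 * (-c * x).re) * Real.exp (2 * c.re * t) := fun t => by
      rw [← Real.exp_add]
      ring_nf
    have h2 : 2 * c.re < 0 := by rw [hcre]; linarith
    refine norm_setIntegral_exp_mul_le (fun t ht => hx.trans (mem_Ioi.1 ht).le) hf ?_ ?_
    · simp_rw [e]
      exact (integrableOn_exp_mul_Ioi h2 x).const_mul _
    · simp_rw [e]
      rw [integral_const_mul, integral_exp_mul_Ioi h2, mul_div_assoc', mul_neg, ← Real.exp_add]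
      have : 2 * (-c * x).re + 2 * c.re * x = 0 := by
        simp
        ring
      rw [this, Real.exp_zero, hcre]
      refine le_of_eq ?_
      field_simp
  have hIb : ∀ b : ℝ, Icc 0 b ⊆ Ici (0 : ℝ) := fun b => Icc_subset_Ici_self
  have hu : MemLp (fun x => Complex.I / (2 * ζ) * (P x + Q x)) 2 (volume.restrict (Ici 0)) :=
    (hPL.add hQL).const_mul _
  have hv : MemLp (fun x => -(1 / 2) * (P x - Q x)) 2 (volume.restrict (Ici 0)) :=
    (hPL.sub hQL).const_mul _
  have hw : MemLp (fun x => -ζ ^ 2 * (Complex.I / (2 * ζ) * (P x + Q x)) - f x) 2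
      (volume.restrict (Ici 0)) := (hu.const_mul _).sub hf
  refine ⟨_, _, hu, hv, hw, fun x hx => ?_, fun x hx =>
    intervalIntegrable_of_memLp hw hx (hIb x), fun x hx => ?_⟩
  · have hx1 : (0 : ℝ) < x + 1 := by linarith [mem_Ici.1 hx]
    have h1 := hPp _ hx1.le
    have h2 := hQp _ hx1.le
    have hp : IsPrim (x + 1) (fun x => Complex.I / (2 * ζ) * (P x + Q x))
        (fun x => -(1 / 2) * (P x - Q x)) := by
      refine (IsPrim.linearComb hx1.le h1 h2 (Complex.I / (2 * ζ)) (Complex.I / (2 * ζ))).congr₂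
        (fun t => by ring) fun t => ?_
      rw [hc]
      field_simp
      ring_nf
      rw [Complex.I_sq]
      ring
    have hcont : ContinuousOn (fun x => -(1 / 2) * (P x - Q x)) (Icc 0 (x + 1)) :=
      continuousOn_const.mul ((h1.continuousOn hx1.le).sub (h2.continuousOn hx1.le))
    refine (hp.hasDerivWithinAt hx1 hcont ⟨hx, by linarith⟩).mono_of_mem_nhdsWithin ?_
    refine mem_nhdsWithin.2 ⟨Iio (x + 1), isOpen_Iio, by simp, fun y hy => ⟨hy.2, ?_⟩⟩
    exact (mem_Iio.1 hy.1).le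
  · have h1 := hPp x hx
    have h2 := hQp x hx
    have hp : IsPrim x (fun x => -(1 / 2) * (P x - Q x))
        (fun x => -ζ ^ 2 * (Complex.I / (2 * ζ) * (P x + Q x)) - f x) := by
      refine (IsPrim.linearComb hx h1 h2 (-(1 / 2)) (1 / 2)).congr₂
        (fun t => by ring) fun t => ?_
      rw [hc]
      field_simp
      ring
    exact hp.eq x ⟨hx, le_rfl⟩

end Lead

/-! ### Graphs of Sturm–Liouville operators: eigenvalues, symmetry, resolvent -/

section SLOperator
variable {ι : Type*} [Fintype ι] {I : ι → Set ℝ} {q : ι → ℝ → ℝ}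
  {B : Submodule ℂ ((ι → ℝ → ℂ) × (ι → ℝ → ℂ))}

theorem slOperator_graph (hI : ∀ j, I j = Ici 0 ∨ ∃ l > 0, I j = Icc 0 l) :
    (slOperator I q B).graph = slGraph I q B :=
  Submodule.toLinearPMap_graph_eq _ (slGraph_functional hI q B)

omit [Fintype ι] in
/-- A family of `H²` functions gives an element of the graph. -/
theorem exists_mem_slGraph {u v w : ι → ℝ → ℂ} {z : ℂ} {f : L2Sum I}
    (h : ∀ j, IsH2 (I j) (u j) (v j) (w j)) (hB : (u, v) ∈ B)
    (hw : ∀ j, w j =ᵐ[volume.restrict (I j)] fun x => ((q j x : ℂ) - z) * u j x - f j x) :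
    ∃ p ∈ slGraph I q B, p.2 - z • p.1 = f ∧ ∀ j, p.1 j =ᵐ[volume.restrict (I j)] u j := by
  let y : L2Sum I := WithLp.toLp 2 fun j => (h j).memLp_u.toLp (u j)
  have hy : ∀ j, y j =ᵐ[volume.restrict (I j)] u j := fun j => (h j).memLp_u.coeFn_toLp
  refine ⟨(y, f + z • y), ⟨u, v, w, h, hB, hy, fun j => ?_⟩, by simp, hy⟩
  filter_upwards [hw j, hy j, Lp.coeFn_add (f j) (z • y j), Lp.coeFn_smul z (y j)]
    with x h1 h2 h3 h4
  change (f j + z • y j : Lp ℂ 2 (volume.restrict (I j))) x = _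
  rw [h3, Pi.add_apply, h4, Pi.smul_apply, h2, h1, smul_eq_mul]
  ring

theorem isEigenvalue_slOperator_iff (hI : ∀ j, I j = Ici 0 ∨ ∃ l > 0, I j = Icc 0 l) {z : ℂ} :
    IsEigenvalue (slOperator I q B) z ↔ ∃ u v w : ι → ℝ → ℂ,
      (∀ j, IsH2 (I j) (u j) (v j) (w j)) ∧ (u, v) ∈ B ∧
      (∀ j, w j =ᵐ[volume.restrict (I j)] fun x => ((q j x : ℂ) - z) * u j x) ∧
      ∃ j, ¬ u j =ᵐ[volume.restrict (I j)] 0 := by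
  constructor
  · rintro ⟨y, hy, hy0⟩
    rw [mem_eigenspace_iff, slOperator_graph hI] at hy
    obtain ⟨u, v, w, h, hB, h3, h4⟩ := hy
    refine ⟨u, v, w, h, hB, fun j => ?_, ?_⟩
    · filter_upwards [h3 j, h4 j, Lp.coeFn_smul z (y j)] with x e1 e2 e3
      change (z • y j : Lp ℂ 2 (volume.restrict (I j))) x = _ at e2
      change y j x = _ at e1
      rw [e3, Pi.smul_apply, e1, smul_eq_mul] at e2
      linear_combination e2
    · by_contra! hc
      refine hy0 ?_
      ext1 j
      exact Lp.ext (((h3 j).trans (hc j)).trans (Lp.coeFn_zero ℂ 2 (volume.restrict (I j))).symm)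
  · rintro ⟨u, v, w, h, hB, hw, j, hj⟩
    have hw' : ∀ j, w j =ᵐ[volume.restrict (I j)]
        fun x => ((q j x : ℂ) - z) * u j x - (0 : L2Sum I) j x := fun j => by
      filter_upwards [hw j, Lp.coeFn_zero ℂ 2 (volume.restrict (I j))] with x e1 e2
      change _ = _ - (0 : Lp ℂ 2 (volume.restrict (I j))) x
      rw [e1, e2]
      simp
    obtain ⟨p, hp, hp0, hpu⟩ := exists_mem_slGraph h hB hw'
    refine ⟨p.1, ?_, fun h0 => hj ?_⟩
    · rw [mem_eigenspace_iff, slOperator_graph hI, ← sub_eq_zero.1 hp0]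
      exact hp
    · refine (hpu j).symm.trans ?_
      rw [h0]
      exact Lp.coeFn_zero ℂ 2 (volume.restrict (I j))

/-- The potential terms cancel because `q` is real. -/
theorem inner_lagrange {J : Set ℝ} {q : ℝ → ℝ} {u w u' w' : ℝ → ℂ}
    {f g f' g' : Lp ℂ 2 (volume.restrict J)} (hf : f =ᵐ[volume.restrict J] u)
    (hg : g =ᵐ[volume.restrict J] fun x => -w x + (q x : ℂ) * u x)
    (hf' : f' =ᵐ[volume.restrict J] u')
    (hg' : g' =ᵐ[volume.restrict J] fun x => -w' x + (q x : ℂ) * u' x) :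
    inner ℂ g f' - inner ℂ f g' =
      -∫ x in J, (starRingEnd ℂ (w x) * u' x - starRingEnd ℂ (u x) * w' x) := by
  rw [L2.inner_def, L2.inner_def, ← integral_sub (L2.integrable_inner _ _)
    (L2.integrable_inner _ _), ← integral_neg]
  refine integral_congr_ae ?_
  filter_upwards [hf, hg, hf', hg'] with x h1 h2 h3 h4
  simp only [RCLike.inner_apply, h1, h2, h3, h4, map_add, map_neg, map_mul, Complex.conj_ofReal]
  ring

/-- Reduces symmetry to the vanishing of the boundary terms in Green's formula, the only place where
`B` matters. -/
theorem slGraph_symmetric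
    (hB : ∀ u v w u' v' w' : ι → ℝ → ℂ, (∀ j, IsH2 (I j) (u j) (v j) (w j)) → (u, v) ∈ B →
      (∀ j, IsH2 (I j) (u' j) (v' j) (w' j)) → (u', v') ∈ B →
      ∑ j, ∫ x in I j, (starRingEnd ℂ (w j x) * u' j x - starRingEnd ℂ (u j x) * w' j x) = 0) :
    ∀ p ∈ slGraph I q B, ∀ p' ∈ slGraph I q B, inner ℂ p.2 p'.1 = inner ℂ p.1 p'.2 := by
  rintro p ⟨u, v, w, h1, h2, h3, h4⟩ p' ⟨u', v', w', h1', h2', h3', h4'⟩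
  rw [← sub_eq_zero, PiLp.inner_apply, PiLp.inner_apply, ← Finset.sum_sub_distrib]
  have := hB u v w u' v' w' h1 h2 h1' h2'
  rw [← neg_eq_zero, ← Finset.sum_neg_distrib] at this
  rw [← this]
  exact Finset.sum_congr rfl fun j _ => inner_lagrange (h3 j) (h4 j) (h3' j) (h4' j)

theorem mem_resolventSet_slOperator (hI : ∀ j, I j = Ici 0 ∨ ∃ l > 0, I j = Icc 0 l)
    (hA : ∀ p ∈ slGraph I q B, ∀ p' ∈ slGraph I q B, inner ℂ p.2 p'.1 = inner ℂ p.1 p'.2) {z : ℂ}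
    (hz : ∀ f : L2Sum I, ∃ p ∈ slGraph I q B, p.2 - z • p.1 = f)
    (hz' : ∀ f : L2Sum I, ∃ p ∈ slGraph I q B, p.2 - (starRingEnd ℂ z) • p.1 = f) :
    z ∈ resolventSet (slOperator I q B) := by
  rw [← slOperator_graph hI] at hA hz hz'
  have hc : CompleteSpace (L2Sum I) := inferInstance
  exact @mem_resolventSet_of_symmetric (L2Sum I) _ _ hc (slOperator I q B) hA z hz hz'

end SLOperator

/-! ### Tree combinatorics and symmetry of the three operators -/

section Tree
variable {V : Type*} [Fintype V] {G : SimpleGraph V} {r : V}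

omit [Fintype V] in
theorem Edge.head_ne_root (e : Edge G r) : e.head ≠ r := fun h => by
  have h1 := e.2
  change G.dist r e.head = _ at h1
  rw [h, SimpleGraph.dist_self] at h1
  omega

/-- The last step of a shortest path from the root shows surjectivity. Each undirected edge is
oriented in at most one way, so there are at most `|V| - 1` directed edges, and counting gives
injectivity. -/
theorem Edge.head_bijective [Nontrivial V] (hG : G.IsTree) :
    Function.Bijective fun e : Edge G r => (⟨e.head, e.head_ne_root⟩ : {x : V // x ≠ r}) := by
  classical
  have hsurj : Function.Surjective
      fun e : Edge G r => (⟨e.head, e.head_ne_root⟩ : {x : V // x ≠ r}) := by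
    rintro ⟨x, hx⟩
    obtain ⟨p, hp⟩ := hG.connected.exists_walk_length_eq_dist r x
    have hnn : ¬ p.Nil := SimpleGraph.Walk.not_nil_of_ne (Ne.symm hx)
    have hadj := p.adj_penultimate hnn
    have hl : p.dropLast.length + 1 = p.length := SimpleGraph.Walk.length_dropLast_add_one hnn
    have h1 : G.dist r p.penultimate ≤ p.dropLast.length := SimpleGraph.dist_le _
    have h2 : G.dist r x ≤ G.dist r p.penultimate + 1 := by
      obtain ⟨p', hp'⟩ := hG.connected.exists_walk_length_eq_dist r p.penultimate
      rw [← hp', ← SimpleGraph.Walk.length_concat p' hadj]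
      exact SimpleGraph.dist_le _
    exact ⟨⟨⟨(p.penultimate, x), hadj⟩, show G.dist r x = G.dist r p.penultimate + 1 by omega⟩, rfl⟩
  have hinj : Function.Injective (fun e : Edge G r => e.1.edge) := by
    rintro ⟨d, hd⟩ ⟨d', hd'⟩ h
    apply Subtype.ext
    rcases SimpleGraph.dart_edge_eq_iff d d' |>.1 h with h | h
    · exact h
    · subst h
      simp only [SimpleGraph.Dart.symm_toProd, Prod.fst_swap, Prod.snd_swap] at hd
      change G.dist r d'.fst = G.dist r d'.snd + 1 at hd
      omega
  have hle : Fintype.card (Edge G r) ≤ G.edgeFinset.card := by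
    rw [← Finset.card_univ]
    exact Finset.card_le_card_of_injOn (fun e => e.1.edge)
      (fun e _ => by simp [SimpleGraph.Dart.edge_mem]) (hinj.injOn)
  have htree := hG.card_edgeFinset
  have hV : Fintype.card {x : V // x ≠ r} + 1 = Fintype.card V := by
    rw [Fintype.card_subtype_compl, Fintype.card_subtype_eq]
    have := Fintype.card_pos_iff.2 (⟨r⟩ : Nonempty V)
    omega
  have hge := Fintype.card_le_of_surjective _ hsurj
  exact (Fintype.bijective_iff_surjective_and_card _).2 ⟨hsurj, by omega⟩

theorem mem_inEdges {x : V} {e : Edge G r} : e ∈ inEdges G r x ↔ e.head = x := by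
  simp [inEdges]

theorem mem_outEdges {x : V} {e : Edge G r} : e ∈ outEdges G r x ↔ e.tail = x := by
  simp [outEdges]

theorem exists_inEdges_eq_singleton [Nontrivial V] (hG : G.IsTree) {x : V} (hx : x ≠ r) :
    ∃ j, inEdges G r x = {j} := by
  obtain ⟨j, hj⟩ := (Edge.head_bijective hG).2 (⟨x, hx⟩ : {x : V // x ≠ r})
  have hjx : j.head = x := congrArg Subtype.val hj
  refine ⟨j, Finset.ext fun e => ?_⟩
  rw [mem_inEdges, Finset.mem_singleton]
  refine ⟨fun he => (Edge.head_bijective hG).1 (Subtype.ext (he.trans hjx.symm)), ?_⟩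
  rintro rfl
  exact hjx

theorem inEdges_root : inEdges G r r = ∅ :=
  Finset.eq_empty_of_forall_notMem fun e he => e.head_ne_root (mem_inEdges.1 he)

/-- Summation by parts over the vertices of the tree. -/
theorem sum_vertices [Nontrivial V] (hG : G.IsTree) {a b c d : Edge G r → ℂ}
    (hc : ∀ x ≠ r, ∀ j ∈ inEdges G r x, ∀ k ∈ outEdges G r x, c j = d k)
    (ha : ∀ x ≠ r, ∑ j ∈ inEdges G r x, a j = ∑ k ∈ outEdges G r x, b k) :
    ∑ e, (a e * c e - b e * d e) = -∑ k ∈ outEdges G r r, b k * d k := by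
  classical
  have e1 : ∑ e, a e * c e = ∑ x, ∑ j ∈ inEdges G r x, a j * c j := by
    rw [← Finset.sum_fiberwise Finset.univ Edge.head]
    refine Finset.sum_congr rfl fun x _ => Finset.sum_congr ?_ fun _ _ => rfl
    ext e
    simp [mem_inEdges]
  have e2 : ∑ e, b e * d e = ∑ x, ∑ k ∈ outEdges G r x, b k * d k := by
    rw [← Finset.sum_fiberwise Finset.univ Edge.tail]
    refine Finset.sum_congr rfl fun x _ => Finset.sum_congr ?_ fun _ _ => rfl
    ext e
    simp [mem_outEdges]
  -- Regrouped by vertices, every non-root vertex contributes zero: its single incoming edge gives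
  -- one value of `c`, shared with all outgoing edges, and the sums of `a` and `b` balance. The root
  -- has no incoming edge.
  rw [Finset.sum_sub_distrib, e1, e2, ← Finset.sum_sub_distrib,
    Finset.sum_eq_single_of_mem r (Finset.mem_univ r)]
  · simp [inEdges_root]
  · intro x _ hx
    obtain ⟨j, hj⟩ := exists_inEdges_eq_singleton hG hx
    have h1 := ha x hx
    have h2 := hc x hx j (by simp [hj])
    rw [hj, Finset.sum_singleton] at h1 ⊢
    rw [h1, Finset.sum_mul, sub_eq_zero]
    exact Finset.sum_congr rfl fun k hk => by rw [h2 k hk]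

/-- Each half of the Wronskian is a product of a Kirchhoff factor and a continuous factor;
`sum_vertices` is applied with the roles of the two families exchanged. -/
theorem sum_wronsk [Nontrivial V] (hG : G.IsTree) {ℓ : ℝ} {u v u' v' : Edge G r → ℝ → ℂ}
    (h : (u, v) ∈ standardOffRoot G r ℓ) (h' : (u', v') ∈ standardOffRoot G r ℓ) :
    ∑ e, (wronsk (u e) (v e) (u' e) (v' e) ℓ - wronsk (u e) (v e) (u' e) (v' e) 0) =
      -∑ k ∈ outEdges G r r, wronsk (u k) (v k) (u' k) (v' k) 0 := by
  have h1 := sum_vertices hG (a := fun e => starRingEnd ℂ (v e ℓ))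
    (b := fun e => starRingEnd ℂ (v e 0)) (c := fun e => u' e ℓ) (d := fun e => u' e 0)
    (fun x hx j hj k hk => sub_eq_zero.1 ((h' x hx).1 j hj k hk))
    (fun x hx => by
      rw [← map_sum, ← map_sum, sub_eq_zero.1 (h x hx).2])
  have h2 := sum_vertices hG (a := fun e => v' e ℓ)
    (b := fun e => v' e 0) (c := fun e => starRingEnd ℂ (u e ℓ))
    (d := fun e => starRingEnd ℂ (u e 0))
    (fun x hx j hj k hk => congrArg (starRingEnd ℂ) (sub_eq_zero.1 ((h x hx).1 j hj k hk)))
    (fun x hx => sub_eq_zero.1 (h' x hx).2)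
  simp only [wronsk, Finset.sum_sub_distrib] at h1 h2 ⊢
  simp only [mul_comm (v' _ _)] at h2
  linear_combination h1 - h2

theorem sum_green [Nontrivial V] (hG : G.IsTree) {ℓ : ℝ} (hℓ : 0 < ℓ)
    {u v w u' v' w' : Edge G r → ℝ → ℂ}
    (hu : ∀ e, IsH2 (Icc 0 ℓ) (u e) (v e) (w e)) (h : (u, v) ∈ standardOffRoot G r ℓ)
    (hu' : ∀ e, IsH2 (Icc 0 ℓ) (u' e) (v' e) (w' e)) (h' : (u', v') ∈ standardOffRoot G r ℓ) :
    ∑ e, ∫ x in Icc 0 ℓ, (starRingEnd ℂ (w e x) * u' e x - starRingEnd ℂ (u e x) * w' e x) =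
      -∑ k ∈ outEdges G r r, wronsk (u k) (v k) (u' k) (v' k) 0 := by
  rw [← sum_wronsk hG h h']
  exact Finset.sum_congr rfl fun e _ => (hu e).green_Icc hℓ.le (hu' e)

omit [Fintype V] in
theorem sum_wronsk_root {s : Finset (Edge G r)} {u v u' v' : Edge G r → ℝ → ℂ} {c c' : ℂ}
    (hc : ∀ k ∈ s, u k 0 = c) (hc' : ∀ k ∈ s, u' k 0 = c') :
    ∑ k ∈ s, wronsk (u k) (v k) (u' k) (v' k) 0 =
      starRingEnd ℂ (∑ k ∈ s, v k 0) * c' - starRingEnd ℂ c * ∑ k ∈ s, v' k 0 := by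
  rw [map_sum, Finset.sum_mul, Finset.mul_sum, ← Finset.sum_sub_distrib]
  exact Finset.sum_congr rfl fun k hk => by rw [wronsk, hc k hk, hc' k hk]

theorem exists_const_of_forall_sub_eq_zero {α : Type*} {s : Finset α} {f : α → ℂ}
    (h : ∀ j ∈ s, ∀ k ∈ s, f j - f k = 0) : ∃ c, ∀ k ∈ s, f k = c := by
  rcases s.eq_empty_or_nonempty with rfl | ⟨j, hj⟩
  · simp
  · exact ⟨f j, fun k hk => (sub_eq_zero.1 (h j hj k hk)).symm⟩

variable {ℓ : ℝ} {q : Edge G r → ℝ → ℝ}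

omit [Fintype V] in
theorem edgeInterval (hℓ : 0 < ℓ) (_ : Edge G r) :
    Icc 0 ℓ = Ici 0 ∨ ∃ l > 0, Icc 0 ℓ = Icc 0 l := .inr ⟨ℓ, hℓ, rfl⟩

omit [Fintype V] in
theorem leadInterval_cases (hℓ : 0 < ℓ) (j : Option (Edge G r)) :
    leadInterval G r ℓ j = Ici 0 ∨ ∃ l > 0, leadInterval G r ℓ j = Icc 0 l := by
  cases j
  · exact .inl rfl
  · exact .inr ⟨ℓ, hℓ, rfl⟩

theorem LInf_graph (hℓ : 0 < ℓ) : (LInf G r ℓ q).graph =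
    slGraph (leadInterval G r ℓ) (leadPotential G r q) (standardLead G r ℓ) :=
  slOperator_graph (leadInterval_cases hℓ)

theorem LD_symmetric [Nontrivial V] (hG : G.IsTree) (hℓ : 0 < ℓ) :
    ∀ p ∈ slGraph (fun _ => Icc 0 ℓ) q (standardOffRoot G r ℓ ⊓ dirichletRoot G r),
    ∀ p' ∈ slGraph (fun _ => Icc 0 ℓ) q (standardOffRoot G r ℓ ⊓ dirichletRoot G r),
      inner ℂ p.2 p'.1 = inner ℂ p.1 p'.2 := by
  refine slGraph_symmetric fun u v w u' v' w' h hB h' hB' => ?_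
  rw [sum_green hG hℓ h hB.1 h' hB'.1, sum_wronsk_root hB.2 hB'.2]
  simp

theorem LN_symmetric [Nontrivial V] (hG : G.IsTree) (hℓ : 0 < ℓ) :
    ∀ p ∈ slGraph (fun _ => Icc 0 ℓ) q (standardOffRoot G r ℓ ⊓ standardRoot G r),
    ∀ p' ∈ slGraph (fun _ => Icc 0 ℓ) q (standardOffRoot G r ℓ ⊓ standardRoot G r),
      inner ℂ p.2 p'.1 = inner ℂ p.1 p'.2 := by
  refine slGraph_symmetric fun u v w u' v' w' h hB h' hB' => ?_
  obtain ⟨c, hc⟩ := exists_const_of_forall_sub_eq_zero hB.2.1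
  obtain ⟨c', hc'⟩ := exists_const_of_forall_sub_eq_zero hB'.2.1
  have h1 : ∑ k ∈ outEdges G r r, v k 0 = 0 := hB.2.2
  have h2 : ∑ k ∈ outEdges G r r, v' k 0 = 0 := hB'.2.2
  rw [sum_green hG hℓ h hB.1 h' hB'.1, sum_wronsk_root hc hc', h1, h2]
  simp

/-- The boundary term of the tree at the root cancels the one of the lead at `0`, by continuity and
Kirchhoff's condition there. -/
theorem LInf_symmetric [Nontrivial V] (hG : G.IsTree) (hℓ : 0 < ℓ) :
    ∀ p ∈ slGraph (leadInterval G r ℓ) (leadPotential G r q) (standardLead G r ℓ),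
    ∀ p' ∈ slGraph (leadInterval G r ℓ) (leadPotential G r q) (standardLead G r ℓ),
      inner ℂ p.2 p'.1 = inner ℂ p.1 p'.2 := by
  refine slGraph_symmetric fun u v w u' v' w' h hB h' hB' => ?_
  have h1 : v none 0 + ∑ k ∈ outEdges G r r, v (some k) 0 = 0 := hB.2.2
  have h2 : v' none 0 + ∑ k ∈ outEdges G r r, v' (some k) 0 = 0 := hB'.2.2
  have hlead : ∫ x in Ici (0 : ℝ), (starRingEnd ℂ (w none x) * u' none x -
      starRingEnd ℂ (u none x) * w' none x) = _ := (h none).green_Ici (h' none)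
  have htree := sum_green hG hℓ (fun e => h (some e)) hB.1 (fun e => h' (some e)) hB'.1
  rw [sum_wronsk_root (c := u none 0) (c' := u' none 0)
    (fun k hk => (sub_eq_zero.1 (hB.2.1 k hk)).symm)
    (fun k hk => (sub_eq_zero.1 (hB'.2.1 k hk)).symm)] at htree
  rw [Fintype.sum_option]
  simp only [leadInterval]
  rw [htree, hlead, wronsk]
  have h1' := congrArg (starRingEnd ℂ) h1
  rw [map_add, map_zero] at h1'
  linear_combination -(u' none 0) * h1' + starRingEnd ℂ (u none 0) * h2

end Tree

/-! ### Characteristic determinants; the Jost function as a Robin determinant -/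

section Characteristic
variable {V : Type*} [Fintype V] {G : SimpleGraph V} {r : V} (N : Arrangement G r) (ℓ : ℝ)

theorem offRootForm_add (u v u' v' : Edge G r → ℝ → ℂ) (i) :
    offRootForm ℓ (u + u') (v + v') i = offRootForm ℓ u v i + offRootForm ℓ u' v' i := by
  rcases i with k | x <;> simp only [offRootForm, Pi.add_apply, Finset.sum_add_distrib] <;> ring

theorem offRootForm_smul (a : ℂ) (u v : Edge G r → ℝ → ℂ) (i) :
    offRootForm ℓ (a • u) (a • v) i = a * offRootForm ℓ u v i := by
  rcases i with k | x <;>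
    simp only [offRootForm, Pi.smul_apply, smul_eq_mul, ← Finset.mul_sum] <;> ring

/-- The boundary forms of Problem D as a linear map. -/
def Arrangement.linD : ((Edge G r → ℝ → ℂ) × (Edge G r → ℝ → ℂ)) →ₗ[ℂ] (N.Cond → ℂ) where
  toFun p := N.formD ℓ p.1 p.2
  map_add' p p' := by
    funext i
    rcases i with k | i
    · rfl
    · exact offRootForm_add ℓ _ _ _ _ i
  map_smul' a p := by
    funext i
    rcases i with k | i
    · rfl
    · exact offRootForm_smul ℓ a _ _ i

/-- The root forms with the Robin condition `∑ y_k'(0) + h y(v₀)`. -/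
def Arrangement.rootRobin (h : ℂ) (u v : Edge G r → ℝ → ℂ) : Fin (N.m + 1) → ℂ :=
  Fin.lastCases (motive := fun _ => ℂ)
    ((∑ j, v (N.rootEdge j) 0) + h * u (N.rootEdge 0) 0)
    (fun i => u (N.rootEdge 0) 0 - u (N.rootEdge i.succ) 0)

/-- The boundary forms with a Robin condition at the root as a linear map. -/
def Arrangement.linR (h : ℂ) :
    ((Edge G r → ℝ → ℂ) × (Edge G r → ℝ → ℂ)) →ₗ[ℂ] (N.Cond → ℂ) where
  toFun p := Sum.elim (N.rootRobin h p.1 p.2) (offRootForm ℓ p.1 p.2)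
  map_add' p p' := by
    funext i
    rcases i with k | i
    · refine Fin.lastCases ?_ (fun i => ?_) k
      · simp [Arrangement.rootRobin, Finset.sum_add_distrib]
        ring
      · simp [Arrangement.rootRobin]
        ring
    · exact offRootForm_add ℓ _ _ _ _ i
  map_smul' a p := by
    funext i
    rcases i with k | i
    · refine Fin.lastCases ?_ (fun i => ?_) k
      · simp [Arrangement.rootRobin, ← Finset.mul_sum]
        ring
      · simp [Arrangement.rootRobin]
        ring
    · exact offRootForm_smul ℓ a _ _ i

theorem Arrangement.linR_inl_last (h : ℂ) (p) : N.linR ℓ h p (.inl (Fin.last N.m)) =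
    (∑ j, p.2 (N.rootEdge j) 0) + h * p.1 (N.rootEdge 0) 0 := by
  simp [Arrangement.linR, Arrangement.rootRobin]

theorem Arrangement.linR_inl_castSucc (h : ℂ) (p) (i : Fin N.m) :
    N.linR ℓ h p (.inl i.castSucc) = p.1 (N.rootEdge 0) 0 - p.1 (N.rootEdge i.succ) 0 := by
  simp [Arrangement.linR, Arrangement.rootRobin]

theorem Arrangement.linR_inr (h : ℂ) (p) (i) :
    N.linR ℓ h p (.inr i) = offRootForm ℓ p.1 p.2 i := rfl

theorem Arrangement.formN_eq_linR (u v : Edge G r → ℝ → ℂ) :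
    N.formN ℓ u v = N.linR ℓ 0 (u, v) := by
  funext i
  rcases i with k | i
  · refine Fin.lastCases ?_ (fun i => ?_) k
    · rw [Arrangement.linR_inl_last]
      simp [Arrangement.formN]
    · rw [Arrangement.linR_inl_castSucc]
      simp [Arrangement.formN]
  · rfl

variable {ℓ} {q : Edge G r → ℝ → ℝ}

/-- The family `y_j = a_j c_j + b_j s_j` with its derivatives. -/
def solFamily (ℓ : ℝ) (q : Edge G r → ℝ → ℝ) (lam : ℂ) (c : Edge G r ⊕ Edge G r → ℂ) :
    (Edge G r → ℝ → ℂ) × (Edge G r → ℝ → ℂ) :=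
  ∑ k, c k • basisFamily ℓ q lam k

theorem solFamily_fst (lam : ℂ) (c : Edge G r ⊕ Edge G r → ℂ) (e : Edge G r) :
    (solFamily ℓ q lam c).1 e =
      c (.inl e) • (slSol ℓ (q e) lam 1 0).1 + c (.inr e) • (slSol ℓ (q e) lam 0 1).1 := by
  simp only [solFamily, Fintype.sum_sum_type, Prod.fst_add, Prod.fst_sum, Pi.add_apply,
    Finset.sum_apply, Prod.smul_fst, basisFamily, Pi.smul_apply]
  congr 1
  · rw [Finset.sum_eq_single e (fun e' _ he => by rw [Pi.single_eq_of_ne he.symm, smul_zero])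
      (by simp), Pi.single_eq_same]
  · rw [Finset.sum_eq_single e (fun e' _ he => by rw [Pi.single_eq_of_ne he.symm, smul_zero])
      (by simp), Pi.single_eq_same]

theorem solFamily_snd (lam : ℂ) (c : Edge G r ⊕ Edge G r → ℂ) (e : Edge G r) :
    (solFamily ℓ q lam c).2 e =
      c (.inl e) • (slSol ℓ (q e) lam 1 0).2 + c (.inr e) • (slSol ℓ (q e) lam 0 1).2 := by
  simp only [solFamily, Fintype.sum_sum_type, Prod.snd_add, Prod.snd_sum, Pi.add_apply,
    Finset.sum_apply, Prod.smul_snd, basisFamily, Pi.smul_apply]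
  congr 1
  · rw [Finset.sum_eq_single e (fun e' _ he => by rw [Pi.single_eq_of_ne he.symm, smul_zero])
      (by simp), Pi.single_eq_same]
  · rw [Finset.sum_eq_single e (fun e' _ he => by rw [Pi.single_eq_of_ne he.symm, smul_zero])
      (by simp), Pi.single_eq_same]

section SolFamily
variable (hℓ : 0 < ℓ) (hq : ∀ e, MemLp (q e) 2 (volume.restrict (Icc 0 ℓ)))
include hℓ hq

theorem isSLSolution_solFamily (lam : ℂ) (c : Edge G r ⊕ Edge G r → ℂ) (e : Edge G r) :
    IsSLSolution ℓ (q e) lam ((solFamily ℓ q lam c).1 e) ((solFamily ℓ q lam c).2 e) := by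
  rw [solFamily_fst, solFamily_snd]
  exact (slSol_spec hℓ (hq e) lam 1 0).1.linearComb (slSol_spec hℓ (hq e) lam 0 1).1 hℓ (hq e) _ _

theorem solFamily_fst_zero (lam : ℂ) (c : Edge G r ⊕ Edge G r → ℂ) (e : Edge G r) :
    (solFamily ℓ q lam c).1 e 0 = c (.inl e) := by
  rw [solFamily_fst]
  simp [(slSol_spec hℓ (hq e) lam 1 0).2.1, (slSol_spec hℓ (hq e) lam 0 1).2.1]

theorem solFamily_snd_zero (lam : ℂ) (c : Edge G r ⊕ Edge G r → ℂ) (e : Edge G r) :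
    (solFamily ℓ q lam c).2 e 0 = c (.inr e) := by
  rw [solFamily_snd]
  simp [(slSol_spec hℓ (hq e) lam 1 0).2.2, (slSol_spec hℓ (hq e) lam 0 1).2.2]

end SolFamily

/-- The characteristic matrix of a linear family of boundary conditions. -/
def Arrangement.charMatrix (F : ((Edge G r → ℝ → ℂ) × (Edge G r → ℝ → ℂ)) →ₗ[ℂ] (N.Cond → ℂ))
    (ℓ : ℝ) (q : Edge G r → ℝ → ℝ) (lam : ℂ) :
    Matrix (Fin (2 * Fintype.card (Edge G r))) (Fin (2 * Fintype.card (Edge G r))) ℂ :=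
  Matrix.reindex N.row N.col (Matrix.of fun i k => F (basisFamily ℓ q lam k) i)

variable (F : ((Edge G r → ℝ → ℂ) × (Edge G r → ℝ → ℂ)) →ₗ[ℂ] (N.Cond → ℂ)) (lam : ℂ)

theorem Arrangement.charMatrix_mulVec (c : Fin (2 * Fintype.card (Edge G r)) → ℂ) (i) :
    (N.charMatrix F ℓ q lam).mulVec c i = F (solFamily ℓ q lam (c ∘ N.col)) (N.row.symm i) := by
  simp only [Arrangement.charMatrix, solFamily, map_sum, map_smul, Finset.sum_apply,
    Pi.smul_apply, smul_eq_mul, Matrix.mulVec, dotProduct, Matrix.reindex_apply,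
    Matrix.submatrix_apply, Matrix.of_apply, Function.comp_apply]
  rw [← Equiv.sum_comp N.col]
  refine Finset.sum_congr rfl fun k _ => ?_
  rw [Equiv.symm_apply_apply, mul_comm]

theorem Arrangement.det_charMatrix_eq_zero_iff :
    (N.charMatrix F ℓ q lam).det = 0 ↔ ∃ c, c ≠ 0 ∧ F (solFamily ℓ q lam c) = 0 := by
  rw [← Matrix.exists_mulVec_eq_zero_iff]
  constructor
  · rintro ⟨c, hc, h⟩
    refine ⟨c ∘ N.col, fun h0 => hc ?_, funext fun i => ?_⟩
    · funext i
      simpa using congrFun h0 (N.col.symm i)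
    · have := congrFun h (N.row i)
      rwa [N.charMatrix_mulVec, Equiv.symm_apply_apply] at this
  · rintro ⟨c, hc, h⟩
    refine ⟨c ∘ N.col.symm, fun h0 => hc ?_, funext fun i => ?_⟩
    · funext i
      simpa using congrFun h0 (N.col i)
    · rw [N.charMatrix_mulVec, Function.comp_assoc, Equiv.symm_comp_self, Function.comp_id, h]
      rfl

variable {F lam} in
theorem Arrangement.exists_solFamily_of_det_ne_zero (h : (N.charMatrix F ℓ q lam).det ≠ 0)
    (b : N.Cond → ℂ) : ∃ c, F (solFamily ℓ q lam c) = b := by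
  have hu : IsUnit (N.charMatrix F ℓ q lam).det := isUnit_iff_ne_zero.2 h
  refine ⟨((N.charMatrix F ℓ q lam)⁻¹.mulVec (b ∘ N.row.symm)) ∘ N.col, funext fun i => ?_⟩
  have := N.charMatrix_mulVec (ℓ := ℓ) (q := q) F lam
    ((N.charMatrix F ℓ q lam)⁻¹.mulVec (b ∘ N.row.symm)) (N.row i)
  rw [Matrix.mulVec_mulVec, Matrix.mul_nonsing_inv _ hu, Matrix.one_mulVec,
    Equiv.symm_apply_apply, Function.comp_apply, Equiv.symm_apply_apply] at this
  exact this.symm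

theorem Arrangement.phiD_eq : N.phiD ℓ q lam = (N.charMatrix (N.linD ℓ) ℓ q lam).det := rfl

theorem Arrangement.phiN_eq : N.phiN ℓ q lam = (N.charMatrix (N.linR ℓ 0) ℓ q lam).det := by
  unfold Arrangement.phiN Arrangement.PhiN Arrangement.charMatrix
  simp_rw [Arrangement.formN_eq_linR]

/-- The matrix that carries `(y₁, …, y_d)` to `(y₁ - y₂, …, y₁ - y_d, y₁)`. -/
def rootChange (m : ℕ) : Matrix (Fin (m + 1)) (Fin (m + 1)) ℂ :=
  Matrix.of fun i => Fin.lastCases (motive := fun _ => Fin (m + 1) → ℂ) (Pi.single 0 1)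
    (fun i => Pi.single 0 1 - Pi.single i.succ 1) i

/-- Expanding along the last row `(1, 0, …, 0)` leaves the minor `-1` of size `m`; its sign `(-1)^m`
cancels the sign of the cofactor. -/
theorem det_rootChange (m : ℕ) : (rootChange m).det = 1 := by
  rw [Matrix.det_succ_row _ (Fin.last m), Finset.sum_eq_single 0]
  · have hsub : (rootChange m).submatrix (Fin.last m).succAbove (Fin.succAbove 0) =
        -(1 : Matrix (Fin m) (Fin m) ℂ) := by
      ext i j
      simp [rootChange, Matrix.one_apply, Pi.single_apply, eq_comm]
    rw [hsub, Matrix.det_neg, Matrix.det_one]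
    simp [rootChange, ← mul_pow]
  · intro j _ hj
    simp [rootChange, hj]
  · simp

/-- The parameter `h` enters one row only, so the determinant is affine in `h`. Its coefficient has
`y₁(0)` in that row; the root rows are then `y₁ - y₂, …, y₁ - y_d, y₁`, which arise from the
Dirichlet rows by `rootChange`. As that matrix has determinant `1`, the coefficient is exactly
`φ_D`, with no sign or factor. -/
theorem Arrangement.det_charMatrix_linR (h : ℂ) :
    (N.charMatrix (N.linR ℓ h) ℓ q lam).det = N.phiN ℓ q lam + h * N.phiD ℓ q lam := by
  classical
  set i₀ := N.row (.inl (Fin.last N.m))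
  set y : Fin (2 * Fintype.card (Edge G r)) → ℂ :=
    fun k => (basisFamily ℓ q lam (N.col.symm k)).1 (N.rootEdge 0) 0
  have h1 : N.charMatrix (N.linR ℓ h) ℓ q lam = (N.charMatrix (N.linR ℓ 0) ℓ q lam).updateRow i₀
      (N.charMatrix (N.linR ℓ 0) ℓ q lam i₀ + h • y) := by
    ext i k
    obtain ⟨i, rfl⟩ := N.row.surjective i
    by_cases hi : i = .inl (Fin.last N.m)
    · subst hi
      rw [Matrix.updateRow_self]
      simp [Arrangement.charMatrix, i₀, y, Arrangement.linR_inl_last]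
    · rw [Matrix.updateRow_ne (fun h => hi (N.row.injective h))]
      simp only [Arrangement.charMatrix, Matrix.reindex_apply, Matrix.submatrix_apply,
        Matrix.of_apply, Equiv.symm_apply_apply]
      rcases i with i | i
      · revert hi
        refine Fin.lastCases (fun hi => absurd rfl hi) (fun i _ => ?_) i
        rw [Arrangement.linR_inl_castSucc, Arrangement.linR_inl_castSucc]
      · rfl
  have h2 : (N.charMatrix (N.linR ℓ 0) ℓ q lam).updateRow i₀ y =
      Matrix.reindex N.row N.row (Matrix.fromBlocks (rootChange N.m) 0 0 1) *
        N.charMatrix (N.linD ℓ) ℓ q lam := by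
    ext i k
    obtain ⟨i, rfl⟩ := N.row.surjective i
    rw [Matrix.mul_apply, ← Equiv.sum_comp N.row, Fintype.sum_sum_type]
    simp only [Arrangement.charMatrix, Matrix.reindex_apply, Matrix.submatrix_apply,
        Matrix.of_apply, Equiv.symm_apply_apply]
    rcases i with i | i
    · refine Fin.lastCases ?_ (fun i => ?_) i
      · rw [Matrix.updateRow_self]
        simp [y, rootChange, Pi.single_apply, Arrangement.linD, Arrangement.formD]
      · rw [Matrix.updateRow_ne (fun h => (Fin.castSucc_lt_last i).ne
          (Sum.inl_injective (N.row.injective h)))]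
        simp [Arrangement.linR_inl_castSucc, rootChange, Pi.single_apply, Arrangement.linD,
          Arrangement.formD, sub_mul, Finset.sum_sub_distrib]
    · rw [Matrix.updateRow_ne (fun h => by simpa using N.row.injective h)]
      simp [Arrangement.linR_inr, Matrix.one_apply, Arrangement.linD, Arrangement.formD]
  rw [h1, Matrix.det_updateRow_add, Matrix.updateRow_eq_self, Matrix.det_updateRow_smul, h2,
    Matrix.det_mul, Matrix.det_reindex_self, Matrix.det_fromBlocks_zero₂₁, det_rootChange,
    Matrix.det_one, one_mul, one_mul, N.phiN_eq, N.phiD_eq]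

theorem Arrangement.jost_eq (ζ : ℂ) : N.jost ℓ q ζ =
    (N.charMatrix (N.linR ℓ (Complex.I * ζ)) ℓ q (ζ ^ 2)).det := by
  rw [N.det_charMatrix_linR, Arrangement.jost]

theorem rootEdge_tail (j) : (N.rootEdge j : Edge G r) ∈ outEdges G r r :=
  mem_outEdges.2 (N.rootEdge j).2

theorem exists_rootEdge {k : Edge G r} (hk : k ∈ outEdges G r r) : ∃ j, N.rootEdge j = k := by
  obtain ⟨j, hj⟩ := N.rootEdge.surjective ⟨k, mem_outEdges.1 hk⟩
  exact ⟨j, by rw [hj]⟩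

theorem sum_rootEdge (f : Edge G r → ℂ) : ∑ j, f (N.rootEdge j) = ∑ k ∈ outEdges G r r, f k := by
  refine Finset.sum_bij (fun j _ => (N.rootEdge j : Edge G r)) (fun j _ => rootEdge_tail N j)
    (fun i _ j _ h => N.rootEdge.injective (Subtype.ext h)) (fun k hk => ?_) (fun _ _ => rfl)
  obtain ⟨j, hj⟩ := exists_rootEdge N hk
  exact ⟨j, Finset.mem_univ _, hj⟩

/-- Since a non-root vertex has exactly one incoming edge, one continuity equation per outgoing
edge, with a one-term sum, expresses continuity at the vertex. -/
theorem offRootForm_eq_zero_iff [Nontrivial V] (hG : G.IsTree) {u v : Edge G r → ℝ → ℂ} :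
    offRootForm ℓ u v = 0 ↔ (u, v) ∈ standardOffRoot G r ℓ := by
  constructor
  · intro h x hx
    refine ⟨fun j hj k hk => ?_, congrFun h (.inr ⟨x, hx⟩)⟩
    have hkx := mem_outEdges.1 hk
    have h1 := congrFun h (.inl ⟨k, by rw [hkx]; exact hx⟩)
    simp only [offRootForm, Pi.zero_apply, hkx] at h1
    obtain ⟨j', hj'⟩ := exists_inEdges_eq_singleton hG hx
    rw [hj', Finset.mem_singleton] at hj
    rw [hj', Finset.sum_singleton, ← hj] at h1
    exact h1
  · intro h
    funext i
    rcases i with ⟨k, hk⟩ | ⟨x, hx⟩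
    · obtain ⟨j, hj⟩ := exists_inEdges_eq_singleton hG hk
      simp only [offRootForm, hj, Finset.sum_singleton]
      exact (h k.tail hk).1 j (by simp [hj]) k (mem_outEdges.2 rfl)
    · exact (h x hx).2

theorem Arrangement.linD_eq_zero_iff [Nontrivial V] (hG : G.IsTree) {u v : Edge G r → ℝ → ℂ} :
    N.linD ℓ (u, v) = 0 ↔ (u, v) ∈ standardOffRoot G r ℓ ⊓ dirichletRoot G r := by
  rw [Submodule.mem_inf, ← offRootForm_eq_zero_iff hG]
  constructor
  · refine fun h => ⟨funext fun i => congrFun h (.inr i), fun k hk => ?_⟩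
    obtain ⟨j, rfl⟩ := exists_rootEdge N hk
    exact congrFun h (.inl j)
  · rintro ⟨h1, h2⟩
    funext i
    rcases i with j | i
    · exact h2 _ (rootEdge_tail N j)
    · exact congrFun h1 i

/-- A Robin family with inhomogeneity `b` in the last root condition. -/
theorem Arrangement.linR_eq_iff [Nontrivial V] (hG : G.IsTree) {h b : ℂ}
    {u v : Edge G r → ℝ → ℂ} :
    N.linR ℓ h (u, v) = Sum.elim (Pi.single (Fin.last N.m) b) 0 ↔
      (u, v) ∈ standardOffRoot G r ℓ ∧ ∃ c, (∀ k ∈ outEdges G r r, u k 0 = c) ∧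
        ∑ k ∈ outEdges G r r, v k 0 = b - h * c := by
  rw [← offRootForm_eq_zero_iff hG]
  constructor
  · intro H
    refine ⟨funext fun i => ?_, u (N.rootEdge 0) 0, fun k hk => ?_, ?_⟩
    · exact congrFun H (.inr i)
    · obtain ⟨j, rfl⟩ := exists_rootEdge N hk
      refine Fin.cases rfl (fun i => ?_) j
      have := congrFun H (.inl i.castSucc)
      rw [Sum.elim_inl, Pi.single_eq_of_ne (Fin.castSucc_lt_last i).ne, N.linR_inl_castSucc] at this
      exact (sub_eq_zero.1 this).symm
    · have := congrFun H (.inl (Fin.last N.m))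
      rw [Sum.elim_inl, Pi.single_eq_same, N.linR_inl_last, sum_rootEdge N fun k => v k 0] at this
      linear_combination this
  · rintro ⟨h1, c, h2, h3⟩
    funext i
    rcases i with j | i
    · refine Fin.lastCases ?_ (fun i => ?_) j
      · rw [Sum.elim_inl, Pi.single_eq_same, N.linR_inl_last, sum_rootEdge N fun k => v k 0, h3]
        have := h2 _ (rootEdge_tail N 0)
        linear_combination h * this
      · rw [Sum.elim_inl, Pi.single_eq_of_ne (Fin.castSucc_lt_last i).ne, N.linR_inl_castSucc]
        exact sub_eq_zero.2 ((h2 _ (rootEdge_tail N 0)).trans (h2 _ (rootEdge_tail N _)).symm)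
    · exact congrFun h1 i

theorem Arrangement.linR_eq_zero_iff [Nontrivial V] (hG : G.IsTree) {h : ℂ}
    {u v : Edge G r → ℝ → ℂ} :
    N.linR ℓ h (u, v) = 0 ↔
      (u, v) ∈ standardOffRoot G r ℓ ∧ ∃ c, (∀ k ∈ outEdges G r r, u k 0 = c) ∧
        ∑ k ∈ outEdges G r r, v k 0 = -(h * c) := by
  have := N.linR_eq_iff (ℓ := ℓ) hG (h := h) (b := 0) (u := u) (v := v)
  simpa using this

theorem Arrangement.linR_zero_eq_zero_iff [Nontrivial V] (hG : G.IsTree)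
    {u v : Edge G r → ℝ → ℂ} :
    N.linR ℓ 0 (u, v) = 0 ↔ (u, v) ∈ standardOffRoot G r ℓ ⊓ standardRoot G r := by
  rw [N.linR_eq_zero_iff hG, Submodule.mem_inf]
  refine and_congr_right fun _ => ?_
  constructor
  · rintro ⟨c, h1, h2⟩
    refine ⟨fun j hj k hk => ?_, by simpa using h2⟩
    change u j 0 - u k 0 = 0
    rw [h1 j hj, h1 k hk, sub_self]
  · rintro ⟨h1, h2⟩
    obtain ⟨c, hc⟩ := exists_const_of_forall_sub_eq_zero h1
    exact ⟨c, hc, by simpa using h2⟩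

end Characteristic

/-! ### Boundary value problems on the compact tree -/

section Compact
variable {V : Type*} [Fintype V] {G : SimpleGraph V} {r : V} (N : Arrangement G r) {ℓ : ℝ}
  {q : Edge G r → ℝ → ℝ}

/-- The forms see only the values of the functions and derivatives at the end points. -/
def EndpointForm (N : Arrangement G r) (ℓ : ℝ)
    (F : ((Edge G r → ℝ → ℂ) × (Edge G r → ℝ → ℂ)) →ₗ[ℂ] (N.Cond → ℂ)) : Prop :=
  ∀ p p', (∀ e, p.1 e 0 = p'.1 e 0 ∧ p.2 e 0 = p'.2 e 0 ∧ p.1 e ℓ = p'.1 e ℓ ∧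
    p.2 e ℓ = p'.2 e ℓ) → F p = F p'

theorem offRootForm_congr {u v u' v' : Edge G r → ℝ → ℂ}
    (h : ∀ e, u e 0 = u' e 0 ∧ v e 0 = v' e 0 ∧ u e ℓ = u' e ℓ ∧ v e ℓ = v' e ℓ) :
    offRootForm ℓ u v = offRootForm ℓ u' v' := by
  funext i
  rcases i with k | x
  · simp only [offRootForm, (h _).1, (h _).2.2.1]
  · simp only [offRootForm, (h _).2.1, (h _).2.2.2]

theorem Arrangement.linR_endpointForm (c : ℂ) : EndpointForm N ℓ (N.linR ℓ c) := by
  intro p p' h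
  funext i
  rcases i with j | i
  · refine Fin.lastCases ?_ (fun i => ?_) j
    · simp only [N.linR_inl_last, (h _).1, (h _).2.1]
    · simp only [N.linR_inl_castSucc, (h _).1]
  · exact congrFun (offRootForm_congr h) i

theorem IsSLSolution.eq_zero_of_ae {q : ℝ → ℝ} {lam : ℂ} {u v : ℝ → ℂ}
    (h : IsSLSolution ℓ q lam u v) (hℓ : 0 < ℓ) (hu : u =ᵐ[volume.restrict (Icc 0 ℓ)] 0) :
    u 0 = 0 ∧ v 0 = 0 := by
  have h0 : (0 : ℝ) ∈ Icc 0 ℓ := ⟨le_rfl, hℓ.le⟩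
  have hu0 : EqOn u 0 (Icc 0 ℓ) := Measure.eqOn_Icc_of_ae_eq volume hℓ.ne hu h.continuousOn_u
    continuousOn_const
  exact ⟨hu0 h0, (uniqueDiffOn_Icc hℓ 0 h0).eq_deriv (Icc 0 ℓ) (h.deriv_u 0 h0)
    ((hasDerivWithinAt_const 0 (Icc 0 ℓ) (0 : ℂ)).congr hu0 (hu0 h0))⟩

variable (hℓ : 0 < ℓ) (hq : ∀ e, MemLp (q e) 2 (volume.restrict (Icc 0 ℓ)))
include hℓ hq

/-- The characteristic determinant vanishes iff there is a nontrivial solution. -/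
theorem Arrangement.det_eq_zero_iff_exists
    {F : ((Edge G r → ℝ → ℂ) × (Edge G r → ℝ → ℂ)) →ₗ[ℂ] (N.Cond → ℂ)}
    (hF : EndpointForm N ℓ F) {lam : ℂ} :
    (N.charMatrix F ℓ q lam).det = 0 ↔ ∃ u v : Edge G r → ℝ → ℂ,
      (∀ e, IsSLSolution ℓ (q e) lam (u e) (v e)) ∧ F (u, v) = 0 ∧
      ∃ e, ¬ u e =ᵐ[volume.restrict (Icc 0 ℓ)] 0 := by
  rw [N.det_charMatrix_eq_zero_iff]
  constructor
  · rintro ⟨c, hc, h⟩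
    have hs := isSLSolution_solFamily hℓ hq lam c
    refine ⟨_, _, hs, h, ?_⟩
    by_contra! h0
    refine hc (funext fun k => ?_)
    rcases k with e | e
    · rw [← solFamily_fst_zero hℓ hq lam c e]
      exact ((hs e).eq_zero_of_ae hℓ (h0 e)).1
    · rw [← solFamily_snd_zero hℓ hq lam c e]
      exact ((hs e).eq_zero_of_ae hℓ (h0 e)).2
  · rintro ⟨u, v, hs, h, e, he⟩
    set c : Edge G r ⊕ Edge G r → ℂ := Sum.elim (fun e => u e 0) (fun e => v e 0) with hc
    have hu : ∀ e, EqOn (u e) ((solFamily ℓ q lam c).1 e) (Icc 0 ℓ) ∧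
        EqOn (v e) ((solFamily ℓ q lam c).2 e) (Icc 0 ℓ) := fun e =>
      (hs e).unique (isSLSolution_solFamily hℓ hq lam c e) hℓ (hq e)
        (by rw [solFamily_fst_zero hℓ hq, hc, Sum.elim_inl])
        (by rw [solFamily_snd_zero hℓ hq, hc, Sum.elim_inr])
    have m0 : (0 : ℝ) ∈ Icc 0 ℓ := ⟨le_rfl, hℓ.le⟩
    have m1 : ℓ ∈ Icc 0 ℓ := ⟨hℓ.le, le_rfl⟩
    refine ⟨c, fun h0 => he ?_, ?_⟩
    · refine (ae_restrict_iff' measurableSet_Icc).2 (Filter.Eventually.of_forall fun x hx => ?_)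
      rw [(hu e).1 hx, h0]
      simp [solFamily]
    · rw [← h]
      exact (hF _ _ fun e => ⟨(hu e).1 m0, (hu e).2 m0, (hu e).1 m1, (hu e).2 m1⟩).symm

/-- Solvability of the inhomogeneous boundary value problem. -/
theorem Arrangement.exists_forced_of_det_ne_zero
    {F : ((Edge G r → ℝ → ℂ) × (Edge G r → ℝ → ℂ)) →ₗ[ℂ] (N.Cond → ℂ)} {lam : ℂ}
    (hdet : (N.charMatrix F ℓ q lam).det ≠ 0) {f : Edge G r → ℝ → ℂ}
    (hf : ∀ e, MemLp (f e) 2 (volume.restrict (Icc 0 ℓ))) (b : N.Cond → ℂ) :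
    ∃ u v : Edge G r → ℝ → ℂ,
      (∀ e, IsH2 (Icc 0 ℓ) (u e) (v e) (fun x => ((q e x : ℂ) - lam) * u e x - f e x)) ∧
      F (u, v) = b := by
  -- A particular solution is taken edge by edge, ignoring the vertices; its boundary defect is then
  -- corrected by a homogeneous family.
  choose u v h _ _ using fun e => exists_isH2_forcing hℓ (hq e) lam 0 0 (hf e)
  obtain ⟨c, hc⟩ := N.exists_solFamily_of_det_ne_zero hdet (b - F (u, v))
  refine ⟨(solFamily ℓ q lam c).1 + u, (solFamily ℓ q lam c).2 + v, fun e => ?_, ?_⟩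
  · have hadd := ((isSLSolution_solFamily hℓ hq lam c e).isH2 hℓ (hq e)).add (h e)
    have hw : (fun x => ((q e x : ℂ) - lam) * ((solFamily ℓ q lam c).1 + u) e x - f e x) =
        (fun x => ((q e x : ℂ) - lam) * (solFamily ℓ q lam c).1 e x) +
          fun x => ((q e x : ℂ) - lam) * u e x - f e x := by
      funext x
      simp only [Pi.add_apply]
      ring
    rw [hw]
    exact hadd
  · have : ((solFamily ℓ q lam c).1 + u, (solFamily ℓ q lam c).2 + v) =
        solFamily ℓ q lam c + (u, v) := rfl
    rw [this, map_add, hc, sub_add_cancel]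

theorem Arrangement.surjective_of_det_ne_zero
    {F : ((Edge G r → ℝ → ℂ) × (Edge G r → ℝ → ℂ)) →ₗ[ℂ] (N.Cond → ℂ)}
    {B : Submodule ℂ ((Edge G r → ℝ → ℂ) × (Edge G r → ℝ → ℂ))}
    (hB : ∀ u v, F (u, v) = 0 → (u, v) ∈ B) {lam : ℂ} (hdet : (N.charMatrix F ℓ q lam).det ≠ 0)
    (f : L2Sum (fun _ : Edge G r => Icc 0 ℓ)) :
    ∃ p ∈ slGraph (fun _ : Edge G r => Icc 0 ℓ) q B, p.2 - lam • p.1 = f := by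
  obtain ⟨u, v, h, h0⟩ := N.exists_forced_of_det_ne_zero hℓ hq hdet
    (f := fun e => f e) (fun e => Lp.memLp (f e)) 0
  obtain ⟨p, hp, hpf, -⟩ := exists_mem_slGraph (q := q) (f := f) h (hB u v h0)
    (fun j => Filter.EventuallyEq.rfl)
  exact ⟨p, hp, hpf⟩

variable [Nontrivial V] (hG : G.IsTree)
include hG

/-- For real `lam` the two surjectivity conditions of `mem_resolventSet_slOperator` coincide, and a
nonzero determinant supplies them. -/
theorem Arrangement.phiD_eq_zero_of_mem_Sp {lam : ℝ} (h : (lam : ℂ) ∈ Sp (LD G r ℓ q)) :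
    N.phiD ℓ q lam = 0 := by
  by_contra hdet
  rw [N.phiD_eq] at hdet
  have hs := N.surjective_of_det_ne_zero hℓ hq (fun u v => (N.linD_eq_zero_iff hG).1) hdet
  exact h (mem_resolventSet_slOperator (edgeInterval hℓ) (LD_symmetric hG hℓ) hs
    (by rw [Complex.conj_ofReal]; exact hs))

theorem Arrangement.phiN_eq_zero_of_mem_Sp {lam : ℝ} (h : (lam : ℂ) ∈ Sp (LN G r ℓ q)) :
    N.phiN ℓ q lam = 0 := by
  by_contra hdet
  rw [N.phiN_eq] at hdet
  have hs := N.surjective_of_det_ne_zero hℓ hq (fun u v => (N.linR_zero_eq_zero_iff hG).1) hdet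
  exact h (mem_resolventSet_slOperator (edgeInterval hℓ) (LN_symmetric hG hℓ) hs
    (by rw [Complex.conj_ofReal]; exact hs))

/-- Zeros of the Jost function correspond to solutions on the tree with a Robin condition. -/
theorem Arrangement.jost_eq_zero_iff {ζ : ℂ} :
    N.jost ℓ q ζ = 0 ↔ ∃ (u v : Edge G r → ℝ → ℂ) (c : ℂ),
      (∀ e, IsSLSolution ℓ (q e) (ζ ^ 2) (u e) (v e)) ∧ (u, v) ∈ standardOffRoot G r ℓ ∧
      (∀ k ∈ outEdges G r r, u k 0 = c) ∧
      ∑ k ∈ outEdges G r r, v k 0 = -(Complex.I * ζ * c) ∧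
      ∃ e, ¬ u e =ᵐ[volume.restrict (Icc 0 ℓ)] 0 := by
  rw [N.jost_eq, N.det_eq_zero_iff_exists hℓ hq (N.linR_endpointForm _)]
  simp_rw [N.linR_eq_zero_iff hG]
  constructor
  · rintro ⟨u, v, h1, ⟨h2, c, h3, h4⟩, h5⟩
    exact ⟨u, v, c, h1, h2, h3, h4, h5⟩
  · rintro ⟨u, v, c, h1, h2, h3, h4, h5⟩
    exact ⟨u, v, h1, ⟨h2, c, h3, h4⟩, h5⟩

omit hG in
/-- Green's identity for a solution on the tree. -/
theorem sum_norm_sq_identity (hG : G.IsTree) {lam c d : ℂ} {u v : Edge G r → ℝ → ℂ}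
    (hs : ∀ e, IsSLSolution ℓ (q e) lam (u e) (v e)) (hB : (u, v) ∈ standardOffRoot G r ℓ)
    (hc : ∀ k ∈ outEdges G r r, u k 0 = c) (hd : ∑ k ∈ outEdges G r r, v k 0 = d) :
    (lam - starRingEnd ℂ lam) * ((∑ e, ∫ x in Icc 0 ℓ, ‖u e x‖ ^ 2 : ℝ) : ℂ) =
      starRingEnd ℂ c * d - starRingEnd ℂ d * c := by
  have h := fun e => (hs e).isH2 hℓ (hq e)
  have hg := sum_green hG hℓ h hB h hB
  rw [sum_wronsk_root hc hc, hd, neg_sub] at hg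
  rw [← hg, Complex.ofReal_sum, Finset.mul_sum]
  refine Finset.sum_congr rfl fun e _ => ?_
  rw [← integral_complex_ofReal, ← integral_const_mul]
  refine integral_congr_ae (Filter.Eventually.of_forall fun x => ?_)
  simp only [map_mul, map_sub, Complex.conj_ofReal, Complex.ofReal_pow, ← Complex.conj_mul']
  ring

omit hℓ hG hq [Nontrivial V] in
theorem sum_norm_sq_pos {lam : ℂ} {u v : Edge G r → ℝ → ℂ}
    (hs : ∀ e, IsSLSolution ℓ (q e) lam (u e) (v e))
    (hne : ∃ e, ¬ u e =ᵐ[volume.restrict (Icc 0 ℓ)] 0) :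
    0 < ∑ e, ∫ x in Icc 0 ℓ, ‖u e x‖ ^ 2 := by
  obtain ⟨e, he⟩ := hne
  have h0 : ∀ e, 0 ≤ ∫ x in Icc 0 ℓ, ‖u e x‖ ^ 2 := fun e => integral_nonneg fun _ => by positivity
  refine Finset.sum_pos' (fun e _ => h0 e) ⟨e, Finset.mem_univ e, lt_of_le_of_ne (h0 e) ?_⟩
  intro h
  have hi := (memLp_two_iff_integrable_sq_norm (memLp_of_continuousOn_Icc
    (hs e).continuousOn_u).1).1 (memLp_of_continuousOn_Icc (hs e).continuousOn_u)
  rw [eq_comm, integral_eq_zero_iff_of_nonneg (fun _ => by positivity) hi] at h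
  refine he ?_
  filter_upwards [h] with x hx
  simpa using hx

/-- Green's identity with `lam = ζ²` and `d = -iζ c`: the left side is `4i Re ζ Im ζ ∑‖u‖²`, the
right side `-2i Re ζ |c|²`. -/
theorem re_mul_eq_zero {ζ c : ℂ} {u v : Edge G r → ℝ → ℂ}
    (hs : ∀ e, IsSLSolution ℓ (q e) (ζ ^ 2) (u e) (v e)) (hB : (u, v) ∈ standardOffRoot G r ℓ)
    (hc : ∀ k ∈ outEdges G r r, u k 0 = c)
    (hd : ∑ k ∈ outEdges G r r, v k 0 = -(Complex.I * ζ * c)) :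
    ζ.re * (2 * ζ.im * (∑ e, ∫ x in Icc 0 ℓ, ‖u e x‖ ^ 2) + ‖c‖ ^ 2) = 0 := by
  have h := congrArg Complex.im (sum_norm_sq_identity hℓ hq hG hs hB hc hd)
  rw [Complex.im_mul_ofReal] at h
  have hn : ‖c‖ ^ 2 = c.re * c.re + c.im * c.im := by
    rw [← Complex.normSq_eq_norm_sq, Complex.normSq_apply]
  rw [hn]
  generalize ∑ e, ∫ x in Icc 0 ℓ, ‖u e x‖ ^ 2 = S at h ⊢
  simp [pow_two] at h
  linear_combination h / 2

/-- Zeros of the Jost function in the closed upper half plane are real or imaginary. -/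
theorem Arrangement.jost_zero_location {ζ : ℂ} (hζ : 0 ≤ ζ.im)
    (h : N.jost ℓ q ζ = 0) : ζ.im = 0 ∨ (ζ.re = 0 ∧ 0 < ζ.im) := by
  obtain ⟨u, v, c, hs, hB, hc, hd, hne⟩ := (N.jost_eq_zero_iff hℓ hq hG).1 h
  have hS := sum_norm_sq_pos hs hne
  rcases hζ.eq_or_lt with h0 | h0
  · exact .inl h0.symm
  · refine .inr ⟨?_, h0⟩
    rcases mul_eq_zero.1 (re_mul_eq_zero hℓ hq hG hs hB hc hd) with h1 | h1
    · exact h1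
    · have : 0 < 2 * ζ.im * (∑ e, ∫ x in Icc 0 ℓ, ‖u e x‖ ^ 2) := by positivity
      have : 0 ≤ ‖c‖ ^ 2 := by positivity
      linarith

/-- At real zeros of the Jost function the solution vanishes at the root together with the sum
of its derivatives. -/
theorem root_eq_zero_of_real {ζ c : ℂ} (hζ : ζ.im = 0) (hζ0 : ζ ≠ 0)
    {u v : Edge G r → ℝ → ℂ}
    (hs : ∀ e, IsSLSolution ℓ (q e) (ζ ^ 2) (u e) (v e)) (hB : (u, v) ∈ standardOffRoot G r ℓ)
    (hc : ∀ k ∈ outEdges G r r, u k 0 = c)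
    (hd : ∑ k ∈ outEdges G r r, v k 0 = -(Complex.I * ζ * c)) : c = 0 := by
  have h := re_mul_eq_zero hℓ hq hG hs hB hc hd
  have hre : ζ.re ≠ 0 := fun h0 => hζ0 (Complex.ext h0 hζ)
  simpa [hζ, hre] using h

/-- The root value `c` vanishes, and the Robin condition then makes the sum of the derivatives
vanish too; one function serves both operators. -/
theorem Arrangement.eigenvalue_of_real_zero {ζ : ℂ} (hζ : ζ.im = 0) (hζ0 : ζ ≠ 0)
    (h : N.jost ℓ q ζ = 0) :
    IsEigenvalue (LN G r ℓ q) (ζ ^ 2) ∧ IsEigenvalue (LD G r ℓ q) (ζ ^ 2) := by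
  obtain ⟨u, v, c, hs, hB, hc, hd, hne⟩ := (N.jost_eq_zero_iff hℓ hq hG).1 h
  have hc0 := root_eq_zero_of_real hℓ hq hG hζ hζ0 hs hB hc hd
  have hH := fun e => (hs e).isH2 hℓ (hq e)
  subst hc0
  constructor
  · refine (isEigenvalue_slOperator_iff (edgeInterval hℓ)).2
      ⟨u, v, _, hH, ⟨hB, fun j hj k hk => ?_, ?_⟩, fun j => Filter.EventuallyEq.rfl, hne⟩
    · change u j 0 - u k 0 = 0
      rw [hc j hj, hc k hk, sub_self]
    · simpa using hd
  · exact (isEigenvalue_slOperator_iff (edgeInterval hℓ)).2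
      ⟨u, v, _, hH, ⟨hB, hc⟩, fun j => Filter.EventuallyEq.rfl, hne⟩

end Compact

/-! ### The operator on the tree with the lead -/

section LeadOperator
variable {V : Type*} [Fintype V] {G : SimpleGraph V} {r : V} (N : Arrangement G r) {ℓ : ℝ}
  {q : Edge G r → ℝ → ℝ} (hℓ : 0 < ℓ) (hq : ∀ e, MemLp (q e) 2 (volume.restrict (Icc 0 ℓ)))
  [Nontrivial V] (hG : G.IsTree)
include hℓ hq hG

/-- Eigenvalues of `L_∞` are the squares of the zeros of the Jost function. -/
theorem Arrangement.isEigenvalue_LInf_iff {ζ : ℂ} (hζ0 : ζ ≠ 0) (hζ : 0 ≤ ζ.im) :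
    IsEigenvalue (LInf G r ℓ q) (ζ ^ 2) ↔ N.jost ℓ q ζ = 0 := by
  rw [N.jost_eq_zero_iff hℓ hq hG]
  constructor
  · intro h
    obtain ⟨u, v, w, hH, hB, hw, hne⟩ :=
      (isEigenvalue_slOperator_iff (leadInterval_cases hℓ)).1 h
    have hlead : IsH2 (Ici 0) (u none) (v none) (w none) := hH none
    have hwl : w none =ᵐ[volume.restrict (Ici 0)] fun x => -ζ ^ 2 * u none x := by
      have h1 : w none =ᵐ[volume.restrict (Ici 0)] _ := hw none
      filter_upwards [h1] with x hx
      rw [hx]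
      simp [leadPotential]
    have hs : ∀ e, IsSLSolution ℓ (q e) (ζ ^ 2) (u (some e)) (v (some e)) := fun e =>
      IsH2.isSLSolution (hH (some e)) (hw (some e))
    have h2 : v none 0 + ∑ k ∈ outEdges G r r, v (some k) 0 = 0 := hB.2.2
    have h3 := hlead.lead_deriv_eq hwl hζ le_rfl
    refine ⟨fun e => u (some e), fun e => v (some e), u none 0, hs, hB.1,
      fun k hk => (sub_eq_zero.1 (hB.2.1 k hk)).symm, by linear_combination h2 - h3, ?_⟩
    by_contra! h0
    obtain ⟨j, hj⟩ := hne
    refine hj ?_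
    rcases j with _ | e
    · have h4 : u none 0 = 0 :=
        (sub_eq_zero.1 (hB.2.1 _ (rootEdge_tail N 0))).trans ((hs _).eq_zero_of_ae hℓ (h0 _)).1
      refine (ae_restrict_iff' measurableSet_Ici).2 (Filter.Eventually.of_forall fun x hx => ?_)
      rw [hlead.lead_eq_exp hwl hζ hx, h4, zero_mul]
      rfl
    · exact h0 e
  · rintro ⟨u, v, c, hs, hB, hc, hd, e, he⟩
    -- The extension to the lead is `c e^{iζx}` if `Im ζ > 0`. For real `ζ` this is not in `L²`, but
    -- then `c = 0` and the zero function fits.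
    have hl : ∃ u₀ v₀ w₀ : ℝ → ℂ, IsH2 (Ici 0) u₀ v₀ w₀ ∧ (∀ x, w₀ x = -ζ ^ 2 * u₀ x) ∧
        u₀ 0 = c ∧ v₀ 0 = Complex.I * ζ * c := by
      rcases hζ.eq_or_lt with h0 | h0
      · have hc0 := root_eq_zero_of_real hℓ hq hG h0.symm hζ0 hs hB hc hd
        exact ⟨0, 0, 0, IsH2.zero _, by simp, by simp [hc0], by simp [hc0]⟩
      · refine ⟨_, _, _, (isH2_exp (c := Complex.I * ζ) (by simpa using h0)).smul c,
          fun x => ?_, ?_, ?_⟩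
        · simp only [Pi.smul_apply, smul_eq_mul, mul_pow, Complex.I_sq]
          ring
        · simp
        · simp
          ring
    obtain ⟨u₀, v₀, w₀, hH₀, hw₀, hu₀, hv₀⟩ := hl
    refine (isEigenvalue_slOperator_iff (leadInterval_cases hℓ)).2
      ⟨fun j => j.elim u₀ u, fun j => j.elim v₀ v,
        fun j => j.elim w₀ fun e x => ((q e x : ℂ) - ζ ^ 2) * u e x, ?_,
        ⟨hB, fun k hk => ?_, ?_⟩, ?_, some e, he⟩
    · rintro (_ | e)
      · exact hH₀
      · exact (hs e).isH2 hℓ (hq e)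
    · change u₀ 0 - u k 0 = 0
      rw [hu₀, hc k hk, sub_self]
    · change v₀ 0 + ∑ k ∈ outEdges G r r, v k 0 = 0
      rw [hv₀, hd, add_neg_cancel]
    · rintro (_ | e)
      · refine Filter.Eventually.of_forall fun x => ?_
        change w₀ x = _
        rw [hw₀]
        simp [leadPotential]
      · exact Filter.EventuallyEq.rfl

/-- `L_∞ - ζ²` is onto for `Im ζ > 0` unless the Jost function vanishes at `ζ`. -/
theorem Arrangement.surjective_LInf {ζ : ℂ} (hζ : 0 < ζ.im) (h : N.jost ℓ q ζ ≠ 0)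
    (f : L2Sum (leadInterval G r ℓ)) :
    ∃ p ∈ slGraph (leadInterval G r ℓ) (leadPotential G r q) (standardLead G r ℓ), p.2 - (ζ ^ 2) • p.1 = f := by
  have hfl : MemLp (f none) 2 (volume.restrict (Ici 0)) := Lp.memLp (f none)
  have hft : ∀ e : Edge G r, MemLp (f (some e)) 2 (volume.restrict (Icc 0 ℓ)) := fun e =>
    Lp.memLp (f (some e))
  obtain ⟨u₀, v₀, h₀⟩ := exists_lead_solution hζ hfl
  rw [N.jost_eq] at h
  -- On the lead `u₀ + (c - u₀(0)) e^{iζx}` has value `c` at `0` and derivative `v₀(0) + iζ (c -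
  -- u₀(0))`. Kirchhoff's condition thus becomes the Robin condition with right-hand side `iζ u₀(0)
  -- - v₀(0)`.
  obtain ⟨u, v, hH, hb⟩ := N.exists_forced_of_det_ne_zero hℓ hq h hft
    (Sum.elim (Pi.single (Fin.last N.m) (Complex.I * ζ * u₀ 0 - v₀ 0)) 0)
  obtain ⟨hB, c, hc, hd⟩ := (N.linR_eq_iff hG).1 hb
  have he := (isH2_exp (c := Complex.I * ζ) (by simpa using hζ)).smul (c - u₀ 0)
  have hH₀ := h₀.add he
  set u₁ : ℝ → ℂ := u₀ + (c - u₀ 0) • fun x : ℝ => Complex.exp (Complex.I * ζ * x) with hu₁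
  set v₁ : ℝ → ℂ := v₀ + (c - u₀ 0) •
    fun x : ℝ => Complex.I * ζ * Complex.exp (Complex.I * ζ * x) with hv₁
  have hmem : ((fun j => j.elim u₁ u, fun j => j.elim v₁ v) :
      (Option (Edge G r) → ℝ → ℂ) × (Option (Edge G r) → ℝ → ℂ)) ∈ standardLead G r ℓ := by
    refine ⟨hB, fun k hk => ?_, ?_⟩
    · change u₁ 0 - u k 0 = 0
      rw [hc k hk, hu₁]
      simp
    · change v₁ 0 + ∑ k ∈ outEdges G r r, v k 0 = 0
      rw [hd, hv₁]
      simp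
      ring
  obtain ⟨p, hp, hpf, -⟩ := exists_mem_slGraph (I := leadInterval G r ℓ)
    (q := leadPotential G r q) (B := standardLead G r ℓ) (z := ζ ^ 2) (f := f)
    (w := fun j => j.elim _ fun e x => ((q e x : ℂ) - ζ ^ 2) * u e x - f (some e) x)
    (by
      rintro (_ | e)
      · exact hH₀
      · exact hH e) hmem
    (by
      rintro (_ | e)
      · refine Filter.Eventually.of_forall fun x => ?_
        simp only [hu₁, Option.elim_none, Pi.add_apply, Pi.smul_apply, smul_eq_mul,
          leadPotential, mul_pow, Complex.I_sq]
        simp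
        ring
      · exact Filter.EventuallyEq.rfl)
  exact ⟨p, hp, hpf⟩

/-- The positive half line belongs to the spectrum of `L_∞`. -/
theorem mem_Sp_LInf_of_pos {μ : ℝ} (hμ : 0 < μ) : (μ : ℂ) ∈ Sp (LInf G r ℓ q) := by
  intro hres
  -- The right-hand side is chosen so that any solution must equal `e^{cx}` on the lead: `Re c < 0`
  -- makes this square integrable, and `Im c ≠ 0` will be incompatible with a real spectral
  -- parameter on the tree.
  set c : ℂ := -1 + Complex.I with hc
  have he := isH2_exp (c := c) (by simp [hc])
  let g : ℝ → ℂ := fun x => -(c ^ 2 + μ) * Complex.exp (c * x)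
  have hg : MemLp g 2 (volume.restrict (Ici 0)) := he.memLp_u.const_mul _
  let f : L2Sum (leadInterval G r ℓ) := WithLp.toLp 2 fun j => match j with
    | none => (hg.toLp g : Lp ℂ 2 (volume.restrict (Ici (0 : ℝ))))
    | some _ => (0 : Lp ℂ 2 (volume.restrict (Icc 0 ℓ)))
  obtain ⟨p, hp, hpf⟩ := exists_mem_graph_of_mem_resolventSet hres f
  rw [LInf_graph hℓ] at hp
  obtain ⟨u, v, w, hH, hB, h3, h4⟩ := hp
  have key : ∀ j, w j =ᵐ[volume.restrict (leadInterval G r ℓ j)]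
      fun x => ((leadPotential G r q j x : ℂ) - μ) * u j x - f j x := fun j => by
    have h5 : f j = p.2 j - (μ : ℂ) • p.1 j := by rw [← hpf]; rfl
    rw [h5]
    filter_upwards [h3 j, h4 j, Lp.coeFn_sub (p.2 j) ((μ : ℂ) • p.1 j),
      Lp.coeFn_smul (μ : ℂ) (p.1 j)] with x e1 e2 e3 e4
    rw [e3, Pi.sub_apply, e4, Pi.smul_apply, e1, e2, smul_eq_mul]
    ring
  have hs : ∀ e, IsSLSolution ℓ (q e) μ (u (some e)) (v (some e)) := fun e => by
    refine IsH2.isSLSolution (hH (some e)) ?_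
    have h1 : w (some e) =ᵐ[volume.restrict (Icc 0 ℓ)] _ := key (some e)
    filter_upwards [h1, Lp.coeFn_zero ℂ 2 (volume.restrict (Icc 0 ℓ))] with x e1 e2
    rw [e1]
    change ((q e x : ℂ) - μ) * u (some e) x - (0 : Lp ℂ 2 (volume.restrict (Icc 0 ℓ))) x = _
    rw [e2]
    simp
  -- The difference to `e^{cx}` solves the homogeneous equation with real `ζ = √μ`, hence vanishes.
  have hl : IsH2 (Ici 0) _ _ _ := IsH2.add (hH none) (he.smul (-1))
  have hsq : ((Real.sqrt μ : ℝ) : ℂ) ^ 2 = μ := by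
    rw [← Complex.ofReal_pow, Real.sq_sqrt hμ.le]
  have h0 := hl.lead_eq_zero (ζ := (Real.sqrt μ : ℝ)) (by
    have h1 : w none =ᵐ[volume.restrict (Ici 0)] _ := key none
    filter_upwards [h1, hg.coeFn_toLp] with x e1 e2
    simp only [Pi.add_apply, Pi.smul_apply, smul_eq_mul]
    rw [e1]
    change ((leadPotential G r q none x : ℂ) - μ) * u none x -
      (hg.toLp g : Lp ℂ 2 (volume.restrict (Ici (0 : ℝ)))) x + _ = _
    rw [e2, hsq]
    simp [leadPotential, g]
    ring) (by simp) (by simpa using (Real.sqrt_pos.2 hμ).ne') le_rfl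
  have h1 : u none 0 = 1 := by
    have := h0.1
    simp only [Pi.add_apply, Pi.smul_apply, smul_eq_mul, Complex.ofReal_zero, mul_zero,
      Complex.exp_zero] at this
    linear_combination this
  have h2 : v none 0 = c := by
    have := h0.2
    simp only [Pi.add_apply, Pi.smul_apply, smul_eq_mul, Complex.ofReal_zero, mul_zero,
      Complex.exp_zero] at this
    linear_combination this
  have hB2 : v none 0 + ∑ k ∈ outEdges G r r, v (some k) 0 = 0 := hB.2.2
  -- On the tree the equation is homogeneous with real `μ`, so Green's identity with root value `1`
  -- and derivative sum `-c` forces `c` to be real.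
  have hid := sum_norm_sq_identity (d := -c) hℓ hq hG hs hB.1
    (fun k hk => (sub_eq_zero.1 (hB.2.1 k hk)).symm) (by linear_combination hB2 - h2)
  change _ = starRingEnd ℂ (u none 0) * _ - _ * (u none 0) at hid
  rw [h1, Complex.conj_ofReal, sub_self, zero_mul] at hid
  have := congrArg Complex.im hid
  simp [hc] at this
  norm_num at this

end LeadOperator

/-! ### Analyticity of the Jost function and isolated eigenvalues -/

section Analytic
variable {V : Type*} [Fintype V] {G : SimpleGraph V} {r : V} (N : Arrangement G r) {ℓ : ℝ}
  {q : Edge G r → ℝ → ℝ} (hℓ : 0 < ℓ) (hq : ∀ e, MemLp (q e) 2 (volume.restrict (Icc 0 ℓ)))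
include hℓ hq

omit [Fintype V] in
-- At `0` the initial values do not depend on `lam`; at `ℓ` they are the entire functions found
-- above.
theorem differentiable_basisFamily (k : Edge G r ⊕ Edge G r) (e : Edge G r) :
    (Differentiable ℂ fun lam => (basisFamily ℓ q lam k).1 e 0) ∧
    (Differentiable ℂ fun lam => (basisFamily ℓ q lam k).2 e 0) ∧
    (Differentiable ℂ fun lam => (basisFamily ℓ q lam k).1 e ℓ) ∧
    (Differentiable ℂ fun lam => (basisFamily ℓ q lam k).2 e ℓ) := by
  rcases k with e' | e' <;> simp only [basisFamily] <;> by_cases he : e = e'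
  · subst he
    simp only [Pi.single_eq_same, (slSol_spec hℓ (hq e) _ _ _).2.1,
      (slSol_spec hℓ (hq e) _ _ _).2.2]
    exact ⟨differentiable_const _, differentiable_const _,
      differentiable_slSol_fst hℓ (hq e) _ _, differentiable_slSol_snd hℓ (hq e) _ _⟩
  · simp [Pi.single_eq_of_ne he]
  · subst he
    simp only [Pi.single_eq_same, (slSol_spec hℓ (hq e) _ _ _).2.1,
      (slSol_spec hℓ (hq e) _ _ _).2.2]
    exact ⟨differentiable_const _, differentiable_const _,
      differentiable_slSol_fst hℓ (hq e) _ _, differentiable_slSol_snd hℓ (hq e) _ _⟩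
  · simp [Pi.single_eq_of_ne he]

theorem differentiable_offRootForm (k : Edge G r ⊕ Edge G r) (i) :
    Differentiable ℂ fun lam =>
      offRootForm ℓ (basisFamily ℓ q lam k).1 (basisFamily ℓ q lam k).2 i := by
  have h := differentiable_basisFamily hℓ hq k
  rcases i with j | x
  · exact (Differentiable.fun_sum fun e _ => (h e).2.2.1).sub (h _).1
  · exact (Differentiable.fun_sum fun e _ => (h e).2.2.2).sub
      (Differentiable.fun_sum fun e _ => (h e).2.1)

omit hℓ hq in
theorem Arrangement.differentiable_det
    {F : ((Edge G r → ℝ → ℂ) × (Edge G r → ℝ → ℂ)) →ₗ[ℂ] (N.Cond → ℂ)}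
    (hF : ∀ i k, Differentiable ℂ fun lam => F (basisFamily ℓ q lam k) i) :
    Differentiable ℂ fun lam => (N.charMatrix F ℓ q lam).det := by
  simp only [Matrix.det_apply]
  refine Differentiable.fun_sum fun σ _ => Differentiable.const_smul ?_ _
  refine Differentiable.fun_finsetProd fun i _ => ?_
  exact hF _ _

theorem Arrangement.differentiable_jost : Differentiable ℂ (N.jost ℓ q) := by
  have hD : Differentiable ℂ fun lam => N.phiD ℓ q lam := by
    simp only [N.phiD_eq]
    refine N.differentiable_det fun i k => ?_
    rcases i with j | i
    · exact (differentiable_basisFamily hℓ hq k _).1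
    · exact differentiable_offRootForm hℓ hq k i
  have hN : Differentiable ℂ fun lam => N.phiN ℓ q lam := by
    simp only [N.phiN_eq]
    refine N.differentiable_det fun i k => ?_
    have h := differentiable_basisFamily hℓ hq k
    rcases i with j | i
    · refine Fin.lastCases ?_ (fun i => ?_) j
      · simp only [N.linR_inl_last, zero_mul, add_zero]
        exact Differentiable.fun_sum fun e _ => (h _).2.1
      · simp only [N.linR_inl_castSucc]
        exact (h _).1.sub (h _).1
    · exact differentiable_offRootForm hℓ hq k i
  have h2 : Differentiable ℂ fun ζ : ℂ => ζ ^ 2 := by fun_prop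
  exact (hN.comp h2).add ((differentiable_id.const_mul Complex.I).mul (hD.comp h2))

theorem Arrangement.isIsolatedEigenvalue_LInf [Nontrivial V] (hG : G.IsTree) {k : ℝ} (hk : 0 < k)
    (h : N.jost ℓ q (Complex.I * k) = 0) :
    IsIsolatedEigenvalue (LInf G r ℓ q) ((-k ^ 2 : ℝ) : ℂ) := by
  have hk0 : Complex.I * (k : ℂ) ≠ 0 := by simp [hk.ne']
  have hsq : (Complex.I * (k : ℂ)) ^ 2 = ((-k ^ 2 : ℝ) : ℂ) := by
    rw [mul_pow, Complex.I_sq]; push_cast; ring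
  refine ⟨hsq ▸ (N.isEigenvalue_LInf_iff hℓ hq hG hk0 (by simpa using hk.le)).2 h, ?_⟩
  have han : AnalyticAt ℂ (N.jost ℓ q) (Complex.I * k) :=
    (N.differentiable_jost hℓ hq).analyticAt _
  rcases han.eventually_eq_zero_or_eventually_ne_zero with h0 | h0
  -- If `E` vanished near `ik`, it would vanish at `ik + t` with small `t > 0`, off the imaginary
  -- axis.
  · exfalso
    have ht : Filter.Tendsto (fun t : ℝ => Complex.I * (k : ℂ) + t) (nhdsWithin 0 (Ioi 0))
        (nhds (Complex.I * k)) := by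
      have : Continuous fun t : ℝ => Complex.I * (k : ℂ) + t := by fun_prop
      simpa using (this.tendsto 0).mono_left nhdsWithin_le_nhds
    obtain ⟨t, ht0, htpos⟩ := ((ht.eventually h0).and self_mem_nhdsWithin).exists
    have htpos : 0 < t := htpos
    rcases N.jost_zero_location hℓ hq hG (by simpa using hk.le) ht0 with h1 | h1
    · simp [hk.ne'] at h1
    · simp [htpos.ne'] at h1
  · set lam : ℂ := ((-k ^ 2 : ℝ) : ℂ) with hlam
    -- The branch of `√w` with value `ik` at `-k²`; it is continuous there since `-w` is near the
    -- positive axis, and so keeps a positive imaginary part nearby.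
    set g : ℂ → ℂ := fun w => Complex.I * (-w) ^ (1 / 2 : ℂ) with hg
    have hgsq : ∀ w, g w ^ 2 = w := fun w => by
      have : ((-w) ^ (1 / 2 : ℂ)) ^ 2 = -w := by
        rw [one_div]
        exact Complex.cpow_nat_inv_pow (-w) two_ne_zero
      rw [hg, mul_pow, this, Complex.I_sq]
      ring
    have hglam : g lam = Complex.I * k := by
      have h1 : -lam = ((k ^ 2 : ℝ) : ℂ) := by rw [hlam]; push_cast; ring
      have h2 : (1 / 2 : ℂ) = ((1 / 2 : ℝ) : ℂ) := by push_cast; rfl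
      simp only [hg]
      rw [h1, h2, ← Complex.ofReal_cpow (by positivity), ← Real.sqrt_eq_rpow,
        Real.sqrt_sq hk.le]
    have hgc : ContinuousAt g lam := by
      refine continuousAt_const.mul ?_
      refine ContinuousAt.cpow continuousAt_neg continuousAt_const (.inl ?_)
      have h1 : -lam = ((k ^ 2 : ℝ) : ℂ) := by rw [hlam]; push_cast; ring
      rw [h1]
      simpa only [Complex.ofReal_re] using pow_pos hk 2
    have hev : ∀ᶠ w in nhds lam, (g w ≠ Complex.I * k → N.jost ℓ q (g w) ≠ 0) ∧ 0 < (g w).im := by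
      rw [eventually_nhdsWithin_iff] at h0
      rw [← hglam] at h0 ⊢
      refine (hgc.eventually h0).and ?_
      refine hgc.eventually (Complex.continuous_im.continuousAt.eventually
        (lt_mem_nhds (a := (0 : ℝ)) ?_))
      rw [hglam]
      simpa using hk
    obtain ⟨ε, hε, hball⟩ := Metric.eventually_nhds_iff.1 hev
    refine ⟨ε, hε, fun w hw hdist => ?_⟩
    by_contra hne
    have surj : ∀ w, dist w lam < ε → w ≠ lam → ∀ f, ∃ p ∈ slGraph (leadInterval G r ℓ) (leadPotential G r q) (standardLead G r ℓ),
        p.2 - w • p.1 = f := fun w hd hne f => by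
      have h1 := hball hd
      have h2 : g w ≠ Complex.I * k := fun h => hne (by rw [← hgsq w, h, hsq])
      have := N.surjective_LInf hℓ hq hG h1.2 (h1.1 h2) f
      rwa [hgsq] at this
    have hlc : starRingEnd ℂ lam = lam := Complex.conj_ofReal _
    -- The punctured disc is centred at a real point, so it contains `conj w` along with `w`, and
    -- both operators are onto.
    refine hw (mem_resolventSet_slOperator (leadInterval_cases hℓ) (LInf_symmetric hG hℓ) (surj w hdist hne)
      (surj _ ?_ ?_))
    · rwa [← hlc, Complex.dist_conj_conj]
    · intro h
      exact hne (by rw [← Complex.conj_conj w, h, hlc])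

end Analytic

end QTree

end

theorem lemma4p3 {V : Type*} [Fintype V] [Nontrivial V] (G : SimpleGraph V) (hG : G.IsTree)
    (r : V) (ℓ : ℝ) (hℓ : 0 < ℓ) (q : QTree.Edge G r → ℝ → ℝ)
    (hq : ∀ e, MemLp (q e) 2 (volume.restrict (Icc 0 ℓ)))
    (N : QTree.Arrangement G r) :
    -- (i) eigenvalues are the squares of the zeros of the Jost function
    (∀ ζ : ℂ, ζ ≠ 0 → 0 ≤ ζ.im →
      (QTree.IsEigenvalue (QTree.LInf G r ℓ q) (ζ ^ 2) ↔ N.jost ℓ q ζ = 0)) ∧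
    -- (ii) location of the zeros
    (∀ ζ : ℂ, ζ ≠ 0 → 0 ≤ ζ.im → N.jost ℓ q ζ = 0 → ζ.im = 0 ∨ (ζ.re = 0 ∧ 0 < ζ.im)) ∧
    -- (iii) real zeros
    (∀ k : ℝ, k ≠ 0 →
      (N.jost ℓ q (k : ℂ) = 0 ↔
        ((k ^ 2 : ℝ) : ℂ) ∈ QTree.Sp (QTree.LN G r ℓ q) ∩ QTree.Sp (QTree.LD G r ℓ q)) ∧
      (N.jost ℓ q (k : ℂ) = 0 →
        QTree.IsEigenvalue (QTree.LN G r ℓ q) ((k ^ 2 : ℝ) : ℂ) ∧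
        QTree.IsEigenvalue (QTree.LD G r ℓ q) ((k ^ 2 : ℝ) : ℂ) ∧
        QTree.IsEmbeddedEigenvalue (QTree.LInf G r ℓ q) ((k ^ 2 : ℝ) : ℂ))) ∧
    -- (iv) zeros on the positive imaginary half line
    (∀ k : ℝ, 0 < k →
      (N.jost ℓ q (Complex.I * k) = 0 ↔
        QTree.IsIsolatedEigenvalue (QTree.LInf G r ℓ q) ((-k ^ 2 : ℝ) : ℂ))) ∧
    (∀ lam : ℝ, lam < 0 →
      (lam : ℂ) ∈ QTree.Sp (QTree.LN G r ℓ q) ∩ QTree.Sp (QTree.LD G r ℓ q) →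
        QTree.IsIsolatedEigenvalue (QTree.LInf G r ℓ q) (lam : ℂ)) := by
  have hI : ∀ k : ℝ, (Complex.I * (k : ℂ)) ^ 2 = ((-k ^ 2 : ℝ) : ℂ) := fun k => by
    rw [mul_pow, Complex.I_sq]
    push_cast
    ring
  refine ⟨fun ζ hζ0 hζ => N.isEigenvalue_LInf_iff hℓ hq hG hζ0 hζ,
    fun ζ _ hζ h => N.jost_zero_location hℓ hq hG hζ h, fun k hk => ?_, fun k hk => ?_,
    fun lam hlam h => ?_⟩
  · have hk0 : (k : ℂ) ≠ 0 := Complex.ofReal_ne_zero.2 hk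
    have him : (k : ℂ).im = 0 := Complex.ofReal_im k
    have key : N.jost ℓ q (k : ℂ) = 0 → QTree.IsEigenvalue (QTree.LN G r ℓ q) ((k ^ 2 : ℝ) : ℂ) ∧
        QTree.IsEigenvalue (QTree.LD G r ℓ q) ((k ^ 2 : ℝ) : ℂ) := fun h => by
      rw [Complex.ofReal_pow]
      exact N.eigenvalue_of_real_zero hℓ hq hG him hk0 h
    refine ⟨⟨fun h => ⟨(key h).1.mem_Sp, (key h).2.mem_Sp⟩, fun h => ?_⟩,
      fun h => ⟨(key h).1, (key h).2, ?_⟩⟩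
    · rw [QTree.Arrangement.jost, ← Complex.ofReal_pow, N.phiN_eq_zero_of_mem_Sp hℓ hq hG h.1,
        N.phiD_eq_zero_of_mem_Sp hℓ hq hG h.2, mul_zero, add_zero]
    · have he := (N.isEigenvalue_LInf_iff hℓ hq hG hk0 him.ge).2 h
      rw [← Complex.ofReal_pow] at he
      refine ⟨he, he.mem_Sp, fun hiso => ?_⟩
      obtain ⟨ε, hε, hball⟩ := hiso.1.2
      -- Any point of the positive half line within `ε` of `k²` refutes isolation, as it belongs to
      -- the spectrum.
      have hpos : 0 < k ^ 2 + ε / 2 := by positivity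
      have := Complex.ofReal_injective (hball _ (QTree.mem_Sp_LInf_of_pos hℓ hq hG hpos) (by
        rw [Complex.dist_of_im_eq (by simp), Complex.ofReal_re, Complex.ofReal_re, Real.dist_eq,
          add_sub_cancel_left, abs_of_pos (half_pos hε)]
        exact half_lt_self hε))
      linarith
  · refine ⟨N.isIsolatedEigenvalue_LInf hℓ hq hG hk, fun h => ?_⟩
    rw [← N.isEigenvalue_LInf_iff hℓ hq hG (by simp [hk.ne']) (by simpa using hk.le), hI]
    exact h.1
  · have hsq : -Real.sqrt (-lam) ^ 2 = lam := by
      rw [Real.sq_sqrt (by linarith), neg_neg]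
    have := N.isIsolatedEigenvalue_LInf hℓ hq hG (Real.sqrt_pos.2 (neg_pos.2 hlam)) (by
      rw [QTree.Arrangement.jost, hI, hsq, N.phiN_eq_zero_of_mem_Sp hℓ hq hG h.1,
        N.phiD_eq_zero_of_mem_Sp hℓ hq hG h.2, mul_zero, add_zero])
    rwa [hsq] at this
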